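/- **Setting.** Let $d\in\{2,3\}$, $L,H>0$, and let $\Omega=\mathbb T^{d-1}\times(-H,H)$, where $\mathbb T=[-L,L]|_{\{-L,L\}}$ (functions on $\Omega$ are $2L$-periodic in $x_1,\dots,x_{d-1}$). Let $T>0$ and let $\vartheta_B>0$ belong to $W^{2,\infty}((0,T)\times\Omega)$, identified with its continuous representative on $[0,T]\times\overline\Omega$. *Mesh.* $\Omega$ is divided into uniform cubes $K$ of size $h\in(0,1)$, $|K|=h^d$. $\mathcal E$ is the set of all faces, $\mathcal E_{\rm ext}$ the set of the faces on $\{x_d=\pm H\}$, $\mathcal E_{\rm int}=\mathcal E\setminus\mathcal E_{\rm ext}$, and $\mathcal E(K)$ the set of faces of $K$. For a face $\sigma$ orthogonal to $e_i$, $D_\sigma$ is the cube of size $h$ centred at the centre of $\sigma$. $Q_h$ is the space of functions that are constant on every cube. Time is divided by $t_k=k\Delta t$, $k=0,\dots,N_T$, $t_{N_T}=T$, $\Delta t\in(0,1)$, with $0<\underline c\,h\le\Delta t\le\overline c\,h$. *Discrete operators.* For $v\in Q_h$ and a face $\sigma$ with normal $n$ (outer on $\mathcal E_{\rm ext}$),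 $v^{\rm in},v^{\rm out}$ are the one-sided values at $\sigma$, $[[v]]=v^{\rm out}-v^{\rm in}$, $\{\{v\}\}=\frac12(v^{\rm in}+v^{\rm out})$; on $\mathcal E_{\rm ext}$ the value $v^{\rm out}$ is fixed by the boundary conditions below. On a cube $K$, $\nabla_h v=\sum_{\sigma\in\mathcal E(K)}n\otimes\{\{v\}\}/h$ with $n$ the outer normal to $K$, and $\mathbb D_h v=\frac12(\nabla_h v+\nabla_h^Tv)$ for $v\in Q_h^d$. The $i$-th component of $\nabla_{\mathcal E}v$ equals $[[v]]/h$, with the jump taken in the direction $n=e_i$, on $D_\sigma\cap\Omega$ for every face $\sigma$ (interior or exterior) orthogonal to $e_i$. *Discrete functions.* For $k=0,\dots,N_T$ let $\varrho_h^k,\vartheta_h^k\in Q_h$, $\mathbf u_h^k\in Q_h^d$ satisfy the boundary conditions $\{\{\mathbf u_h^k\}\}_\sigma=0$ and $\{\{\vartheta_h^k\}\}_\sigma=\frac1{|\sigma|}\int_\sigma\vartheta_B(t_k,\cdot)\,dS$ for all $\sigma\in\mathcal E_{\rm ext}$, and let $(\varrho_h,\mathbf u_h,\vartheta_h)(t)=(\varrho_h^k,\mathbf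 u_h^k,\vartheta_h^k)$ for $t\in[t_k,t_{k+1})$. **Lemma (Compatibility).** Let $\alpha\in(-1,1)$. Suppose that, with a constant $C_0$ independent of $h,\Delta t$, 1. (uniform bounds) $0<\underline\varrho\le\varrho_h\le\overline\varrho$, $0<\underline\vartheta\le\vartheta_h\le\overline\vartheta$, $|\mathbf u_h|\le\overline u$; 2. (gradient bounds) $\|\nabla_{\mathcal E}\vartheta_h\|_{L^2((0,T)\times\Omega)}+\|\nabla_h\mathbf u_h\|_{L^2((0,T)\times\Omega)}\le C_0$; 3. (jump estimate) $\displaystyle\int_0^T\int_{\mathcal E_{\rm int}}\big(h^\alpha+|\{\{\mathbf u_h\}\}\cdot n|\big)\,\big|[[(\varrho_h,\mathbf u_h,\vartheta_h)]]\big|^2\,dS\,dt\le C_0$. Put $$\Lambda=T+\|\vartheta_B\|_{W^{2,\infty}((0,T)\times\Omega)}+\frac1{\underline\varrho}+\overline\varrho+\frac1{\underline\vartheta}+\overline\vartheta+\overline u+\frac1{\underline c}+\overline c .$$ Then there is a constant $C$, depending only on $d,L,H$, on $C_0$ and on (an upper bound for) $\Lambda$, such that $$\left|\int_0^T\!\!\int_\Omega\big(\mathbf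 u_h\cdot{\rm div}_x\mathbb S+\mathbb D_h(\mathbf u_h):\mathbb S\big)\,dx\,dt\right|\le C\,\|\mathbb S\|_{L^2(0,T;W^{1,2}(\Omega;\mathbb R^{d\times d}_{\rm sym}))}\,h^{(1-\alpha)/2}$$ for every $\mathbb S\in L^2(0,T;W^{1,2}(\Omega;\mathbb R^{d\times d}_{\rm sym}))$, and $$\left|\int_0^T\!\!\int_\Omega\big((\vartheta_h-\vartheta_B)\,{\rm div}_x\Psi+(\nabla_{\mathcal E}\vartheta_h-\nabla_x\vartheta_B)\cdot\Psi\big)\,dx\,dt\right|\le C\,\|\Psi\|_{L^2(0,T;W^{1,2}(\Omega;\mathbb R^d))}\,h$$ for every $\Psi\in L^2(0,T;W^{1,2}(\Omega;\mathbb R^d))$. The test functions $\mathbb S$, $\Psi$ need not vanish at $x_d=\pm H$. -/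

import Mathlib

open MeasureTheory Set
open scoped ContDiff

namespace FV

/-! ### The slab `Ω = 𝕋ⁿ × (-H, H)`, `d = n + 1`

Functions on the slab are written in the fundamental box `(-L, L)ⁿ × (-H, H)` of `ℝⁿ⁺¹`; the last
coordinate is the vertical one, all others are `2L`-periodic. -/

/-- Points of `ℝᵈ`, `d = n + 1`. -/
abbrev Pt (n : ℕ) : Type := Fin (n + 1) → ℝ

/-- Multi-indices of cells and faces. -/
abbrev Idx (n : ℕ) : Type := Fin (n + 1) → ℤ

/-- Half of the width of the slab in direction `i`. -/
noncomputable def halfWidth {n : ℕ} (L H : ℝ) (i : Fin (n + 1)) : ℝ :=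
  if i = Fin.last n then H else L

/-- The fundamental box of the slab. -/
def box (n : ℕ) (L H : ℝ) : Set (Pt n) :=
  Set.univ.pi fun i => Ioo (-halfWidth L H i) (halfWidth L H i)

/-- The space-time cylinder `(0,T) × Ω`. -/
def cylinder (n : ℕ) (T L H : ℝ) : Set (ℝ × Pt n) := Ioo 0 T ×ˢ box n L H

/-- `2L`-periodicity in the horizontal variables. -/
def HPeriodic {n : ℕ} (L : ℝ) (f : Pt n → ℝ) : Prop :=
  ∀ i : Fin (n + 1), i ≠ Fin.last n → ∀ x, f (x + Pi.single i (2 * L)) = f x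

/-! ### Weak derivatives and Sobolev spaces -/

/-- `C_c^∞(𝕋ⁿ × (-H, H))`: smooth, horizontally periodic, vanishing near `x_d = ±H`. -/
def testSpace (n : ℕ) (L H : ℝ) : Set (Pt n → ℝ) :=
  {φ | ContDiff ℝ ∞ φ ∧ HPeriodic L φ ∧ ∃ r < H, ∀ x, r < |x (Fin.last n)| → φ x = 0}

/-- `C_c^∞((0,T) × 𝕋ⁿ × (-H, H))`. -/
def testSpaceTime (n : ℕ) (T L H : ℝ) : Set (ℝ × Pt n → ℝ) :=
  {φ | ContDiff ℝ ∞ φ ∧ (∀ t, HPeriodic L fun x => φ (t, x)) ∧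
    ∃ r < H, ∃ ε > 0, ∀ t x, (r < |x (Fin.last n)| ∨ t < ε ∨ T - ε < t) → φ (t, x) = 0}

/-- `g` is the weak derivative of `f` on `D` in the direction `v`, tested against `𝒟`. -/
def HasWeakDeriv {V : Type*} [NormedAddCommGroup V] [NormedSpace ℝ V] [MeasureSpace V]
    (D : Set V) (𝒟 : Set (V → ℝ)) (v : V) (f g : V → ℝ) : Prop :=
  ∀ φ ∈ 𝒟, ∫ x in D, f x * fderiv ℝ φ x v = -∫ x in D, g x * φ x

/-- An element of `L²(0,T; W^{1,2}(Ω))`, with its weak spatial derivatives. -/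
structure L2W12 (n : ℕ) (T L H : ℝ) where
  val : ℝ × Pt n → ℝ
  grad : Fin (n + 1) → ℝ × Pt n → ℝ
  memLp_val : MemLp val 2 (volume.restrict (cylinder n T L H))
  memLp_grad : ∀ i, MemLp (grad i) 2 (volume.restrict (cylinder n T L H))
  weak : ∀ᵐ t ∂(volume.restrict (Ioo 0 T)), ∀ i,
    HasWeakDeriv (box n L H) (testSpace n L H) (Pi.single i 1)
      (fun x => val (t, x)) (fun x => grad i (t, x))

/-- The square of the norm of `L²(0,T; W^{1,2}(Ω))`. -/
noncomputable def L2W12.normSq {n : ℕ} {T L H : ℝ} (f : L2W12 n T L H) : ℝ :=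
  (∫ p in cylinder n T L H, f.val p ^ 2) + ∑ i, ∫ p in cylinder n T L H, f.grad i p ^ 2

/-- The norm of `L²(0,T; W^{1,2}(Ω; ℝᵈ))`. -/
noncomputable def vecNorm {n : ℕ} {T L H : ℝ} (Ψ : Fin (n + 1) → L2W12 n T L H) : ℝ :=
  Real.sqrt (∑ i, (Ψ i).normSq)

/-- The norm of `L²(0,T; W^{1,2}(Ω; ℝ^{d×d}))`. -/
noncomputable def tensorNorm {n : ℕ} {T L H : ℝ}
    (S : Fin (n + 1) → Fin (n + 1) → L2W12 n T L H) : ℝ :=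
  Real.sqrt (∑ i, ∑ j, (S i j).normSq)

/-- Coordinate directions of space-time: `none` is time, `some i` is `x_i`. -/
def stDir {n : ℕ} : Option (Fin (n + 1)) → ℝ × Pt n
  | none => (1, 0)
  | some i => (0, Pi.single i 1)

/-- A positive function `ϑ_B ∈ W^{2,∞}((0,T) × Ω)`, given by its continuous representative on
`[0,T] × Ω̄` together with its weak derivatives of first and second order. -/
structure BdryTemp (n : ℕ) (T L H : ℝ) where
  val : ℝ × Pt n → ℝ
  d1 : Option (Fin (n + 1)) → ℝ × Pt n → ℝ
  d2 : Option (Fin (n + 1)) → Option (Fin (n + 1)) → ℝ × Pt n → ℝ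
  cont : ContinuousOn val (Icc 0 T ×ˢ {x | |x (Fin.last n)| ≤ H})
  periodic : ∀ t, HPeriodic L fun x => val (t, x)
  pos : ∀ t ∈ Icc 0 T, ∀ x : Pt n, |x (Fin.last n)| ≤ H → 0 < val (t, x)
  memLp_d1 : ∀ a, MemLp (d1 a) ⊤ (volume.restrict (cylinder n T L H))
  memLp_d2 : ∀ a b, MemLp (d2 a b) ⊤ (volume.restrict (cylinder n T L H))
  weak_d1 : ∀ a,
    HasWeakDeriv (cylinder n T L H) (testSpaceTime n T L H) (stDir a) val (d1 a)
  weak_d2 : ∀ a b,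
    HasWeakDeriv (cylinder n T L H) (testSpaceTime n T L H) (stDir b) (d1 a) (d2 a b)

/-- The `L^∞((0,T) × Ω)` norm. -/
noncomputable def supNorm (n : ℕ) (T L H : ℝ) (f : ℝ × Pt n → ℝ) : ℝ :=
  (eLpNorm f ⊤ (volume.restrict (cylinder n T L H))).toReal

/-- The `W^{2,∞}((0,T) × Ω)` norm. -/
noncomputable def BdryTemp.w2Norm {n : ℕ} {T L H : ℝ} (θB : BdryTemp n T L H) : ℝ :=
  supNorm n T L H θB.val + ∑ a, supNorm n T L H (θB.d1 a) +
    ∑ a, ∑ b, supNorm n T L H (θB.d2 a b)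

/-! ### The mesh -/

/-- A uniform mesh of cubes of size `h ∈ (0,1)`: `N` cells in each horizontal direction and `M`
cells in the vertical one. -/
structure Mesh (L H : ℝ) where
  h : ℝ
  N : ℕ
  M : ℕ
  h_pos : 0 < h
  h_lt_one : h < 1
  horizontal : N * h = 2 * L
  vertical : M * h = 2 * H

/-- A uniform time grid `t_k = k Δt`, `k = 0, …, N_T`, `t_{N_T} = T`. -/
structure TimeGrid (T : ℝ) where
  dt : ℝ
  steps : ℕ
  dt_pos : 0 < dt
  dt_lt_one : dt < 1
  total : steps * dt = T

section Grid

variable {n : ℕ} {T L H : ℝ} (m : Mesh L H) (τ : TimeGrid T)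

/-- The index `k` of the cell `K_k = ∏ᵢ [-wᵢ + h kᵢ, -wᵢ + h (kᵢ + 1))` containing `x`, where
`wᵢ` is the half width. -/
noncomputable def cellIndex (x : Pt n) : Idx n := fun i => ⌊(x i + halfWidth L H i) / m.h⌋

/-- The cells of the mesh, one for every class modulo horizontal periods. -/
noncomputable def cells (n : ℕ) (m : Mesh L H) : Finset (Idx n) :=
  Fintype.piFinset fun i => Finset.Ico (0 : ℤ) (if i = Fin.last n then (m.M : ℤ) else (m.N : ℤ))

/-- The face `(i, k)` is the common face of the cells `k - eᵢ` and `k`; it lies in the plane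
`x_i = -wᵢ + h kᵢ`. The exterior faces are those with `i` vertical and `k_d ∈ {0, M}`.  This is
the set of interior faces, one for every class modulo horizontal periods. -/
noncomputable def interiorFaces (n : ℕ) (m : Mesh L H) : Finset (Fin (n + 1) × Idx n) :=
  (Finset.univ ×ˢ cells n m).filter fun σ => σ.1 = Fin.last n → 0 < σ.2 (Fin.last n)

/-- The index of the face orthogonal to `eᵢ` whose dual cell (the cube of size `h` centred at the
centre of the face) contains `x`. -/
noncomputable def dualIndex (i : Fin (n + 1)) (x : Pt n) : Idx n := fun j =>
  ⌊(x j + halfWidth L H j) / m.h + if j = i then 1 / 2 else 0⌋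

/-- Average over the face `(i, k)`. -/
noncomputable def faceAverage (i : Fin (n + 1)) (k : Idx n) (f : Pt n → ℝ) : ℝ :=
  (m.h ^ n)⁻¹ *
    ∫ y in Set.univ.pi fun j : Fin n =>
        Icc (-halfWidth L H (i.succAbove j) + m.h * k (i.succAbove j))
          (-halfWidth L H (i.succAbove j) + m.h * (k (i.succAbove j) + 1)),
      f (Fin.insertNth (α := fun _ => ℝ) i (-halfWidth L H i + m.h * k i) y)

/-! ### Piecewise constant functions

A function of `Q_h` is given by its cell values `v : Idx n → ℝ`, `N`-periodic in the horizontal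
indices. The values at vertical index `-1` and `M` are the outer values `v^out` at the exterior
faces, which the boundary conditions prescribe; no other value outside the slab is used. -/

/-- Horizontal periodicity of cell values. -/
def GridPeriodic (v : Idx n → ℝ) : Prop :=
  ∀ i : Fin (n + 1), i ≠ Fin.last n → ∀ k, v (k + Pi.single i (m.N : ℤ)) = v k

/-- The average `{{v}}` on the face `(i, k)`. -/
noncomputable def avg (i : Fin (n + 1)) (v : Idx n → ℝ) (k : Idx n) : ℝ :=
  (v k + v (k - Pi.single i 1)) / 2

/-- The jump `[[v]]` on the face `(i, k)`, with the normal `eᵢ`. -/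
def jump (i : Fin (n + 1)) (v : Idx n → ℝ) (k : Idx n) : ℝ :=
  v k - v (k - Pi.single i 1)

/-- The `i`-th component of `∇_h v` on the cell `k`, that is of
`∑_{σ ∈ E(K)} n {{v}} / h`: of the `2d` faces of the cell only `(i, k + eᵢ)` with outer normal `eᵢ`
and `(i, k)` with outer normal `-eᵢ` contribute to it. -/
noncomputable def gradH (i : Fin (n + 1)) (v : Idx n → ℝ) (k : Idx n) : ℝ :=
  (avg i v (k + Pi.single i 1) - avg i v k) / m.h

/-- The entries of the discrete symmetric gradient `D_h u` on the cell `k`. -/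
noncomputable def symGradH (u : Fin (n + 1) → Idx n → ℝ) (i j : Fin (n + 1)) (k : Idx n) : ℝ :=
  (gradH m i (u j) k + gradH m j (u i) k) / 2

/-- The piecewise constant function of space-time with the cell values `v k` on
`[t_k, t_{k+1})`. -/
noncomputable def interp (v : ℕ → Idx n → ℝ) (p : ℝ × Pt n) : ℝ :=
  v ⌊p.1 / τ.dt⌋₊ (cellIndex m p.2)

/-- The `i`-th component of `∇_E v`, which equals `[[v]] / h` on every dual cell of a face
orthogonal to `eᵢ`. -/
noncomputable def gradE (i : Fin (n + 1)) (v : ℕ → Idx n → ℝ) (p : ℝ × Pt n) : ℝ :=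
  jump i (v ⌊p.1 / τ.dt⌋₊) (dualIndex m i p.2) / m.h

end Grid

/-- Cell values of the discrete density, velocity and temperature at all time levels. -/
structure Trio (n : ℕ) where
  rho : ℕ → Idx n → ℝ
  u : ℕ → Fin (n + 1) → Idx n → ℝ
  theta : ℕ → Idx n → ℝ

/-- The constants in the uniform bounds and in the relation of `Δt` and `h`. -/
structure Bounds where
  rhoLo : ℝ
  rhoHi : ℝ
  thetaLo : ℝ
  thetaHi : ℝ
  uHi : ℝ
  cLo : ℝ
  cHi : ℝ

/-- `Λ = T + ‖ϑ_B‖_{W^{2,∞}} + 1/ϱ̲ + ϱ̄ + 1/ϑ̲ + ϑ̄ + ū + 1/c̲ + c̄`. -/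
noncomputable def Lam {n : ℕ} {T L H : ℝ} (θB : BdryTemp n T L H) (b : Bounds) : ℝ :=
  T + θB.w2Norm + 1 / b.rhoLo + b.rhoHi + 1 / b.thetaLo + b.thetaHi + b.uHi + 1 / b.cLo + b.cHi

section Conditions

variable {n : ℕ} {T L H : ℝ} (m : Mesh L H) (τ : TimeGrid T)

/-- `0 < c̲ h ≤ Δt ≤ c̄ h`. -/
def StepRatio (b : Bounds) : Prop :=
  0 < b.cLo ∧ b.cLo * m.h ≤ τ.dt ∧ τ.dt ≤ b.cHi * m.h

/-- The components of the trio belong to `Q_h` at all times, and at every exterior face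
`{{u_h}} = 0` and `{{ϑ_h}} = ϑ_{B,h}`, the face average of `ϑ_B(t_k, ·)`. -/
structure IsDiscreteTrio (θB : BdryTemp n T L H) (U : Trio n) : Prop where
  periodic_rho : ∀ k ≤ τ.steps, GridPeriodic m (U.rho k)
  periodic_u : ∀ k ≤ τ.steps, ∀ i, GridPeriodic m (U.u k i)
  periodic_theta : ∀ k ≤ τ.steps, GridPeriodic m (U.theta k)
  bdry_u : ∀ k ≤ τ.steps, ∀ σ : Idx n, (σ (Fin.last n) = 0 ∨ σ (Fin.last n) = m.M) →
    ∀ i, avg (Fin.last n) (U.u k i) σ = 0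
  bdry_theta : ∀ k ≤ τ.steps, ∀ σ : Idx n, (σ (Fin.last n) = 0 ∨ σ (Fin.last n) = m.M) →
    avg (Fin.last n) (U.theta k) σ =
      faceAverage m (Fin.last n) σ fun x => θB.val (k * τ.dt, x)

/-- The uniform bounds `0 < ϱ̲ ≤ ϱ_h ≤ ϱ̄`, `0 < ϑ̲ ≤ ϑ_h ≤ ϑ̄`, `|u_h| ≤ ū`. -/
structure UniformBounds (b : Bounds) (U : Trio n) : Prop where
  rhoLo_pos : 0 < b.rhoLo
  thetaLo_pos : 0 < b.thetaLo
  rho : ∀ k ≤ τ.steps, ∀ c ∈ cells n m, b.rhoLo ≤ U.rho k c ∧ U.rho k c ≤ b.rhoHi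
  theta : ∀ k ≤ τ.steps, ∀ c ∈ cells n m, b.thetaLo ≤ U.theta k c ∧ U.theta k c ≤ b.thetaHi
  u : ∀ k ≤ τ.steps, ∀ c ∈ cells n m, Real.sqrt (∑ i, U.u k i c ^ 2) ≤ b.uHi

/-- `‖∇_E ϑ_h‖_{L²((0,T)×Ω)} + ‖∇_h u_h‖_{L²((0,T)×Ω)} ≤ C₀`. -/
def GradientBound (C₀ : ℝ) (U : Trio n) : Prop :=
  Real.sqrt (∫ p in cylinder n T L H, ∑ i, gradE m τ i U.theta p ^ 2) +
    Real.sqrt (∫ p in cylinder n T L H,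
      ∑ i, ∑ j, interp m τ (fun k => gradH m i (U.u k j)) p ^ 2) ≤ C₀

/-- `∫₀ᵀ ∫_{E_int} (h^α + |{{u_h}} · n|) |[[(ϱ_h, u_h, ϑ_h)]]|² dS dt ≤ C₀`; the integrand is
constant on each face, and a face has measure `h^{d-1}`. -/
def JumpBound (α C₀ : ℝ) (U : Trio n) : Prop :=
  ∫ t in Ioo 0 T, ∑ σ ∈ interiorFaces n m,
    m.h ^ n * ((m.h ^ α + |avg σ.1 (U.u ⌊t / τ.dt⌋₊ σ.1) σ.2|) *
      (jump σ.1 (U.rho ⌊t / τ.dt⌋₊) σ.2 ^ 2 + ∑ j, jump σ.1 (U.u ⌊t / τ.dt⌋₊ j) σ.2 ^ 2 +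
        jump σ.1 (U.theta ⌊t / τ.dt⌋₊) σ.2 ^ 2)) ≤ C₀

/-- `∫₀ᵀ ∫_Ω u_h · div S + D_h(u_h) : S dx dt`. -/
noncomputable def velocityError (U : Trio n)
    (S : Fin (n + 1) → Fin (n + 1) → L2W12 n T L H) : ℝ :=
  ∫ p in cylinder n T L H,
    ((∑ i, interp m τ (fun k => U.u k i) p * ∑ j, (S i j).grad j p) +
      ∑ i, ∑ j, interp m τ (fun k => symGradH m (U.u k) i j) p * (S i j).val p)

/-- `∫₀ᵀ ∫_Ω (ϑ_h - ϑ_B) div Ψ + (∇_E ϑ_h - ∇ϑ_B) · Ψ dx dt`. -/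
noncomputable def temperatureError (θB : BdryTemp n T L H) (U : Trio n)
    (Ψ : Fin (n + 1) → L2W12 n T L H) : ℝ :=
  ∫ p in cylinder n T L H,
    ((interp m τ U.theta p - θB.val p) * (∑ i, (Ψ i).grad i p) +
      ∑ i, (gradE m τ i U.theta p - θB.d1 (some i) p) * (Ψ i).val p)

end Conditions

end FV

/-! # Compatibility of the discrete gradients

Both estimates come from replacing a piecewise constant function by an interpolant that is continuous
and piecewise linear in one direction only, and whose derivative in this direction is exactly the
discrete derivative in question.

For the velocity, let `V` interpolate the face averages of `uᵢ` linearly in direction `j` on every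
cell (`faceInterp`). Then `∂ⱼV` is the `j`-th component of `∇_h uᵢ`, and `V` vanishes at `x_d = ±H` or
is periodic, so that `V` is an admissible test function, `∫ V ∂ⱼSᵢⱼ + ∂ⱼV Sᵢⱼ = 0`, although `Sᵢⱼ`
does not vanish on the boundary (`integral_faceInterp_eq_zero`). The error is therefore
`∫ (uᵢ - V) ∂ⱼSᵢⱼ`. On a cell `|uᵢ - V|` is at most half of the jumps on two of its faces. Interior
jumps are controlled by the jump estimate, which yields `h^{(1-α)/2}`. Since `{{u}} = 0` on exterior
faces, an exterior jump is controlled by the opposite interior jump and by `h |∇_h u|`, and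
`h ≤ h^{(1-α)/2}` because of `α > -1` (`jump_sq_add_le`,
`integral_sq_interp_sub_faceInterp_le`).

For the temperature, let `Θᵢ` interpolate the cell values of `ϑ_h` linearly in direction `i` on every
dual cell (`cellInterp`). Then `∂ᵢΘᵢ` is the `i`-th component of `∇_E ϑ_h`, and
`|ϑ_h - Θᵢ| ≤ (h/2) |∇_E ϑ_h|`. The remaining integral
`∫ (Θᵢ - ϑ_B) ∂ᵢΨᵢ + ∂ᵢ(Θᵢ - ϑ_B) Ψᵢ` is a boundary term. It is `O(h)` because `Θᵢ - ϑ_B` is `O(h)`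
at `x_d = ±H`: there `Θ_d` is a face average of `ϑ_B` at the beginning of the time step, and `ϑ_B` is
Lipschitz continuous (`abs_bdry_theta_sub_le`, `abs_integral_cellInterp_sub_le`).

The interpolants are discontinuous across the transverse directions, hence the integrations by parts
are done line by line. The tool is `ae_line_eq_primitive`: a function with a weak derivative in one
direction is on almost every line in this direction a primitive of it. Only products of
one-dimensional test functions enter its proof, through a countable family of them that determines
integrable functions (`Determining`); in the horizontal directions the factors are periodic.
-/


namespace FV

open Filter Topology

/-! ### Absolutely continuous functions on an interval -/

theorem ac_primitive {a b : ℝ} {v : ℝ → ℝ} (hv : IntervalIntegrable v volume a b) (c : ℝ) :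
    AbsolutelyContinuousOnInterval (fun x => c + ∫ r in a..x, v r) a b := by
  have h1 := hv.absolutelyContinuousOnInterval_intervalIntegral (c := a) (by simp)
  have h2 : AbsolutelyContinuousOnInterval (fun _ : ℝ => c) a b :=
    (LipschitzWith.const c).lipschitzOnWith.absolutelyContinuousOnInterval
  exact h2.fun_add h1

theorem ae_deriv_primitive {a b : ℝ} {v : ℝ → ℝ} (hv : IntervalIntegrable v volume a b) (c : ℝ) :
    ∀ᵐ x, x ∈ uIcc a b → deriv (fun x => c + ∫ r in a..x, v r) x = v x := by
  filter_upwards [hv.ae_hasDerivAt_integral] with x hx hxm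
  exact ((hx hxm a (by simp)).const_add c).deriv

theorem integral_mul_primitive {a b : ℝ} {v w : ℝ → ℝ}
    (hv : IntervalIntegrable v volume a b) (hw : IntervalIntegrable w volume a b) (c d : ℝ) :
    ∫ x in a..b, (v x * (d + ∫ r in a..x, w r) + (c + ∫ r in a..x, v r) * w x) =
      (c + ∫ r in a..b, v r) * (d + ∫ r in a..b, w r) - c * d := by
  have h := (ac_primitive hv c).integral_deriv_mul_eq_sub (ac_primitive hw d)
  simp only [intervalIntegral.integral_same, add_zero] at h
  rw [← h]
  apply intervalIntegral.integral_congr_ae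
  filter_upwards [ae_deriv_primitive hv c, ae_deriv_primitive hw d] with x h1 h2 hx
  rw [h1 (uIoc_subset_uIcc hx), h2 (uIoc_subset_uIcc hx)]

theorem continuousOn_primitive {a b : ℝ} {v : ℝ → ℝ} (hv : IntervalIntegrable v volume a b)
    (c : ℝ) : ContinuousOn (fun x => c + ∫ r in a..x, v r) (uIcc a b) :=
  (ac_primitive hv c).continuousOn

theorem intervalIntegrable_of_Ioo {a b : ℝ} (hab : a ≤ b) {v : ℝ → ℝ}
    (hv : Integrable v (volume.restrict (Ioo a b))) : IntervalIntegrable v volume a b :=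
  (intervalIntegrable_iff_integrableOn_Ioo_of_le hab).2 hv

theorem integral_Ioo_eq {a b : ℝ} (hab : a ≤ b) (v : ℝ → ℝ) :
    ∫ x in Ioo a b, v x = ∫ x in a..b, v x := by
  rw [intervalIntegral.integral_of_le hab, integral_Ioc_eq_integral_Ioo]

theorem abs_primitive_le {a b s : ℝ} (hs : s ∈ Icc a b) {v : ℝ → ℝ}
    (hv : Integrable v (volume.restrict (Ioo a b))) :
    |∫ r in a..s, v r| ≤ ∫ r in Ioo a b, |v r| := by
  refine (intervalIntegral.abs_integral_le_integral_abs hs.1).trans ?_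
  rw [← integral_Ioo_eq hs.1]
  exact setIntegral_mono_set hv.abs (ae_of_all _ fun _ => abs_nonneg _)
    (Ioo_subset_Ioo_right hs.2).eventuallyLE

/-- The end point values of an absolutely continuous function are bounded by its `W^{1,1}` norm. -/
theorem abs_endpoint_le {a b c : ℝ} (hab : a < b) {u v : ℝ → ℝ}
    (hu : Integrable u (volume.restrict (Ioo a b)))
    (hv : Integrable v (volume.restrict (Ioo a b)))
    (h : ∀ᵐ s ∂(volume.restrict (Ioo a b)), u s = c + ∫ r in a..s, v r) :
    |c| ≤ (b - a)⁻¹ * (∫ s in Ioo a b, |u s|) + ∫ s in Ioo a b, |v s| ∧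
    |c + ∫ r in a..b, v r| ≤
      (b - a)⁻¹ * (∫ s in Ioo a b, |u s|) + ∫ s in Ioo a b, |v s| := by
  have hba : 0 < b - a := sub_pos.2 hab
  have key : ∀ z : ℝ, (∀ s ∈ Ioo a b, |z - (c + ∫ r in a..s, v r)| ≤ ∫ s in Ioo a b, |v s|) →
      |z| ≤ (b - a)⁻¹ * (∫ s in Ioo a b, |u s|) + ∫ s in Ioo a b, |v s| := by
    intro z hz
    have h1 : ∫ s in Ioo a b, |z| ≤ ∫ s in Ioo a b, (|u s| + ∫ s in Ioo a b, |v s|) := by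
      refine integral_mono_ae (integrable_const _) (hu.abs.add (integrable_const _)) ?_
      filter_upwards [h, ae_restrict_mem measurableSet_Ioo] with s hs hsm
      have := hz s hsm
      rw [← hs] at this
      have h3 : |z| ≤ |z - u s| + |u s| := by
        simpa using abs_add_le (z - u s) (u s)
      linarith
    rw [integral_add hu.abs (integrable_const _)] at h1
    simp only [integral_const, measureReal_restrict_apply_univ, Real.volume_real_Ioo_of_le hab.le,
      smul_eq_mul] at h1
    have : |z| = (b - a)⁻¹ * ((b - a) * |z|) := by field_simp
    rw [this]
    calc _ ≤ (b - a)⁻¹ * ((∫ s in Ioo a b, |u s|) + (b - a) * ∫ s in Ioo a b, |v s|) := by gcongr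
      _ = _ := by field_simp
  constructor
  · refine key c fun s hs => ?_
    rw [sub_add_cancel_left, abs_neg]
    exact abs_primitive_le (Ioo_subset_Icc_self hs) hv
  · refine key _ fun s hs => ?_
    have hi := intervalIntegrable_of_Ioo hab.le hv
    rw [add_sub_add_left_eq_sub, intervalIntegral.integral_interval_sub_left hi
      (hi.mono_set (by rw [uIcc_of_le hab.le, uIcc_of_le hs.1.le]; exact Icc_subset_Icc_right hs.2.le))]
    refine (intervalIntegral.abs_integral_le_integral_abs hs.2.le).trans ?_
    rw [← integral_Ioo_eq hs.2.le]
    exact setIntegral_mono_set hv.abs (ae_of_all _ fun _ => abs_nonneg _)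
      (Ioo_subset_Ioo_left hs.1.le).eventuallyLE

/-- A function whose integrals over all intervals with rational end points vanish is zero. -/
theorem ae_eq_zero_of_integral_rat {a b : ℝ} {G : ℝ → ℝ}
    (hG : Integrable G (volume.restrict (Ioo a b)))
    (h : ∀ p q : ℚ, a < p → p < q → (q : ℝ) < b → ∫ s in Ioo (p : ℝ) q, G s = 0) :
    G =ᵐ[volume.restrict (Ioo a b)] 0 := by
  rcases le_or_gt b a with hab | hab
  · simp [Ioo_eq_empty_of_le hab, EventuallyEq]
  have hi := intervalIntegrable_of_Ioo hab.le hG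
  have hsub : ∀ p ∈ Ioo a b, IntervalIntegrable G volume a p := fun p hp =>
    hi.mono_set (by rw [uIcc_of_le hab.le, uIcc_of_le hp.1.le]; exact Icc_subset_Icc_right hp.2.le)
  obtain ⟨p₀, hp₀⟩ := exists_rat_btwn hab
  have hc : ContinuousOn (fun x => ∫ r in a..x, G r) (Ioo a b) := by
    have := continuousOn_primitive hi 0
    simp only [zero_add] at this
    exact this.mono (by rw [uIcc_of_le hab.le]; exact Ioo_subset_Icc_self)
  have hlt : ∀ p q : ℚ, a < p → p < q → (q : ℝ) < b →
      ∫ r in a..(p : ℝ), G r = ∫ r in a..(q : ℝ), G r := by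
    intro p q hp hpq hq
    have hpq' : (p : ℝ) < q := by exact_mod_cast hpq
    have := h p q hp hpq hq
    rw [integral_Ioo_eq hpq'.le, ← intervalIntegral.integral_interval_sub_left
      (hsub q ⟨hp.trans hpq', hq⟩) (hsub p ⟨hp, hpq'.trans hq⟩)] at this
    linarith
  have heq : EqOn (fun x => ∫ r in a..x, G r) (fun _ => ∫ r in a..(p₀ : ℝ), G r) (Ioo a b) := by
    refine Set.EqOn.of_subset_closure (s := Ioo a b ∩ range ((↑) : ℚ → ℝ)) ?_ hc
      continuousOn_const inter_subset_left
      (Dense.open_subset_closure_inter Rat.denseRange_cast isOpen_Ioo)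
    rintro _ ⟨hq, q, rfl⟩
    rcases lt_trichotomy q p₀ with hlt' | rfl | hlt'
    · exact hlt q p₀ hq.1 hlt' hp₀.2
    · rfl
    · exact (hlt p₀ q hp₀.1 hlt' hq.2).symm
  rw [EventuallyEq, ae_restrict_iff' measurableSet_Ioo]
  filter_upwards [hi.ae_hasDerivAt_integral] with x hx hxm
  have h1 := hx (by rw [uIcc_of_le hab.le]; exact Ioo_subset_Icc_self hxm) a (by simp)
  have h2 : HasDerivAt (fun x => ∫ r in a..x, G r) 0 x := by
    refine (hasDerivAt_const x (∫ r in a..(p₀ : ℝ), G r)).congr_of_eventuallyEq ?_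
    filter_upwards [isOpen_Ioo.mem_nhds hxm] with y hy using heq hy
  exact h1.unique h2

/-! ### Classes of one-dimensional test functions -/

/-- A class of smooth functions on `(a, b)` that is rich enough for the fundamental lemma of the
calculus of variations: it is closed under the formation of primitives of functions of mean zero
and contains approximations of the indicators of intervals. -/
structure TestClass (a b : ℝ) (𝒯 : Set (ℝ → ℝ)) : Prop where
  smooth : ∀ ψ ∈ 𝒯, ContDiff ℝ ∞ ψ
  sub_mul : ∀ ψ ∈ 𝒯, ∀ ρ ∈ 𝒯, ∀ c : ℝ, (fun s => ψ s - c * ρ s) ∈ 𝒯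
  primitive : ∀ ψ ∈ 𝒯, ∫ r in a..b, ψ r = 0 → (fun s => ∫ r in a..s, ψ r) ∈ 𝒯
  approx : ∀ p q : ℝ, a < p → p < q → q < b → ∃ ψ : ℕ → ℝ → ℝ, (∀ k, ψ k ∈ 𝒯) ∧
    (∀ k s, 0 ≤ ψ k s ∧ ψ k s ≤ 1) ∧
    ∀ s ∈ Ioo a b, Tendsto (fun k => ψ k s) atTop (𝓝 ((Ioo p q).indicator 1 s))

/-- `C_c^∞(a, b)`. -/
def compactTests (a b : ℝ) : Set (ℝ → ℝ) :=
  {ψ | ContDiff ℝ ∞ ψ ∧ ∃ ε > 0, ∀ s, (s < a + ε ∨ b - ε < s) → ψ s = 0}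

/-- Smooth functions of period `2L`. -/
def periodicTests (L : ℝ) : Set (ℝ → ℝ) :=
  {ψ | ContDiff ℝ ∞ ψ ∧ Function.Periodic ψ (2 * L)}

theorem contDiff_primitive {ψ : ℝ → ℝ} (h : ContDiff ℝ ∞ ψ) (a : ℝ) :
    ContDiff ℝ ∞ fun s => ∫ r in a..s, ψ r := by
  have hd : ∀ s, HasDerivAt (fun s => ∫ r in a..s, ψ r) (ψ s) s := fun s =>
    intervalIntegral.integral_hasDerivAt_right (h.continuous.intervalIntegrable _ _)
      h.continuous.aestronglyMeasurable.stronglyMeasurableAtFilter h.continuous.continuousAt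
  rw [contDiff_infty_iff_deriv]
  refine ⟨fun s => (hd s).differentiableAt, ?_⟩
  rwa [show deriv (fun s => ∫ r in a..s, ψ r) = ψ from funext fun s => (hd s).deriv]

theorem tendsto_smoothTransition_mul (F : ℝ → ℝ) (s : ℝ) :
    Tendsto (fun k : ℕ => Real.smoothTransition (k * F s)) atTop
      (𝓝 ({s | 0 < F s}.indicator 1 s)) := by
  by_cases hF : 0 < F s
  · rw [indicator_of_mem (by exact hF)]
    refine tendsto_const_nhds.congr' ?_
    filter_upwards [(tendsto_natCast_atTop_atTop.atTop_mul_const hF).eventually_ge_atTop 1]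
      with k hk
    exact (Real.smoothTransition.one_of_one_le hk).symm
  · rw [indicator_of_notMem (by exact hF)]
    refine tendsto_const_nhds.congr fun k => ?_
    exact (Real.smoothTransition.zero_of_nonpos
      (mul_nonpos_of_nonneg_of_nonpos (Nat.cast_nonneg k) (not_lt.1 hF))).symm

theorem testClass_compact {a b : ℝ} : TestClass a b (compactTests a b) where
  smooth ψ h := h.1
  sub_mul := by
    rintro ψ ⟨h1, ε1, hε1, h2⟩ ρ ⟨h3, ε2, hε2, h4⟩ c
    refine ⟨h1.sub (contDiff_const.mul h3), min ε1 ε2, lt_min hε1 hε2, fun s hs => ?_⟩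
    have m1 := min_le_left ε1 ε2
    have m2 := min_le_right ε1 ε2
    beta_reduce
    rw [h2 s (hs.imp (by intro; linarith) (by intro; linarith)),
      h4 s (hs.imp (by intro; linarith) (by intro; linarith))]
    simp
  primitive := by
    rintro ψ ⟨h1, ε, hε, h2⟩ h0
    refine ⟨contDiff_primitive h1 a, ε, hε, fun s hs => ?_⟩
    have hz : ∀ p q : ℝ, (q < a + ε ∧ p < a + ε ∨ b - ε < p ∧ b - ε < q) →
        ∫ r in p..q, ψ r = 0 := by
      intro p q hpq
      refine (intervalIntegral.integral_congr (g := fun _ => 0) fun r hr => ?_).trans (by simp)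
      apply h2
      rcases hpq with h | h
      · left; exact hr.2.trans_lt (max_lt h.2 h.1)
      · right; exact (lt_min h.1 h.2).trans_le hr.1
    rcases hs with hs | hs
    · exact hz a s (Or.inl ⟨hs, by linarith⟩)
    · have hi : ∀ p q : ℝ, IntervalIntegrable ψ volume p q := fun p q =>
        h1.continuous.intervalIntegrable p q
      dsimp only
      rw [← intervalIntegral.integral_add_adjacent_intervals (hi a b) (hi b s), h0, zero_add]
      exact hz b s (Or.inr ⟨by linarith, hs⟩)
  approx := by
    intro p q hp hpq hq
    refine ⟨fun k s => Real.smoothTransition (k * ((s - p) * (q - s))), fun k => ⟨?_, ?_⟩,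
      fun k s => ⟨Real.smoothTransition.nonneg _, Real.smoothTransition.le_one _⟩,
      fun s _ => ?_⟩
    · exact Real.smoothTransition.contDiff.comp (by fun_prop)
    · refine ⟨min (p - a) (b - q), lt_min (by linarith) (by linarith), fun s hs => ?_⟩
      have m1 := min_le_left (p - a) (b - q)
      have m2 := min_le_right (p - a) (b - q)
      apply Real.smoothTransition.zero_of_nonpos
      refine mul_nonpos_of_nonneg_of_nonpos (Nat.cast_nonneg k) ?_
      rcases hs with hs | hs
      · exact mul_nonpos_of_nonpos_of_nonneg (by linarith) (by linarith)
      · exact mul_nonpos_of_nonneg_of_nonpos (by linarith) (by linarith)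
    · have := tendsto_smoothTransition_mul (fun s => (s - p) * (q - s)) s
      convert this using 3
      ext r
      simp only [mem_Ioo, mem_ofPred_eq]
      constructor
      · rintro ⟨h1, h2⟩
        exact mul_pos (by linarith) (by linarith)
      · intro h
        rcases pos_and_pos_or_neg_and_neg_of_mul_pos h with h | h
        · exact ⟨by linarith, by linarith⟩
        · linarith

theorem testClass_periodic {L : ℝ} (hL : 0 < L) : TestClass (-L) L (periodicTests L) where
  smooth ψ h := h.1
  sub_mul := by
    rintro ψ ⟨h1, h2⟩ ρ ⟨h3, h4⟩ c
    refine ⟨h1.sub (contDiff_const.mul h3), fun s => ?_⟩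
    dsimp only
    rw [h2 s, h4 s]
  primitive := by
    rintro ψ ⟨h1, h2⟩ h0
    refine ⟨contDiff_primitive h1 _, fun s => ?_⟩
    have hi : ∀ p q : ℝ, IntervalIntegrable ψ volume p q := fun p q =>
      h1.continuous.intervalIntegrable p q
    dsimp only
    rw [← intervalIntegral.integral_add_adjacent_intervals (hi (-L) s) (hi s _),
      h2.intervalIntegral_add_eq s (-L), show -L + 2 * L = L by ring, h0, add_zero]
  approx := by
    intro p q hp hpq hq
    -- `s ∈ (p, q)` iff `cos (π (s - c) / L) > cos (π r / L)`, `c` the midpoint, `r` the radius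
    refine ⟨fun k s => Real.smoothTransition (k * (Real.cos (Real.pi * (s - (p + q) / 2) / L) -
        Real.cos (Real.pi * ((q - p) / 2) / L))), fun k => ⟨?_, ?_⟩,
      fun k s => ⟨Real.smoothTransition.nonneg _, Real.smoothTransition.le_one _⟩,
      fun s hs => ?_⟩
    · exact Real.smoothTransition.contDiff.comp (by fun_prop)
    · intro s
      dsimp only
      rw [show Real.pi * (s + 2 * L - (p + q) / 2) / L =
        Real.pi * (s - (p + q) / 2) / L + 2 * Real.pi by field_simp; ring, Real.cos_add_two_pi]
    · have := tendsto_smoothTransition_mul (fun s => Real.cos (Real.pi * (s - (p + q) / 2) / L) -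
        Real.cos (Real.pi * ((q - p) / 2) / L)) s
      convert this using 2
      have hiff : s ∈ Ioo p q ↔ 0 < Real.cos (Real.pi * (s - (p + q) / 2) / L) -
          Real.cos (Real.pi * ((q - p) / 2) / L) := by
        rw [sub_pos]
        have hpi := Real.pi_pos
        have hr : Real.pi * ((q - p) / 2) / L ∈ Icc 0 Real.pi := by
          constructor
          · have : 0 < q - p := by linarith
            positivity
          · rw [div_le_iff₀ hL]
            gcongr
            linarith
        have habs : |Real.pi * (s - (p + q) / 2) / L| = Real.pi * |s - (p + q) / 2| / L := by
          rw [abs_div, abs_mul, abs_of_pos hpi, abs_of_pos hL]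
        have hlin : s ∈ Ioo p q ↔ |s - (p + q) / 2| < (q - p) / 2 := by
          rw [abs_lt]
          constructor
          · rintro ⟨h1, h2⟩; constructor <;> linarith
          · rintro ⟨h1, h2⟩; constructor <;> linarith
        rw [← Real.cos_abs (Real.pi * (s - (p + q) / 2) / L), habs, hlin]
        rcases le_or_gt |s - (p + q) / 2| L with hle | hgt
        · have hs' : Real.pi * |s - (p + q) / 2| / L ∈ Icc 0 Real.pi := by
            constructor
            · positivity
            · rw [div_le_iff₀ hL]
              gcongr
          rw [Real.strictAntiOn_cos.lt_iff_gt hr hs', div_lt_div_iff_of_pos_right hL,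
            mul_lt_mul_iff_right₀ hpi]
        · -- beyond half a period the cosine is compared through the distance to the nearest copy
          have h2L : |s - (p + q) / 2| < 2 * L - (q - p) / 2 := by
            rw [abs_lt]
            constructor <;> linarith [hs.1, hs.2]
          have hs' : 2 * Real.pi - Real.pi * |s - (p + q) / 2| / L ∈ Icc 0 Real.pi := by
            constructor
            · rw [sub_nonneg, div_le_iff₀ hL]
              nlinarith
            · have : Real.pi ≤ Real.pi * |s - (p + q) / 2| / L := by
                rw [le_div_iff₀ hL]
                gcongr
              linarith
          rw [← Real.cos_two_pi_sub (Real.pi * |s - (p + q) / 2| / L),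
            Real.strictAntiOn_cos.lt_iff_gt hr hs']
          constructor
          · intro h; linarith
          · intro h
            exfalso
            have : 2 * Real.pi - Real.pi * |s - (p + q) / 2| / L =
              Real.pi * (2 * L - |s - (p + q) / 2|) / L := by field_simp
            rw [this, div_lt_div_iff_of_pos_right hL, mul_lt_mul_iff_right₀ hpi] at h
            linarith
      by_cases hm : s ∈ Ioo p q
      · rw [indicator_of_mem hm, indicator_of_mem (by exact hiff.1 hm)]
      · rw [indicator_of_notMem hm, indicator_of_notMem (by exact fun h => hm (hiff.2 h))]

/-! ### Determining families of test functions -/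

/-- A countable family of bounded functions against which every integrable function with vanishing
integrals is zero. Countability is what allows to pass to almost every fibre of a product. -/
structure Determining {X : Type*} [MeasurableSpace X] (μ : Measure X) (𝒜 : Set (X → ℝ)) :
    Prop where
  countable : 𝒜.Countable
  measurable : ∀ A ∈ 𝒜, Measurable A
  bounded : ∀ A ∈ 𝒜, ∃ C, ∀ x, |A x| ≤ C
  eq_zero : ∀ G : X → ℝ, Integrable G μ → (∀ A ∈ 𝒜, ∫ x, G x * A x ∂μ = 0) → G =ᵐ[μ] 0

section Product

variable {X Y : Type*} [MeasurableSpace X] [MeasurableSpace Y] {μ : Measure X} {ν : Measure Y}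
  {𝒜 : Set (X → ℝ)} {ℬ : Set (Y → ℝ)}

theorem Determining.ae_fiber_eq_zero [SFinite μ] [SFinite ν] (h𝒜 : Determining μ 𝒜)
    {k : X × Y → ℝ} (hk : Integrable k (μ.prod ν))
    (h : ∀ A ∈ 𝒜, ∫ z, k z * A z.1 ∂(μ.prod ν) = 0) : ∀ᵐ x ∂μ, ∫ y, k (x, y) ∂ν = 0 := by
  refine h𝒜.eq_zero _ hk.integral_prod_left fun A hA => ?_
  obtain ⟨C, hC⟩ := h𝒜.bounded A hA
  have hi : Integrable (fun z : X × Y => k z * A z.1) (μ.prod ν) :=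
    hk.mul_bdd ((h𝒜.measurable A hA).comp measurable_fst).aestronglyMeasurable
      (ae_of_all _ fun z => hC z.1)
  have := h A hA
  rw [integral_prod _ hi] at this
  simpa only [integral_mul_const] using this

theorem Determining.prod [SFinite μ] [SFinite ν] (h𝒜 : Determining μ 𝒜)
    (hℬ : Determining ν ℬ) :
    Determining (μ.prod ν) (image2 (fun A B => fun z : X × Y => A z.1 * B z.2) 𝒜 ℬ) where
  countable := h𝒜.countable.image2 hℬ.countable _
  measurable := by
    rintro _ ⟨A, hA, B, hB, rfl⟩
    exact ((h𝒜.measurable A hA).comp measurable_fst).mul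
      ((hℬ.measurable B hB).comp measurable_snd)
  bounded := by
    rintro _ ⟨A, hA, B, hB, rfl⟩
    obtain ⟨C, hC⟩ := h𝒜.bounded A hA
    obtain ⟨D, hD⟩ := hℬ.bounded B hB
    refine ⟨C * D, fun z => ?_⟩
    rw [abs_mul]
    exact mul_le_mul (hC _) (hD _) (abs_nonneg _) ((abs_nonneg _).trans (hC z.1))
  eq_zero := by
    intro G hG h
    have h1 : ∀ᵐ x ∂μ, ∀ B ∈ ℬ, ∫ y, G (x, y) * B y ∂ν = 0 := by
      rw [ae_ball_iff hℬ.countable]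
      intro B hB
      obtain ⟨D, hD⟩ := hℬ.bounded B hB
      refine h𝒜.ae_fiber_eq_zero (k := fun z => G z * B z.2)
        (hG.mul_bdd ((hℬ.measurable B hB).comp measurable_snd).aestronglyMeasurable
          (ae_of_all _ fun z => hD z.2)) fun A hA => ?_
      rw [← h _ ⟨A, hA, B, hB, rfl⟩]
      refine integral_congr_ae (ae_of_all _ fun z => ?_)
      ring
    have h2 : ∀ᵐ x ∂μ, ∫ y, |G (x, y)| ∂ν = 0 := by
      filter_upwards [h1, hG.prod_right_ae] with x hx hi
      rw [integral_congr_ae (g := fun _ => (0 : ℝ)), integral_zero]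
      filter_upwards [hℬ.eq_zero _ hi hx] with y hy
      simpa using hy
    have h3 : ∫ z, |G z| ∂(μ.prod ν) = 0 := by
      rw [integral_prod _ hG.abs, integral_congr_ae h2]
      simp
    rw [integral_eq_zero_iff_of_nonneg (fun _ => abs_nonneg _) hG.abs] at h3
    filter_upwards [h3] with z hz
    simpa using hz

theorem Determining.comp (hℬ : Determining ν ℬ) (e : X ≃ᵐ Y) (he : MeasurePreserving e μ ν) :
    Determining μ ((fun B : Y → ℝ => fun x => B (e x)) '' ℬ) where
  countable := hℬ.countable.image _
  measurable := by
    rintro _ ⟨B, hB, rfl⟩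
    exact (hℬ.measurable B hB).comp e.measurable
  bounded := by
    rintro _ ⟨B, hB, rfl⟩
    obtain ⟨D, hD⟩ := hℬ.bounded B hB
    exact ⟨D, fun x => hD _⟩
  eq_zero := by
    intro G hG h
    have hG' : Integrable (G ∘ e.symm) ν := (he.symm e).integrable_comp_of_integrable hG
    have := hℬ.eq_zero _ hG' fun B hB => by
      rw [← h _ ⟨B, hB, rfl⟩, ← he.integral_comp']
      simp
    filter_upwards [he.quasiMeasurePreserving.ae this] with x hx
    simpa using hx

end Product

theorem TestClass.exists_determining {a b : ℝ} {𝒯 : Set (ℝ → ℝ)} (h𝒯 : TestClass a b 𝒯) :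
    ∃ ℬ ⊆ 𝒯, Determining (volume.restrict (Ioo a b)) ℬ := by
  choose ψ h1 h2 h3 using h𝒯.approx
  refine ⟨⋃ (p : ℚ) (q : ℚ) (hp : a < p) (hpq : (p : ℝ) < q) (hq : (q : ℝ) < b),
    range (ψ p q hp hpq hq), ?_, ?_, ?_, ?_, ?_⟩
  · simp only [iUnion_subset_iff]
    rintro p q hp hpq hq _ ⟨k, rfl⟩
    exact h1 _ _ hp hpq hq k
  · exact countable_iUnion fun p => countable_iUnion fun q => countable_iUnion fun hp =>
      countable_iUnion fun hpq => countable_iUnion fun hq => countable_range _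
  · simp only [mem_iUnion]
    rintro _ ⟨p, q, hp, hpq, hq, k, rfl⟩
    exact (h𝒯.smooth _ (h1 _ _ hp hpq hq k)).continuous.measurable
  · simp only [mem_iUnion]
    rintro _ ⟨p, q, hp, hpq, hq, k, rfl⟩
    refine ⟨1, fun s => ?_⟩
    rw [abs_of_nonneg (h2 _ _ hp hpq hq k s).1]
    exact (h2 _ _ hp hpq hq k s).2
  · intro G hG h
    refine ae_eq_zero_of_integral_rat hG fun p q hp hpq hq => ?_
    have hpq' : (p : ℝ) < q := by exact_mod_cast hpq
    have ht : Tendsto (fun k => ∫ s in Ioo a b, G s * ψ p q hp hpq' hq k s) atTop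
        (𝓝 (∫ s in Ioo a b, G s * (Ioo (p : ℝ) q).indicator 1 s)) := by
      refine tendsto_integral_of_dominated_convergence (fun s => |G s|) (fun k => ?_) hG.abs
        (fun k => ae_of_all _ fun s => ?_) ?_
      · exact hG.aestronglyMeasurable.mul
          (h𝒯.smooth _ (h1 _ _ hp hpq' hq k)).continuous.aestronglyMeasurable
      · rw [Real.norm_eq_abs, abs_mul, abs_of_nonneg (h2 _ _ hp hpq' hq k s).1]
        exact mul_le_of_le_one_right (abs_nonneg _) (h2 _ _ hp hpq' hq k s).2
      · filter_upwards [ae_restrict_mem measurableSet_Ioo] with s hs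
        exact (h3 _ _ hp hpq' hq s hs).const_mul _
    have h0 : ∀ k, ∫ s in Ioo a b, G s * ψ p q hp hpq' hq k s = 0 := fun k => by
      apply h
      simp only [mem_iUnion]
      exact ⟨p, q, hp, hpq', hq, k, rfl⟩
    simp only [h0] at ht
    have h4 := tendsto_nhds_unique tendsto_const_nhds ht
    have h5 : ∀ s, G s * (Ioo (p : ℝ) q).indicator 1 s = (Ioo (p : ℝ) q).indicator G s := by
      intro s
      by_cases hs : s ∈ Ioo (p : ℝ) q <;> simp [hs]
    simp only [h5] at h4
    rw [setIntegral_indicator measurableSet_Ioo,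
      inter_eq_right.2 (Ioo_subset_Ioo hp.le hq.le)] at h4
    exact h4.symm

/-- Products of one-dimensional test functions determine integrable functions on a box. -/
theorem exists_determining_pi : ∀ (k : ℕ) (a b : Fin k → ℝ) (𝒯 : Fin k → Set (ℝ → ℝ)),
    (∀ j, TestClass (a j) (b j) (𝒯 j)) →
    ∃ ℬ, Determining (Measure.pi fun j => volume.restrict (Ioo (a j) (b j))) ℬ ∧
      ∀ B ∈ ℬ, ∃ χ : Fin k → ℝ → ℝ, (∀ j, χ j ∈ 𝒯 j) ∧ B = fun x => ∏ j, χ j (x j) := by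
  intro k
  induction k with
  | zero =>
    intro a b 𝒯 _
    refine ⟨{fun _ => 1}, ⟨countable_singleton _, ?_, ?_, ?_⟩, ?_⟩
    · rintro _ rfl; exact measurable_const
    · rintro _ rfl; exact ⟨1, fun x => by simp⟩
    · intro G _ h
      have := h _ rfl
      rw [Measure.pi_of_empty (x := isEmptyElim)] at this ⊢
      refine ae_of_all _ fun x => ?_
      rw [integral_dirac, mul_one] at this
      rw [Subsingleton.elim x isEmptyElim, this]
      rfl
    · rintro _ rfl
      exact ⟨isEmptyElim, fun j => j.elim0, by simp⟩
  | succ k ih =>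
    intro a b 𝒯 h
    obtain ⟨ℬ, h1, h2⟩ := ih (fun j => a j.succ) (fun j => b j.succ) (fun j => 𝒯 j.succ)
      fun j => h j.succ
    obtain ⟨ℬ₀, h3, h4⟩ := (h 0).exists_determining
    refine ⟨_, (h4.prod h1).comp (MeasurableEquiv.piFinSuccAbove (fun _ => ℝ) 0)
      (measurePreserving_piFinSuccAbove (fun j => volume.restrict (Ioo (a j) (b j))) 0), ?_⟩
    rintro _ ⟨_, ⟨A, hA, B, hB, rfl⟩, rfl⟩
    obtain ⟨χ, hχ, rfl⟩ := h2 B hB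
    refine ⟨Fin.cons A χ, Fin.cases (h3 hA) hχ, ?_⟩
    funext x
    rw [Fin.prod_univ_succ]
    rfl

/-! ### Absolute continuity on lines -/

theorem integrable_mul_continuous_Ioo {a b : ℝ} {u ψ : ℝ → ℝ}
    (hu : Integrable u (volume.restrict (Ioo a b))) (hψ : Continuous ψ) :
    Integrable (fun s => u s * ψ s) (volume.restrict (Ioo a b)) := by
  obtain ⟨C, hC⟩ := isCompact_Icc.exists_bound_of_continuousOn (hψ.continuousOn (s := Icc a b))
  refine hu.mul_bdd (c := C) hψ.aestronglyMeasurable ?_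
  filter_upwards [ae_restrict_mem measurableSet_Ioo] with s hs using hC s (Ioo_subset_Icc_self hs)

/-- The fundamental lemma of du Bois-Reymond on one line. Every `B` in a determining family yields
the test function `∫ₐ (B - (∫ B) ρ)`, which vanishes at both end points. -/
theorem exists_eq_primitive {a b : ℝ} (hab : a < b) {ℬ : Set (ℝ → ℝ)}
    (hℬ : Determining (volume.restrict (Ioo a b)) ℬ) (hc : ∀ B ∈ ℬ, Continuous B) {ρ : ℝ → ℝ}
    (hρ : Continuous ρ) (hρ1 : ∫ r in a..b, ρ r = 1) {u v : ℝ → ℝ}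
    (hu : Integrable u (volume.restrict (Ioo a b)))
    (hv : Integrable v (volume.restrict (Ioo a b)))
    (h : ∀ B ∈ ℬ, ∫ s in Ioo a b, (u s * (B s - (∫ r in a..b, B r) * ρ s) +
      v s * ∫ r in a..s, (B r - (∫ r in a..b, B r) * ρ r)) = 0) :
    ∃ c, ∀ᵐ s ∂(volume.restrict (Ioo a b)), u s = c + ∫ r in a..s, v r := by
  set F : ℝ → ℝ := fun s => u s - ∫ r in a..s, v r with hF
  have hvi := intervalIntegrable_of_Ioo hab.le hv
  have hprim : Integrable (fun s => ∫ r in a..s, v r) (volume.restrict (Ioo a b)) := by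
    have := continuousOn_primitive hvi 0
    simp only [zero_add, uIcc_of_le hab.le] at this
    exact (this.integrableOn_compact isCompact_Icc).mono_set Ioo_subset_Icc_self
  have hFi : Integrable F (volume.restrict (Ioo a b)) := hu.sub hprim
  refine ⟨∫ s in Ioo a b, F s * ρ s, ?_⟩
  have hz := hℬ.eq_zero (fun s => F s - ∫ s in Ioo a b, F s * ρ s)
    (hFi.sub (integrable_const _)) fun B hB => ?_
  · filter_upwards [hz] with s hs
    have : F s - ∫ s in Ioo a b, F s * ρ s = 0 := hs
    simp only [hF] at this ⊢
    linarith
  · set β := ∫ r in a..b, B r with hβ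
    have hw : Continuous fun s => B s - β * ρ s := (hc B hB).sub (continuous_const.mul hρ)
    have hw0 : ∫ r in a..b, (B r - β * ρ r) = 0 := by
      rw [intervalIntegral.integral_sub ((hc B hB).intervalIntegrable _ _)
        ((hρ.intervalIntegrable _ _).const_mul _),
        intervalIntegral.integral_const_mul, hρ1, ← hβ]
      ring
    have hparts := integral_mul_primitive hvi (hw.intervalIntegrable a b) 0 0
    rw [hw0, ← integral_Ioo_eq hab.le] at hparts
    simp only [zero_add, mul_zero, sub_zero] at hparts
    have hwp : Continuous fun s => ∫ r in a..s, (B r - β * ρ r) :=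
      intervalIntegral.continuous_primitive (fun p q => hw.intervalIntegrable p q) a
    have i1 := integrable_mul_continuous_Ioo hu hw
    have i2 := integrable_mul_continuous_Ioo hv hwp
    have i3 := integrable_mul_continuous_Ioo hprim hw
    have e1 := h B hB
    rw [integral_add i1 i2] at e1
    rw [integral_add i2 i3] at hparts
    have e2 : ∫ s in Ioo a b, F s * (B s - β * ρ s) = 0 := by
      have : ∫ s in Ioo a b, F s * (B s - β * ρ s) =
          ∫ s in Ioo a b, (u s * (B s - β * ρ s) - (∫ r in a..s, v r) * (B s - β * ρ s)) :=
        integral_congr_ae (ae_of_all _ fun s => by simp only [hF]; ring)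
      rw [this, integral_sub i1 i3]
      linarith
    have e3 : ∫ s in Ioo a b, F s * (B s - β * ρ s) =
        (∫ s in Ioo a b, F s * B s) - β * ∫ s in Ioo a b, F s * ρ s := by
      rw [← integral_const_mul, ← integral_sub (integrable_mul_continuous_Ioo hFi (hc B hB))
        ((integrable_mul_continuous_Ioo hFi hρ).const_mul _)]
      exact integral_congr_ae (ae_of_all _ fun s => by ring)
    have hBi : Integrable B (volume.restrict (Ioo a b)) := by
      simpa using integrable_mul_continuous_Ioo (u := fun _ => 1) (integrable_const _) (hc B hB)
    have e4 : ∫ s in Ioo a b, (F s - ∫ s in Ioo a b, F s * ρ s) * B s =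
        (∫ s in Ioo a b, F s * B s) - (∫ s in Ioo a b, F s * ρ s) * β := by
      rw [hβ, ← integral_Ioo_eq hab.le, ← integral_const_mul, ← integral_sub
        (integrable_mul_continuous_Ioo hFi (hc B hB)) (hBi.const_mul _)]
      exact integral_congr_ae (ae_of_all _ fun s => by ring)
    rw [e4]
    linarith

/-- A normalised test function, multiples of which make the mean of any other one vanish. -/
theorem TestClass.exists_integral_eq_one {a b : ℝ} (hab : a < b) {𝒯 : Set (ℝ → ℝ)}
    (h𝒯 : TestClass a b 𝒯) :
    ∃ ρ, Continuous ρ ∧ ∫ r in a..b, ρ r = 1 ∧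
      ∀ B ∈ 𝒯, ∀ c : ℝ, (fun s => B s - c * ρ s) ∈ 𝒯 := by
  obtain ⟨ℬ, h1, h2⟩ := h𝒯.exists_determining
  have : ∃ B ∈ ℬ, ∫ r in a..b, B r ≠ 0 := by
    by_contra! hcon
    have h3 := h2.eq_zero (fun _ => 1) (integrable_const _) fun B hB => by
      simp only [one_mul]
      rw [integral_Ioo_eq hab.le, hcon B hB]
    have h4 : volume.restrict (Ioo a b) = 0 := by
      rw [← ae_eq_bot]
      by_contra hne
      have : (ae (volume.restrict (Ioo a b))).NeBot := ⟨hne⟩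
      obtain ⟨x, hx⟩ := h3.exists
      simp at hx
    rw [Measure.restrict_eq_zero] at h4
    simp at h4
    linarith
  obtain ⟨B, hB, hne⟩ := this
  refine ⟨fun s => (∫ r in a..b, B r)⁻¹ * B s,
    continuous_const.mul (h𝒯.smooth B (h1 hB)).continuous, ?_, fun A hA c => ?_⟩
  · rw [intervalIntegral.integral_const_mul, inv_mul_cancel₀ hne]
  · have := h𝒯.sub_mul A hA B (h1 hB) (c * (∫ r in a..b, B r)⁻¹)
    convert this using 2
    ring

section Lines

variable {X : Type*} [MeasurableSpace X] {μ : Measure X} {𝒜 : Set (X → ℝ)}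
  {a b : ℝ} {𝒯 : Set (ℝ → ℝ)} {f g : X × ℝ → ℝ}

theorem integrable_mul_continuous_snd (hf : Integrable f (μ.prod (volume.restrict (Ioo a b))))
    {ψ : ℝ → ℝ} (hψ : Continuous ψ) :
    Integrable (fun z => f z * ψ z.2) (μ.prod (volume.restrict (Ioo a b))) := by
  obtain ⟨C, hC⟩ := isCompact_Icc.exists_bound_of_continuousOn (hψ.continuousOn (s := Icc a b))
  refine hf.mul_bdd (c := C) (hψ.measurable.comp measurable_snd).aestronglyMeasurable ?_
  have h1 : ∀ᵐ s ∂(volume.restrict (Ioo a b)), ‖ψ s‖ ≤ C := by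
    filter_upwards [ae_restrict_mem measurableSet_Ioo] with s hs
      using hC s (Ioo_subset_Icc_self hs)
  exact Measure.quasiMeasurePreserving_snd.ae h1

theorem ae_fiber_test_eq_zero [SFinite μ] (h𝒜 : Determining μ 𝒜)
    (hf : Integrable f (μ.prod (volume.restrict (Ioo a b))))
    (hg : Integrable g (μ.prod (volume.restrict (Ioo a b)))) {P P' : ℝ → ℝ}
    (hP : Continuous P) (hP' : Continuous P')
    (h : ∀ A ∈ 𝒜, ∫ z, f z * (A z.1 * P' z.2) ∂(μ.prod (volume.restrict (Ioo a b))) =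
      -∫ z, g z * (A z.1 * P z.2) ∂(μ.prod (volume.restrict (Ioo a b)))) :
    ∀ᵐ x ∂μ, ∫ s in Ioo a b, (f (x, s) * P' s + g (x, s) * P s) = 0 := by
  have i1 := integrable_mul_continuous_snd hf hP'
  have i2 := integrable_mul_continuous_snd hg hP
  refine h𝒜.ae_fiber_eq_zero (k := fun z => f z * P' z.2 + g z * P z.2) (i1.add i2) fun A hA => ?_
  obtain ⟨C, hC⟩ := h𝒜.bounded A hA
  have hm : AEStronglyMeasurable (fun z : X × ℝ => A z.1)
      (μ.prod (volume.restrict (Ioo a b))) :=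
    ((h𝒜.measurable A hA).comp measurable_fst).aestronglyMeasurable
  have hb : ∀ᵐ z ∂(μ.prod (volume.restrict (Ioo a b))), ‖A z.1‖ ≤ C :=
    ae_of_all _ fun z => hC z.1
  simp only [add_mul]
  rw [integral_add (i1.mul_bdd hm hb) (i2.mul_bdd hm hb)]
  have := h A hA
  rw [eq_neg_iff_add_eq_zero] at this
  rw [← this]
  congr 1 <;> exact integral_congr_ae (ae_of_all _ fun z => by ring)

/-- A function with an integrable weak derivative in one direction is, on almost every line in this
direction, almost everywhere equal to a primitive of the derivative. -/
theorem ae_line_eq_primitive [SFinite μ] (h𝒜 : Determining μ 𝒜) (hab : a < b) (h𝒯 : TestClass a b 𝒯)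
    (hf : Integrable f (μ.prod (volume.restrict (Ioo a b))))
    (hg : Integrable g (μ.prod (volume.restrict (Ioo a b))))
    (h : ∀ A ∈ 𝒜, ∀ P ∈ 𝒯,
      ∫ z, f z * (A z.1 * deriv P z.2) ∂(μ.prod (volume.restrict (Ioo a b))) =
        -∫ z, g z * (A z.1 * P z.2) ∂(μ.prod (volume.restrict (Ioo a b)))) :
    ∀ᵐ x ∂μ, ∃ c, ∀ᵐ s ∂(volume.restrict (Ioo a b)), f (x, s) = c + ∫ r in a..s, g (x, r) := by
  obtain ⟨ℬ, hℬ𝒯, hℬ⟩ := h𝒯.exists_determining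
  obtain ⟨ρ, hρ, hρ1, hρ𝒯⟩ := h𝒯.exists_integral_eq_one hab
  have hc : ∀ B ∈ ℬ, Continuous B := fun B hB => (h𝒯.smooth B (hℬ𝒯 hB)).continuous
  have key : ∀ᵐ x ∂μ, ∀ B ∈ ℬ, ∫ s in Ioo a b,
      (f (x, s) * (B s - (∫ r in a..b, B r) * ρ s) +
      g (x, s) * ∫ r in a..s, (B r - (∫ r in a..b, B r) * ρ r)) = 0 := by
    rw [ae_ball_iff hℬ.countable]
    intro B hB
    have hw : Continuous fun s => B s - (∫ r in a..b, B r) * ρ s :=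
      (hc B hB).sub (continuous_const.mul hρ)
    have hw0 : ∫ s in a..b, (B s - (∫ r in a..b, B r) * ρ s) = 0 := by
      rw [intervalIntegral.integral_sub ((hc B hB).intervalIntegrable _ _)
        ((hρ.intervalIntegrable _ _).const_mul _),
        intervalIntegral.integral_const_mul, hρ1]
      ring
    have hmem := h𝒯.primitive _ (hρ𝒯 B (hℬ𝒯 hB) (∫ r in a..b, B r)) hw0
    have hd : deriv (fun s => ∫ r in a..s, (B r - (∫ r in a..b, B r) * ρ r)) =
        fun s => B s - (∫ r in a..b, B r) * ρ s := by
      funext s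
      exact hw.deriv_integral _ _ _
    refine ae_fiber_test_eq_zero h𝒜 hf hg (h𝒯.smooth _ hmem).continuous hw fun A hA => ?_
    have := h A hA _ hmem
    rwa [hd] at this
  filter_upwards [key, hf.prod_right_ae, hg.prod_right_ae] with x hx hfx hgx
  exact exists_eq_primitive hab hℬ hc hρ hρ1 hfx hgx hx

end Lines

/-! ### Lines in the space-time cylinder -/

section Lines

variable {n : ℕ} {T L H : ℝ}

theorem halfWidth_pos (hL : 0 < L) (hH : 0 < H) (i : Fin (n + 1)) : 0 < halfWidth L H i := by
  unfold halfWidth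
  split_ifs <;> assumption

theorem measurableSet_box : MeasurableSet (box n L H) :=
  MeasurableSet.univ_pi fun _ => measurableSet_Ioo

theorem measurableSet_cylinder : MeasurableSet (cylinder n T L H) :=
  measurableSet_Ioo.prod measurableSet_box

/-- The parameters `(t, x')` of the lines parallel to the `i`-th axis. -/
def sideSet (n : ℕ) (T L H : ℝ) (i : Fin (n + 1)) : Set (ℝ × (Fin n → ℝ)) :=
  Ioo 0 T ×ˢ Set.univ.pi fun j : Fin n =>
    Ioo (-halfWidth L H (i.succAbove j)) (halfWidth L H (i.succAbove j))

theorem isOpen_sideSet (i : Fin (n + 1)) : IsOpen (sideSet n T L H i) :=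
  isOpen_Ioo.prod (isOpen_set_pi finite_univ fun _ _ => isOpen_Ioo)

/-- The point with parameter `s` on a line parallel to the `i`-th axis. -/
noncomputable def lineEquiv (i : Fin (n + 1)) : (ℝ × (Fin n → ℝ)) × ℝ ≃ᵐ ℝ × Pt n :=
  MeasurableEquiv.prodAssoc.trans (MeasurableEquiv.prodCongr (MeasurableEquiv.refl ℝ)
    (MeasurableEquiv.prodComm.trans (MeasurableEquiv.piFinSuccAbove (fun _ => ℝ) i).symm))

theorem lineEquiv_apply (i : Fin (n + 1)) (z : (ℝ × (Fin n → ℝ)) × ℝ) :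
    lineEquiv i z = (z.1.1, Fin.insertNth (α := fun _ => ℝ) i z.2 z.1.2) := rfl

theorem volume_restrict_pi_Ioo {k : ℕ} (a b : Fin k → ℝ) :
    (volume : Measure (Fin k → ℝ)).restrict (Set.univ.pi fun j => Ioo (a j) (b j)) =
      Measure.pi fun j => volume.restrict (Ioo (a j) (b j)) := by
  rw [volume_pi, Measure.restrict_pi_pi]

theorem measurePreserving_lineEquiv (i : Fin (n + 1)) :
    MeasurePreserving (lineEquiv i)
      ((volume.restrict (sideSet n T L H i)).prod
        (volume.restrict (Ioo (-halfWidth L H i) (halfWidth L H i))))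
      (volume.restrict (cylinder n T L H)) := by
  unfold sideSet cylinder box lineEquiv
  rw [Measure.volume_eq_prod, Measure.volume_eq_prod, ← Measure.prod_restrict,
    ← Measure.prod_restrict, volume_restrict_pi_Ioo, volume_restrict_pi_Ioo]
  refine (measurePreserving_prodAssoc _ _ _).trans ?_
  refine (MeasurePreserving.id _).prod ?_
  refine (Measure.measurePreserving_swap).trans ?_
  exact (measurePreserving_piFinSuccAbove
    (fun j => volume.restrict (Ioo (-halfWidth L H j) (halfWidth L H j))) i).symm _

instance isFiniteMeasure_cylinder : IsFiniteMeasure (volume.restrict (cylinder n T L H)) := by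
  refine ⟨?_⟩
  rw [Measure.restrict_apply_univ, cylinder, box, Measure.volume_eq_prod, Measure.prod_prod,
    Real.volume_pi_Ioo]
  exact ENNReal.mul_lt_top (by simp) (ENNReal.prod_lt_top fun i _ => ENNReal.ofReal_lt_top)

theorem volume_real_cylinder (hT : 0 < T) (hL : 0 < L) (hH : 0 < H) :
    volume.real (cylinder n T L H) = T * ∏ i : Fin (n + 1), (2 * halfWidth L H i) := by
  rw [measureReal_def, cylinder, box, Measure.volume_eq_prod, Measure.prod_prod,
    Real.volume_pi_Ioo, ENNReal.toReal_mul, ENNReal.toReal_prod]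
  congr 1
  · simp [hT.le]
  · refine Finset.prod_congr rfl fun i _ => ?_
    rw [ENNReal.toReal_ofReal (by linarith [halfWidth_pos hL hH i])]
    ring

/-! ### Products of one-dimensional test functions on the slab -/

/-- The one-dimensional test functions in the direction `l`: periodic if `l` is horizontal,
compactly supported if it is vertical. -/
noncomputable def coordTests (L H : ℝ) (l : Fin (n + 1)) : Set (ℝ → ℝ) :=
  if l = Fin.last n then compactTests (-H) H else periodicTests L

theorem testClass_coordTests (hL : 0 < L) (l : Fin (n + 1)) :
    TestClass (-halfWidth L H l) (halfWidth L H l) (coordTests L H l) := by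
  unfold coordTests halfWidth
  split_ifs with h
  · exact testClass_compact
  · exact testClass_periodic hL

/-- The product `∏ₗ χₗ(xₗ)`. -/
def prodTest (χ : Fin (n + 1) → ℝ → ℝ) (x : Pt n) : ℝ := ∏ l, χ l (x l)

theorem contDiff_prodTest {χ : Fin (n + 1) → ℝ → ℝ} (h : ∀ l, ContDiff ℝ ∞ (χ l)) :
    ContDiff ℝ ∞ (prodTest χ) := by
  unfold prodTest
  exact contDiff_prod fun l _ => (h l).comp (contDiff_apply ℝ ℝ l)

theorem contDiff_of_coordTests (hL : 0 < L) {χ : Fin (n + 1) → ℝ → ℝ}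
    (h : ∀ l, χ l ∈ coordTests L H l) (l : Fin (n + 1)) : ContDiff ℝ ∞ (χ l) :=
  (testClass_coordTests (H := H) hL l).smooth _ (h l)

theorem prodTest_mem {χ : Fin (n + 1) → ℝ → ℝ} (hL : 0 < L)
    (h : ∀ l, χ l ∈ coordTests L H l) : prodTest χ ∈ testSpace n L H := by
  refine ⟨contDiff_prodTest (contDiff_of_coordTests hL h), ?_, ?_⟩
  · intro i hi x
    refine Finset.prod_congr rfl fun l _ => ?_
    by_cases hl : l = i
    · subst hl
      have := h l
      rw [coordTests, if_neg hi] at this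
      rw [Pi.add_apply, Pi.single_eq_same]
      exact this.2 (x l)
    · rw [Pi.add_apply, Pi.single_eq_of_ne hl, add_zero]
  · have := h (Fin.last n)
    rw [coordTests, if_pos rfl] at this
    obtain ⟨_, ε, hε, hz⟩ := this
    refine ⟨H - ε, by linarith, fun x hx => ?_⟩
    refine Finset.prod_eq_zero (Finset.mem_univ (Fin.last n)) (hz _ ?_)
    rcases lt_abs.1 hx with h | h
    · exact Or.inr h
    · left; linarith

theorem fderiv_of_line {V : Type*} [NormedAddCommGroup V] [NormedSpace ℝ V] {φ : V → ℝ} {p v : V}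
    (hφ : DifferentiableAt ℝ φ p) {k s : ℝ} {P : ℝ → ℝ} (h : ∀ r : ℝ, φ (p + r • v) = k * P (s + r)) : fderiv ℝ φ p v = k * deriv P s := by
  rw [← hφ.lineDeriv_eq_fderiv, lineDeriv]
  simp only [h]
  rw [deriv_const_mul_field, deriv_comp_const_add, add_zero]

theorem prodTest_add_single (χ : Fin (n + 1) → ℝ → ℝ) (i : Fin (n + 1)) (x : Pt n) (r : ℝ) :
    prodTest χ (x + r • Pi.single i 1) =
      (∏ j, χ (i.succAbove j) (x (i.succAbove j))) * χ i (x i + r) := by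
  rw [prodTest, Fin.prod_univ_succAbove _ i, mul_comm]
  congr 1
  · refine Finset.prod_congr rfl fun j _ => ?_
    simp
  · simp

theorem fderiv_prodTest {χ : Fin (n + 1) → ℝ → ℝ} (h : ∀ l, ContDiff ℝ ∞ (χ l))
    (i : Fin (n + 1)) (x : Pt n) :
    fderiv ℝ (prodTest χ) x (Pi.single i 1) =
      (∏ j, χ (i.succAbove j) (x (i.succAbove j))) * deriv (χ i) (x i) :=
  fderiv_of_line ((contDiff_prodTest h).differentiable (by simp)).differentiableAt
    (prodTest_add_single χ i x)

/-- `G` is the weak derivative of `F` in the direction `i` on the cylinder, tested against products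
of one-dimensional test functions only. -/
def HasProdWeakDeriv (n : ℕ) (T L H : ℝ) (i : Fin (n + 1)) (F G : ℝ × Pt n → ℝ) : Prop :=
  ∀ A ∈ compactTests 0 T, ∀ χ : Fin (n + 1) → ℝ → ℝ, (∀ l, χ l ∈ coordTests L H l) →
    ∫ p in cylinder n T L H, F p * (A p.1 * fderiv ℝ (prodTest χ) p.2 (Pi.single i 1)) =
      -∫ p in cylinder n T L H, G p * (A p.1 * prodTest χ p.2)

theorem exists_determining_side (hL : 0 < L) (i : Fin (n + 1)) :
    ∃ 𝒜, Determining (volume.restrict (sideSet n T L H i)) 𝒜 ∧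
      ∀ B ∈ 𝒜, ∃ A ∈ compactTests 0 T, ∃ χ : Fin n → ℝ → ℝ,
        (∀ j, χ j ∈ coordTests L H (i.succAbove j)) ∧
          B = fun z => A z.1 * ∏ j, χ j (z.2 j) := by
  obtain ⟨ℬ₀, h1, h2⟩ := (testClass_compact (a := 0) (b := T)).exists_determining
  obtain ⟨ℬ, h3, h4⟩ := exists_determining_pi n _ _ _
    fun j => testClass_coordTests (H := H) hL (i.succAbove j)
  refine ⟨image2 (fun A B => fun z : ℝ × (Fin n → ℝ) => A z.1 * B z.2) ℬ₀ ℬ, ?_, ?_⟩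
  · unfold sideSet
    rw [Measure.volume_eq_prod, ← Measure.prod_restrict, volume_restrict_pi_Ioo]
    exact h2.prod h3
  · rintro _ ⟨A, hA, B, hB, rfl⟩
    obtain ⟨χ, hχ, rfl⟩ := h4 B hB
    exact ⟨A, h1 hA, χ, hχ, rfl⟩

theorem integrable_comp_lineEquiv {F : ℝ × Pt n → ℝ} (i : Fin (n + 1))
    (hF : Integrable F (volume.restrict (cylinder n T L H))) :
    Integrable (fun z => F (lineEquiv i z)) ((volume.restrict (sideSet n T L H i)).prod
        (volume.restrict (Ioo (-halfWidth L H i) (halfWidth L H i)))) :=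
  (measurePreserving_lineEquiv i).integrable_comp_of_integrable hF

theorem HasProdWeakDeriv.line_test (hL : 0 < L) {i : Fin (n + 1)} {F G : ℝ × Pt n → ℝ}
    (h : HasProdWeakDeriv n T L H i F G) {A : ℝ → ℝ} (hA : A ∈ compactTests 0 T)
    {χ : Fin n → ℝ → ℝ} (hχ : ∀ j, χ j ∈ coordTests L H (i.succAbove j)) {P : ℝ → ℝ}
    (hP : P ∈ coordTests L H i) :
    ∫ z, F (lineEquiv i z) * ((A z.1.1 * ∏ j, χ j (z.1.2 j)) * deriv P z.2)
        ∂((volume.restrict (sideSet n T L H i)).prod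
          (volume.restrict (Ioo (-halfWidth L H i) (halfWidth L H i)))) =
      -∫ z, G (lineEquiv i z) * ((A z.1.1 * ∏ j, χ j (z.1.2 j)) * P z.2)
        ∂((volume.restrict (sideSet n T L H i)).prod
          (volume.restrict (Ioo (-halfWidth L H i) (halfWidth L H i)))) := by
  set χ' : Fin (n + 1) → ℝ → ℝ := Fin.insertNth (α := fun _ => ℝ → ℝ) i P χ with hχ'
  have hmem : ∀ l, χ' l ∈ coordTests L H l := by
    intro l
    induction l using Fin.succAboveCases i with
    | x => simpa [hχ'] using hP
    | p j => simpa [hχ'] using hχ j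
  have h1 := h A hA χ' hmem
  rw [← (measurePreserving_lineEquiv i).integral_comp',
    ← (measurePreserving_lineEquiv i).integral_comp'] at h1
  have hi : χ' i = P := by simp [hχ']
  have hj : ∀ j, χ' (i.succAbove j) = χ j := by simp [hχ']
  have e1 : ∀ z : (ℝ × (Fin n → ℝ)) × ℝ,
      fderiv ℝ (prodTest χ') (lineEquiv i z).2 (Pi.single i 1) =
        (∏ j, χ j (z.1.2 j)) * deriv P z.2 := by
    intro z
    rw [fderiv_prodTest (contDiff_of_coordTests hL hmem), hi]
    simp only [hj, lineEquiv_apply, Fin.insertNth_apply_succAbove, Fin.insertNth_apply_same]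
  have e2 : ∀ z : (ℝ × (Fin n → ℝ)) × ℝ,
      prodTest χ' (lineEquiv i z).2 = (∏ j, χ j (z.1.2 j)) * P z.2 := by
    intro z
    rw [prodTest, Fin.prod_univ_succAbove _ i, hi, mul_comm]
    simp only [hj, lineEquiv_apply, Fin.insertNth_apply_succAbove, Fin.insertNth_apply_same]
  simp only [e1, e2] at h1
  simpa only [mul_assoc, lineEquiv_apply] using h1

theorem HasProdWeakDeriv.ae_line (hL : 0 < L) (hH : 0 < H) {i : Fin (n + 1)}
    {F G : ℝ × Pt n → ℝ} (h : HasProdWeakDeriv n T L H i F G)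
    (hF : Integrable F (volume.restrict (cylinder n T L H)))
    (hG : Integrable G (volume.restrict (cylinder n T L H))) :
    ∀ᵐ y ∂(volume.restrict (sideSet n T L H i)),
      ∃ c, ∀ᵐ s ∂(volume.restrict (Ioo (-halfWidth L H i) (halfWidth L H i))),
        F (lineEquiv i (y, s)) = c + ∫ r in (-halfWidth L H i)..s, G (lineEquiv i (y, r)) := by
  obtain ⟨𝒜, h1, h2⟩ := exists_determining_side (n := n) (T := T) (H := H) hL i
  refine ae_line_eq_primitive (f := fun z => F (lineEquiv i z))
    (g := fun z => G (lineEquiv i z)) h1 (by linarith [halfWidth_pos hL hH i])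
    (testClass_coordTests hL i) (integrable_comp_lineEquiv i hF) (integrable_comp_lineEquiv i hG)
    fun B hB P hP => ?_
  obtain ⟨A, hA, χ, hχ, rfl⟩ := h2 B hB
  exact h.line_test hL hA hχ hP

/-- In a horizontal direction constants are admissible one-dimensional test functions. -/
theorem HasProdWeakDeriv.ae_integral_eq_zero (hL : 0 < L) {i : Fin (n + 1)}
    (hi : i ≠ Fin.last n)
    {F G : ℝ × Pt n → ℝ} (h : HasProdWeakDeriv n T L H i F G)
    (hF : Integrable F (volume.restrict (cylinder n T L H)))
    (hG : Integrable G (volume.restrict (cylinder n T L H))) :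
    ∀ᵐ y ∂(volume.restrict (sideSet n T L H i)),
      ∫ r in Ioo (-halfWidth L H i) (halfWidth L H i), G (lineEquiv i (y, r)) = 0 := by
  obtain ⟨𝒜, h1, h2⟩ := exists_determining_side (n := n) (T := T) (H := H) hL i
  have := ae_fiber_test_eq_zero (f := fun z => F (lineEquiv i z))
    (g := fun z => G (lineEquiv i z)) (P := fun _ => 1) (P' := fun _ => 0) h1
    (integrable_comp_lineEquiv i hF) (integrable_comp_lineEquiv i hG) continuous_const
    continuous_const fun B hB => ?_
  · simpa using this
  · obtain ⟨A, hA, χ, hχ, rfl⟩ := h2 B hB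
    have hP : (fun _ => 1 : ℝ → ℝ) ∈ coordTests L H i := by
      rw [coordTests, if_neg hi]
      exact ⟨contDiff_const, fun _ => rfl⟩
    simpa using h.line_test hL hA hχ hP

/-! ### The two sources of weak derivatives -/

/-- The closed space-time cylinder over the fundamental box. -/
def closedCylinder (n : ℕ) (T L H : ℝ) : Set (ℝ × Pt n) :=
  Icc 0 T ×ˢ Set.univ.pi fun i : Fin (n + 1) => Icc (-halfWidth L H i) (halfWidth L H i)

theorem isCompact_closedCylinder : IsCompact (closedCylinder n T L H) :=
  isCompact_Icc.prod (isCompact_univ_pi fun _ => isCompact_Icc)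

theorem cylinder_subset_closedCylinder : cylinder n T L H ⊆ closedCylinder n T L H :=
  prod_mono Ioo_subset_Icc_self (pi_mono fun _ _ => Ioo_subset_Icc_self)

theorem integrable_mul_continuous_cylinder {F ψ : ℝ × Pt n → ℝ}
    (hF : Integrable F (volume.restrict (cylinder n T L H))) (hψ : Continuous ψ) :
    Integrable (fun p => F p * ψ p) (volume.restrict (cylinder n T L H)) := by
  obtain ⟨C, hC⟩ := isCompact_closedCylinder.exists_bound_of_continuousOn
    (hψ.continuousOn (s := closedCylinder n T L H))
  refine hF.mul_bdd (c := C) hψ.aestronglyMeasurable ?_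
  filter_upwards [ae_restrict_mem measurableSet_cylinder] with p hp
    using hC p (cylinder_subset_closedCylinder hp)

theorem L2W12.integrable_val (f : L2W12 n T L H) :
    Integrable f.val (volume.restrict (cylinder n T L H)) :=
  f.memLp_val.integrable (by norm_num)

theorem L2W12.integrable_grad (f : L2W12 n T L H) (i : Fin (n + 1)) :
    Integrable (f.grad i) (volume.restrict (cylinder n T L H)) :=
  (f.memLp_grad i).integrable (by norm_num)

theorem setIntegral_cylinder {F : ℝ × Pt n → ℝ}
    (hF : Integrable F (volume.restrict (cylinder n T L H))) :
    ∫ p in cylinder n T L H, F p = ∫ t in Ioo 0 T, ∫ x in box n L H, F (t, x) := by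
  rw [cylinder, Measure.volume_eq_prod] at *
  exact setIntegral_prod F hF

theorem continuous_fderiv_prodTest {χ : Fin (n + 1) → ℝ → ℝ} (h : ∀ l, ContDiff ℝ ∞ (χ l))
    (v : Pt n) : Continuous fun x => fderiv ℝ (prodTest χ) x v :=
  ((contDiff_prodTest h).continuous_fderiv (by simp)).clm_apply continuous_const

theorem L2W12.hasProdWeakDeriv (hL : 0 < L) (f : L2W12 n T L H) (i : Fin (n + 1)) :
    HasProdWeakDeriv n T L H i f.val (f.grad i) := by
  intro A hA χ hχ
  have hs := contDiff_of_coordTests hL hχ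
  have hAc : Continuous fun p : ℝ × Pt n => A p.1 := hA.1.continuous.comp continuous_fst
  have hφ : Continuous fun p : ℝ × Pt n => A p.1 * prodTest χ p.2 :=
    hAc.mul ((contDiff_prodTest hs).continuous.comp continuous_snd)
  have hφ' : Continuous fun p : ℝ × Pt n =>
      A p.1 * fderiv ℝ (prodTest χ) p.2 (Pi.single i 1) :=
    hAc.mul ((continuous_fderiv_prodTest hs _).comp continuous_snd)
  rw [setIntegral_cylinder (integrable_mul_continuous_cylinder f.integrable_val hφ'),
    setIntegral_cylinder (integrable_mul_continuous_cylinder (f.integrable_grad i) hφ),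
    ← integral_neg]
  refine integral_congr_ae ?_
  filter_upwards [f.weak] with t ht
  have := ht i (prodTest χ) (prodTest_mem hL hχ)
  have e : ∀ a b c : ℝ, a * (b * c) = b * (a * c) := fun a b c => by ring
  simp only [e _ (A t)]
  rw [integral_const_mul, integral_const_mul, this]
  ring

theorem BdryTemp.continuousOn_closedCylinder (θB : BdryTemp n T L H) :
    ContinuousOn θB.val (closedCylinder n T L H) := by
  refine θB.cont.mono (prod_mono Subset.rfl fun x hx => ?_)
  have := hx (Fin.last n) (mem_univ _)
  simp only [halfWidth, if_true] at this
  exact abs_le.2 this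

theorem BdryTemp.integrable_val (θB : BdryTemp n T L H) :
    Integrable θB.val (volume.restrict (cylinder n T L H)) :=
  (θB.continuousOn_closedCylinder.integrableOn_compact isCompact_closedCylinder).mono_set
    cylinder_subset_closedCylinder

theorem BdryTemp.integrable_d1 (θB : BdryTemp n T L H) (a : Option (Fin (n + 1))) :
    Integrable (θB.d1 a) (volume.restrict (cylinder n T L H)) :=
  (θB.memLp_d1 a).integrable le_top

theorem prodTest_mem_spaceTime {A : ℝ → ℝ} (hA : A ∈ compactTests 0 T)
    {χ : Fin (n + 1) → ℝ → ℝ} (hL : 0 < L) (h : ∀ l, χ l ∈ coordTests L H l) :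
    (fun p : ℝ × Pt n => A p.1 * prodTest χ p.2) ∈ testSpaceTime n T L H := by
  obtain ⟨h1, h2, r, hr, h3⟩ := prodTest_mem hL h
  obtain ⟨hA1, ε, hε, hA2⟩ := hA
  refine ⟨(hA1.comp contDiff_fst).mul (h1.comp contDiff_snd), fun t i hi x => ?_,
    r, hr, ε, hε, fun t x hx => ?_⟩
  · dsimp only
    rw [h2 i hi x]
  · dsimp only
    rcases hx with hx | hx
    · rw [h3 x hx, mul_zero]
    · rw [hA2 t (by simpa using hx), zero_mul]

theorem BdryTemp.hasProdWeakDeriv (hL : 0 < L) (θB : BdryTemp n T L H) (i : Fin (n + 1)) :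
    HasProdWeakDeriv n T L H i θB.val (θB.d1 (some i)) := by
  intro A hA χ hχ
  have hmem := prodTest_mem_spaceTime hA hL hχ
  rw [← θB.weak_d1 (some i) _ hmem]
  have hs := contDiff_of_coordTests hL hχ
  refine integral_congr_ae (ae_of_all _ fun p => ?_)
  dsimp only
  rw [fderiv_prodTest hs, ← mul_assoc (A p.1)]
  congr 1
  symm
  refine fderiv_of_line (hmem.1.differentiable (by simp)).differentiableAt fun r => ?_
  simp only [stDir, Prod.smul_mk, smul_zero, Prod.fst_add, Prod.snd_add, add_zero,
    prodTest_add_single]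
  ring

end Lines

/-! ### Regularity of the boundary temperature -/

theorem eq_primitive_on_Icc {a b : ℝ} (hab : a < b) {F g : ℝ → ℝ}
    (hF : ContinuousOn F (Icc a b)) (hg : Integrable g (volume.restrict (Ioo a b)))
    (h : ∃ c, ∀ᵐ s ∂(volume.restrict (Ioo a b)), F s = c + ∫ r in a..s, g r) :
    ∀ s ∈ Icc a b, F s = F a + ∫ r in a..s, g r := by
  obtain ⟨c, hc⟩ := h
  have hp := continuousOn_primitive (intervalIntegrable_of_Ioo hab.le hg) c
  rw [uIcc_of_le hab.le] at hp
  rw [Measure.restrict_congr_set Ioo_ae_eq_Icc] at hc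
  have heq := Measure.eqOn_Icc_of_ae_eq volume hab.ne hc hF hp
  have ha := heq (left_mem_Icc.2 hab.le)
  simp only [intervalIntegral.integral_same, add_zero] at ha
  intro s hs
  rw [ha]
  exact heq hs

theorem abs_primitive_sub_le {a b : ℝ} (hab : a < b) {F g : ℝ → ℝ} {K : ℝ}
    (hg : Integrable g (volume.restrict (Ioo a b)))
    (hK : ∀ᵐ s ∂(volume.restrict (Ioo a b)), |g s| ≤ K)
    (h : ∀ s ∈ Icc a b, F s = F a + ∫ r in a..s, g r) :
    ∀ s ∈ Icc a b, ∀ r ∈ Icc a b, |F s - F r| ≤ K * |s - r| := by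
  intro s hs r hr
  have hi := intervalIntegrable_of_Ioo hab.le hg
  have hsub : ∀ p ∈ Icc a b, IntervalIntegrable g volume a p := fun p hp =>
    hi.mono_set (by rw [uIcc_of_le hab.le, uIcc_of_le hp.1]; exact Icc_subset_Icc_right hp.2)
  rw [h s hs, h r hr, add_sub_add_left_eq_sub,
    intervalIntegral.integral_interval_sub_left (hsub s hs) (hsub r hr)]
  refine intervalIntegral.norm_integral_le_of_norm_le_const_ae (E := ℝ) ?_
  rw [Measure.restrict_congr_set Ioo_ae_eq_Icc, ae_restrict_iff' measurableSet_Icc] at hK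
  filter_upwards [hK] with y hy hym
  exact hy ((uIcc_subset_Icc hr hs) (uIoc_subset_uIcc hym))

/-- If the derivative on almost every line is bounded by `K`, then a continuous function is
`K`-Lipschitz on every line. -/
theorem lipschitz_of_ae_line {X : Type*} [TopologicalSpace X] [MeasurableSpace X]
    {μ : Measure X} [SFinite μ] [μ.IsOpenPosMeasure] {D : Set X} (hD : IsOpen D)
    (hDm : MeasurableSet D) {a b : ℝ} (hab : a < b) {f g : X × ℝ → ℝ} {K : ℝ}
    (hf : ContinuousOn f (closure D ×ˢ Icc a b))
    (hg : Integrable g ((μ.restrict D).prod (volume.restrict (Ioo a b))))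
    (hK : ∀ᵐ z ∂((μ.restrict D).prod (volume.restrict (Ioo a b))), |g z| ≤ K)
    (h : ∀ᵐ x ∂(μ.restrict D), ∃ c, ∀ᵐ s ∂(volume.restrict (Ioo a b)),
      f (x, s) = c + ∫ r in a..s, g (x, r)) :
    ∀ x ∈ closure D, ∀ s ∈ Icc a b, ∀ r ∈ Icc a b, |f (x, s) - f (x, r)| ≤ K * |s - r| := by
  have hgood : ∀ᵐ x ∂μ, x ∈ D → ∀ s ∈ Icc a b, ∀ r ∈ Icc a b,
      |f (x, s) - f (x, r)| ≤ K * |s - r| := by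
    rw [← ae_restrict_iff' hDm]
    filter_upwards [h, hg.prod_right_ae, Measure.ae_ae_of_ae_prod hK, ae_restrict_mem hDm]
      with x hx hgx hKx hxD
    refine abs_primitive_sub_le (F := fun s => f (x, s)) hab hgx hKx
      (eq_primitive_on_Icc hab ?_ hgx hx)
    exact hf.comp (by fun_prop) fun s hs => ⟨subset_closure hxD, hs⟩
  have hdense := Measure.dense_of_ae hgood
  intro x hx s hs r hr
  have hc : ∀ p ∈ Icc a b, ContinuousOn (fun x => f (x, p)) (closure D) := fun p hp =>
    hf.comp (by fun_prop) fun y hy => ⟨hy, hp⟩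
  have hsub : closure D ⊆ closure (D ∩ {x | x ∈ D → ∀ s ∈ Icc a b, ∀ r ∈ Icc a b,
      |f (x, s) - f (x, r)| ≤ K * |s - r|}) :=
    closure_minimal (hdense.open_subset_closure_inter hD) isClosed_closure
  have hsub' : closure (D ∩ {x | x ∈ D → ∀ s ∈ Icc a b, ∀ r ∈ Icc a b,
      |f (x, s) - f (x, r)| ≤ K * |s - r|}) ⊆ closure D := closure_mono inter_subset_left
  exact le_on_closure (fun y hy => hy.2 hy.1 s hs r hr)
    (((hc s hs).sub (hc r hr)).abs.mono hsub') continuousOn_const (hsub hx)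

section Bdry

variable {n : ℕ} {T L H : ℝ}

theorem closure_sideSet (hT : 0 < T) (hL : 0 < L) (hH : 0 < H) (i : Fin (n + 1)) :
    closure (sideSet n T L H i) = Icc 0 T ×ˢ Set.univ.pi fun j : Fin n =>
      Icc (-halfWidth L H (i.succAbove j)) (halfWidth L H (i.succAbove j)) := by
  rw [sideSet, closure_prod_eq, closure_pi_set, closure_Ioo hT.ne]
  congr! 3 with j
  exact closure_Ioo (by linarith [halfWidth_pos hL hH (i.succAbove j)])

theorem continuous_lineEquiv (i : Fin (n + 1)) : Continuous (lineEquiv (n := n) i) := by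
  have : (lineEquiv (n := n) i : _ → _) =
      fun z => (z.1.1, Fin.insertNth (α := fun _ => ℝ) i z.2 z.1.2) := rfl
  rw [this]
  fun_prop

theorem lineEquiv_mem_closed {i : Fin (n + 1)} {z : (ℝ × (Fin n → ℝ)) × ℝ}
    (h1 : z.1 ∈ Icc 0 T ×ˢ Set.univ.pi fun j : Fin n =>
      Icc (-halfWidth L H (i.succAbove j)) (halfWidth L H (i.succAbove j)))
    (h2 : z.2 ∈ Icc (-halfWidth L H i) (halfWidth L H i)) :
    lineEquiv i z ∈ closedCylinder n T L H := by
  refine ⟨h1.1, fun l _ => ?_⟩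
  rw [lineEquiv_apply]
  induction l using Fin.succAboveCases i with
  | x => simpa using h2
  | p j =>
    simp only [Fin.insertNth_apply_succAbove]
    exact h1.2 j (mem_univ _)

theorem BdryTemp.continuousOn_lineEquiv (θB : BdryTemp n T L H) (hT : 0 < T) (hL : 0 < L)
    (hH : 0 < H) (i : Fin (n + 1)) :
    ContinuousOn (fun z => θB.val (lineEquiv i z))
      (closure (sideSet n T L H i) ×ˢ Icc (-halfWidth L H i) (halfWidth L H i)) := by
  rw [closure_sideSet hT hL hH]
  exact θB.continuousOn_closedCylinder.comp (continuous_lineEquiv i).continuousOn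
    fun z hz => lineEquiv_mem_closed hz.1 hz.2

theorem BdryTemp.ae_line (θB : BdryTemp n T L H) (hT : 0 < T) (hL : 0 < L) (hH : 0 < H)
    (i : Fin (n + 1)) :
    ∀ᵐ y ∂(volume.restrict (sideSet n T L H i)),
      ∀ s ∈ Icc (-halfWidth L H i) (halfWidth L H i), θB.val (lineEquiv i (y, s)) =
        θB.val (lineEquiv i (y, -halfWidth L H i)) +
          ∫ r in (-halfWidth L H i)..s, θB.d1 (some i) (lineEquiv i (y, r)) := by
  have hw := halfWidth_pos hL hH i
  filter_upwards [(θB.hasProdWeakDeriv hL i).ae_line hL hH θB.integrable_val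
    (θB.integrable_d1 _), (integrable_comp_lineEquiv i (θB.integrable_d1 (some i))).prod_right_ae,
    ae_restrict_mem (isOpen_sideSet i).measurableSet] with y h1 h2 hy
  refine eq_primitive_on_Icc (F := fun s => θB.val (lineEquiv i (y, s))) (by linarith) ?_ h2 h1
  exact (θB.continuousOn_lineEquiv hT hL hH i).comp (by fun_prop)
    fun s hs => ⟨subset_closure hy, hs⟩

theorem ae_abs_le_supNorm {f : ℝ × Pt n → ℝ}
    (hf : MemLp f ⊤ (volume.restrict (cylinder n T L H))) :
    ∀ᵐ p ∂(volume.restrict (cylinder n T L H)), |f p| ≤ supNorm n T L H f := by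
  have hfin : eLpNorm f ⊤ (volume.restrict (cylinder n T L H)) ≠ ⊤ := hf.2.ne
  have h2 := ae_le_eLpNormEssSup (f := f) (μ := volume.restrict (cylinder n T L H))
  rw [← eLpNorm_exponent_top] at h2
  filter_upwards [h2] with p hp
  have := ENNReal.toReal_mono hfin hp
  simpa [supNorm] using this

theorem BdryTemp.supNorm_d1_le (θB : BdryTemp n T L H) (a : Option (Fin (n + 1))) :
    supNorm n T L H (θB.d1 a) ≤ θB.w2Norm := by
  have h0 : ∀ f, 0 ≤ supNorm n T L H f := fun f => ENNReal.toReal_nonneg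
  have h1 : supNorm n T L H (θB.d1 a) ≤ ∑ a, supNorm n T L H (θB.d1 a) :=
    Finset.single_le_sum (f := fun a => supNorm n T L H (θB.d1 a)) (fun a _ => h0 _)
      (Finset.mem_univ a)
  have h2 : 0 ≤ ∑ a, ∑ b, supNorm n T L H (θB.d2 a b) :=
    Finset.sum_nonneg fun a _ => Finset.sum_nonneg fun b _ => h0 _
  have := h0 θB.val
  unfold BdryTemp.w2Norm
  linarith

theorem BdryTemp.w2Norm_nonneg (θB : BdryTemp n T L H) : 0 ≤ θB.w2Norm :=
  ENNReal.toReal_nonneg.trans (θB.supNorm_d1_le none)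

theorem BdryTemp.ae_abs_d1_le (θB : BdryTemp n T L H) (a : Option (Fin (n + 1))) :
    ∀ᵐ p ∂(volume.restrict (cylinder n T L H)), |θB.d1 a p| ≤ θB.w2Norm := by
  filter_upwards [ae_abs_le_supNorm (θB.memLp_d1 a)] with p hp
  exact hp.trans (θB.supNorm_d1_le a)

theorem BdryTemp.lipschitz_line (θB : BdryTemp n T L H) (hT : 0 < T) (hL : 0 < L) (hH : 0 < H)
    (i : Fin (n + 1)) :
    ∀ y ∈ closure (sideSet n T L H i), ∀ s ∈ Icc (-halfWidth L H i) (halfWidth L H i),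
      ∀ r ∈ Icc (-halfWidth L H i) (halfWidth L H i),
        |θB.val (lineEquiv i (y, s)) - θB.val (lineEquiv i (y, r))| ≤ θB.w2Norm * |s - r| :=
  lipschitz_of_ae_line (f := fun z => θB.val (lineEquiv i z))
    (g := fun z => θB.d1 (some i) (lineEquiv i z)) (isOpen_sideSet i)
    (isOpen_sideSet i).measurableSet (by linarith [halfWidth_pos hL hH i])
    (θB.continuousOn_lineEquiv hT hL hH i) (integrable_comp_lineEquiv i (θB.integrable_d1 _))
    ((measurePreserving_lineEquiv i).quasiMeasurePreserving.ae (θB.ae_abs_d1_le _))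
    ((θB.hasProdWeakDeriv hL i).ae_line hL hH θB.integrable_val (θB.integrable_d1 _))

theorem isOpen_box : IsOpen (box n L H) := isOpen_set_pi finite_univ fun _ _ => isOpen_Ioo

theorem closure_box (hL : 0 < L) (hH : 0 < H) : closure (box n L H) =
    Set.univ.pi fun i : Fin (n + 1) => Icc (-halfWidth L H i) (halfWidth L H i) := by
  rw [box, closure_pi_set]
  congr! 2 with j
  exact closure_Ioo (by linarith [halfWidth_pos hL hH j])

theorem BdryTemp.lipschitz_time (θB : BdryTemp n T L H) (hT : 0 < T) (hL : 0 < L) (hH : 0 < H) :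
    ∀ x ∈ closure (box n L H), ∀ s ∈ Icc 0 T, ∀ r ∈ Icc 0 T,
        |θB.val (s, x) - θB.val (r, x)| ≤ θB.w2Norm * |s - r| := by
  have hmp : MeasurePreserving (MeasurableEquiv.prodComm (α := Pt n) (β := ℝ))
      ((volume.restrict (box n L H)).prod (volume.restrict (Ioo 0 T)))
      (volume.restrict (cylinder n T L H)) := by
    unfold cylinder
    rw [Measure.volume_eq_prod, ← Measure.prod_restrict]
    exact Measure.measurePreserving_swap
  have hcomp : ∀ F : ℝ × Pt n → ℝ, Integrable F (volume.restrict (cylinder n T L H)) →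
      Integrable (fun z : Pt n × ℝ => F (z.2, z.1))
        ((volume.restrict (box n L H)).prod (volume.restrict (Ioo 0 T))) := fun F hF =>
    hmp.integrable_comp_of_integrable hF
  obtain ⟨ℬ, h1, h2⟩ := exists_determining_pi (n + 1) _ _ _
    fun j => testClass_coordTests (H := H) hL j
  rw [← volume_restrict_pi_Ioo] at h1
  refine lipschitz_of_ae_line (f := fun z => θB.val (z.2, z.1))
    (g := fun z => θB.d1 none (z.2, z.1)) isOpen_box measurableSet_box hT ?_
    (hcomp _ (θB.integrable_d1 _)) (hmp.quasiMeasurePreserving.ae (θB.ae_abs_d1_le none)) ?_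
  · rw [closure_box hL hH]
    exact θB.continuousOn_closedCylinder.comp (by fun_prop) fun z hz => ⟨hz.2, hz.1⟩
  · refine ae_line_eq_primitive (f := fun z => θB.val (z.2, z.1))
      (g := fun z => θB.d1 none (z.2, z.1)) h1 hT testClass_compact (hcomp _ θB.integrable_val)
      (hcomp _ (θB.integrable_d1 _)) fun B hB P hP => ?_
    obtain ⟨χ, hχ, rfl⟩ := h2 B hB
    have hmem := prodTest_mem_spaceTime hP hL hχ
    have hw := θB.weak_d1 none _ hmem
    rw [← hmp.integral_comp', ← hmp.integral_comp'] at hw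
    have e1 : ∀ z : Pt n × ℝ, fderiv ℝ (fun p : ℝ × Pt n => P p.1 * prodTest χ p.2)
        (z.2, z.1) (stDir none) = prodTest χ z.1 * deriv P z.2 := by
      intro z
      refine fderiv_of_line (hmem.1.differentiable (by simp)).differentiableAt fun r => ?_
      simp only [stDir, Prod.smul_mk, smul_zero, Prod.mk_add_mk, add_zero, smul_eq_mul, mul_one]
      ring
    have hs : ∀ z : Pt n × ℝ, MeasurableEquiv.prodComm z = (z.2, z.1) := fun z => rfl
    simp only [hs, e1] at hw
    simpa only [prodTest, mul_comm (P _)] using hw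

theorem BdryTemp.abs_sub_update_le (θB : BdryTemp n T L H) (hT : 0 < T) (hL : 0 < L) (hH : 0 < H)
    {t : ℝ} {x : Pt n} (hx : (t, x) ∈ closedCylinder n T L H) (i : Fin (n + 1)) {s : ℝ}
    (hs : s ∈ Icc (-halfWidth L H i) (halfWidth L H i)) :
    |θB.val (t, x) - θB.val (t, Function.update x i s)| ≤ θB.w2Norm * |x i - s| := by
  have := θB.lipschitz_line hT hL hH i (t, i.removeNth x) (by
    rw [closure_sideSet hT hL hH]
    exact ⟨hx.1, fun j _ => hx.2 _ (mem_univ _)⟩) (x i) (hx.2 i (mem_univ i)) s hs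
  simpa [lineEquiv_apply, Fin.insertNth_removeNth] using this

/-- `ϑ_B` is Lipschitz continuous up to the boundary. -/
theorem BdryTemp.lipschitz (θB : BdryTemp n T L H) (hT : 0 < T) (hL : 0 < L) (hH : 0 < H)
    {t t' : ℝ} {x y : Pt n} (hx : (t, x) ∈ closedCylinder n T L H)
    (hy : (t', y) ∈ closedCylinder n T L H) :
    |θB.val (t', y) - θB.val (t, x)| ≤ θB.w2Norm * (|t' - t| + ∑ j, |x j - y j|) := by
  have h1 : |θB.val (t', y) - θB.val (t, y)| ≤ θB.w2Norm * |t' - t| :=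
    θB.lipschitz_time hT hL hH y (by rw [closure_box hL hH]; exact hy.2) t' hy.1 t hx.1
  have h2 : ∀ S : Finset (Fin (n + 1)), |θB.val (t, x) - θB.val (t, S.piecewise y x)| ≤
      θB.w2Norm * ∑ j ∈ S, |x j - y j| := by
    intro S
    induction S using Finset.induction with
    | empty => simp
    | insert i S hi ih =>
      rw [Finset.sum_insert hi, Finset.piecewise_insert]
      have hmem : (t, S.piecewise y x) ∈ closedCylinder n T L H := by
        refine ⟨hx.1, fun j _ => ?_⟩
        by_cases hj : j ∈ S
        · simpa [hj] using hy.2 j (mem_univ j)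
        · simpa [hj] using hx.2 j (mem_univ j)
      have h3 := θB.abs_sub_update_le hT hL hH hmem i (hy.2 i (mem_univ i))
      rw [Finset.piecewise_eq_of_notMem _ _ _ hi] at h3
      have := abs_sub_le (θB.val (t, x)) (θB.val (t, S.piecewise y x))
        (θB.val (t, Function.update (S.piecewise y x) i (y i)))
      linarith
  have h3 := h2 Finset.univ
  rw [Finset.piecewise_univ] at h3
  have := abs_sub_le (θB.val (t', y)) (θB.val (t, y)) (θB.val (t, x))
  rw [abs_sub_comm (θB.val (t, y))] at this
  linarith

theorem abs_faceAverage_sub_le (m : Mesh L H) (i : Fin (n + 1)) (k : Idx n) {f : Pt n → ℝ}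
    {z δ : ℝ}
    (hc : ContinuousOn (fun y => f (Fin.insertNth (α := fun _ => ℝ) i
      (-halfWidth L H i + m.h * k i) y)) (Set.univ.pi fun j : Fin n =>
        Icc (-halfWidth L H (i.succAbove j) + m.h * k (i.succAbove j))
          (-halfWidth L H (i.succAbove j) + m.h * (k (i.succAbove j) + 1))))
    (hδ : ∀ y ∈ (Set.univ.pi fun j : Fin n =>
        Icc (-halfWidth L H (i.succAbove j) + m.h * k (i.succAbove j))
          (-halfWidth L H (i.succAbove j) + m.h * (k (i.succAbove j) + 1))),
      |f (Fin.insertNth (α := fun _ => ℝ) i (-halfWidth L H i + m.h * k i) y) - z| ≤ δ) :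
    |faceAverage m i k f - z| ≤ δ := by
  unfold faceAverage
  set Q : Set (Fin n → ℝ) := Set.univ.pi fun j : Fin n =>
        Icc (-halfWidth L H (i.succAbove j) + m.h * k (i.succAbove j))
          (-halfWidth L H (i.succAbove j) + m.h * (k (i.succAbove j) + 1)) with hQ
  have hQc : IsCompact Q := isCompact_univ_pi fun _ => isCompact_Icc
  have hh := m.h_pos
  have hvol : volume.real Q = m.h ^ n := by
    rw [measureReal_def, hQ, volume_pi_pi, ENNReal.toReal_prod]
    have : ∀ j : Fin n, (volume (Icc (-halfWidth L H (i.succAbove j) + m.h * k (i.succAbove j))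
          (-halfWidth L H (i.succAbove j) + m.h * (k (i.succAbove j) + 1)))).toReal = m.h := by
      intro j
      rw [Real.volume_Icc, show -halfWidth L H (i.succAbove j) + m.h * (k (i.succAbove j) + 1) -
        (-halfWidth L H (i.succAbove j) + m.h * k (i.succAbove j)) = m.h by ring,
        ENNReal.toReal_ofReal hh.le]
    rw [Finset.prod_congr rfl fun j _ => this j, Finset.prod_const, Finset.card_univ,
      Fintype.card_fin]
  have hn : 0 < m.h ^ n := pow_pos hh n
  have e : z = (m.h ^ n)⁻¹ * ∫ _y in Q, z := by
    rw [setIntegral_const, hvol, smul_eq_mul]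
    field_simp
  have hconst : IntegrableOn (fun _ => z) Q := integrableOn_const hQc.measure_lt_top.ne
  rw [e, ← mul_sub, ← integral_sub (hc.integrableOn_compact hQc) hconst, abs_mul,
    abs_of_pos (inv_pos.2 hn)]
  have := norm_setIntegral_le_of_norm_le_const (E := ℝ) (μ := volume)
    (f := fun y => f (Fin.insertNth (α := fun _ => ℝ) i (-halfWidth L H i + m.h * k i) y) - z)
    hQc.measure_lt_top hδ
  rw [hvol, Real.norm_eq_abs] at this
  calc _ ≤ (m.h ^ n)⁻¹ * (δ * m.h ^ n) := by gcongr
    _ = δ := by field_simp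

/-- The face averages of `ϑ_B(t', ·)` on a boundary face differ from `ϑ_B(t, ·)` on this face by
`O(h + |t - t'|)`. -/
theorem BdryTemp.abs_faceAverage_sub_le (θB : BdryTemp n T L H) (hT : 0 < T) (hL : 0 < L)
    (hH : 0 < H) (m : Mesh L H) {t t' : ℝ} {x : Pt n} {σ : Idx n}
    (hx : (t, x) ∈ closedCylinder n T L H) (ht' : t' ∈ Icc 0 T)
    (hlast : x (Fin.last n) = -halfWidth L H (Fin.last n) + m.h * σ (Fin.last n))
    (hσ : ∀ j : Fin n, 0 ≤ σ ((Fin.last n).succAbove j) ∧ σ ((Fin.last n).succAbove j) < m.N)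
    (hxσ : ∀ j : Fin n, x ((Fin.last n).succAbove j) ∈
      Icc (-halfWidth L H ((Fin.last n).succAbove j) + m.h * σ ((Fin.last n).succAbove j))
        (-halfWidth L H ((Fin.last n).succAbove j) +
          m.h * (σ ((Fin.last n).succAbove j) + 1))) :
    |faceAverage m (Fin.last n) σ (fun x => θB.val (t', x)) - θB.val (t, x)| ≤
      θB.w2Norm * (|t' - t| + n * m.h) := by
  have hh := m.h_pos
  have hmem : ∀ y ∈ (Set.univ.pi fun j : Fin n =>
        Icc (-halfWidth L H ((Fin.last n).succAbove j) + m.h * σ ((Fin.last n).succAbove j))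
          (-halfWidth L H ((Fin.last n).succAbove j) +
            m.h * (σ ((Fin.last n).succAbove j) + 1))),
      (t', (Fin.insertNth (α := fun _ => ℝ) (Fin.last n)
        (-halfWidth L H (Fin.last n) + m.h * σ (Fin.last n)) y : Pt n)) ∈
        closedCylinder n T L H := by
    intro y hy
    refine ⟨ht', fun l _ => ?_⟩
    induction l using Fin.succAboveCases (Fin.last n) with
    | x =>
      simp only [Fin.insertNth_apply_same]
      rw [← hlast]
      exact hx.2 _ (mem_univ _)
    | p j =>
      simp only [Fin.insertNth_apply_succAbove]
      have h1 := hy j (mem_univ j)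
      have h2 : halfWidth L H ((Fin.last n).succAbove j) = L :=
        if_neg (Fin.succAbove_ne _ _)
      obtain ⟨h3, h4⟩ := hσ j
      simp only [h2] at h1 ⊢
      have h3' : (0 : ℝ) ≤ σ ((Fin.last n).succAbove j) := by exact_mod_cast h3
      have h4' : (σ ((Fin.last n).succAbove j) : ℝ) + 1 ≤ m.N := by exact_mod_cast h4
      have h5 := m.horizontal
      constructor
      · have := mul_nonneg hh.le h3'
        linarith [h1.1]
      · have := mul_le_mul_of_nonneg_left h4' hh.le
        linarith [h1.2]
  refine FV.abs_faceAverage_sub_le m _ σ ?_ fun y hy => ?_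
  · exact θB.continuousOn_closedCylinder.comp (f := fun y => (t', (Fin.insertNth
      (α := fun _ => ℝ) (Fin.last n) (-halfWidth L H (Fin.last n) + m.h * σ (Fin.last n)) y :
        Pt n))) (by fun_prop) hmem
  · refine (θB.lipschitz hT hL hH hx (hmem y hy)).trans ?_
    gcongr
    · exact θB.w2Norm_nonneg
    rw [Fin.sum_univ_succAbove _ (Fin.last n), Fin.insertNth_apply_same, hlast, sub_self,
      abs_zero, zero_add]
    have : ∀ j : Fin n, |x ((Fin.last n).succAbove j) - (Fin.insertNth (α := fun _ => ℝ)
        (Fin.last n) (-halfWidth L H (Fin.last n) + m.h * σ (Fin.last n)) y : Pt n)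
          ((Fin.last n).succAbove j)| ≤ m.h := by
      intro j
      simp only [Fin.insertNth_apply_succAbove]
      have h1 := hy j (mem_univ j)
      have h2 := hxσ j
      rw [abs_le]
      constructor <;> linarith [h1.1, h1.2, h2.1, h2.2]
    refine (Finset.sum_le_sum fun j _ => this j).trans ?_
    simp

end Bdry

/-! ### Integration by parts on the cylinder -/

/-- The Cauchy-Schwarz inequality. -/
theorem abs_integral_mul_le_sqrt {X : Type*} [MeasurableSpace X] {μ : Measure X} {f g : X → ℝ}
    (hf : MemLp f 2 μ) (hg : MemLp g 2 μ) :
    |∫ x, f x * g x ∂μ| ≤ Real.sqrt (∫ x, f x ^ 2 ∂μ) * Real.sqrt (∫ x, g x ^ 2 ∂μ) := by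
  have h := integral_mul_norm_le_Lp_mul_Lq (μ := μ) (f := f) (g := g) Real.HolderConjugate.two_two
    (by simpa using hf) (by simpa using hg)
  have e : ∀ k : X → ℝ, ∫ x, ‖k x‖ ^ (2 : ℝ) ∂μ = ∫ x, k x ^ 2 ∂μ := fun k =>
    integral_congr_ae (ae_of_all _ fun x => by simp)
  rw [e, e, ← Real.sqrt_eq_rpow, ← Real.sqrt_eq_rpow] at h
  refine le_trans ?_ h
  refine (abs_integral_le_integral_abs).trans_eq ?_
  exact integral_congr_ae (ae_of_all _ fun x => by simp [abs_mul])

theorem integral_abs_le_sqrt {X : Type*} [MeasurableSpace X] {μ : Measure X} [IsFiniteMeasure μ]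
    {f : X → ℝ} (hf : MemLp f 2 μ) :
    ∫ x, |f x| ∂μ ≤ Real.sqrt (μ.real univ) * Real.sqrt (∫ x, f x ^ 2 ∂μ) := by
  have h := abs_integral_mul_le_sqrt (memLp_const (1 : ℝ)) hf.abs
  simp only [one_mul, one_pow, integral_const, smul_eq_mul, mul_one, Pi.abs_apply, sq_abs] at h
  exact (le_abs_self _).trans h

theorem abs_integral_line_parts_le {a b : ℝ} (hab : a < b) {u v V V' : ℝ → ℝ} {δ : ℝ} (hδ : 0 ≤ δ)
    (hu : Integrable u (volume.restrict (Ioo a b)))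
    (hv : Integrable v (volume.restrict (Ioo a b)))
    (hV' : Integrable V' (volume.restrict (Ioo a b)))
    (huv : ∃ c, ∀ᵐ s ∂(volume.restrict (Ioo a b)), u s = c + ∫ r in a..s, v r)
    (hV : ∀ s ∈ Icc a b, V s = V a + ∫ r in a..s, V' r)
    (hbd : (|V a| ≤ δ ∧ |V b| ≤ δ) ∨ (V a = V b ∧ ∫ r in Ioo a b, v r = 0)) :
    |∫ s in Ioo a b, (u s * V' s + v s * V s)| ≤
      2 * δ * ((b - a)⁻¹ * (∫ s in Ioo a b, |u s|) + ∫ s in Ioo a b, |v s|) := by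
  obtain ⟨c, hc⟩ := huv
  have hparts := integral_mul_primitive (intervalIntegrable_of_Ioo hab.le hv)
    (intervalIntegrable_of_Ioo hab.le hV') c (V a)
  have hb := hV b (right_mem_Icc.2 hab.le)
  have e : ∫ s in Ioo a b, (u s * V' s + v s * V s) =
      (c + ∫ r in a..b, v r) * V b - c * V a := by
    rw [hb, ← hparts, ← integral_Ioo_eq hab.le]
    refine integral_congr_ae ?_
    filter_upwards [hc, ae_restrict_mem measurableSet_Ioo] with s hs hsm
    rw [hs, hV s (Ioo_subset_Icc_self hsm)]
    ring
  obtain ⟨h1, h2⟩ := abs_endpoint_le hab hu hv hc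
  set K := (b - a)⁻¹ * (∫ s in Ioo a b, |u s|) + ∫ s in Ioo a b, |v s| with hK
  have hK0 : 0 ≤ K := (abs_nonneg _).trans h1
  rw [e]
  rcases hbd with ⟨ha', hb'⟩ | ⟨hVV, h0⟩
  · refine (abs_sub _ _).trans ?_
    rw [abs_mul, abs_mul]
    have := mul_le_mul h2 hb' (abs_nonneg _) hK0
    have := mul_le_mul h1 ha' (abs_nonneg _) hK0
    linarith
  · rw [integral_Ioo_eq hab.le] at h0
    rw [h0, add_zero, hVV, sub_self, abs_zero]
    positivity

variable {n : ℕ} {T L H : ℝ}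

/-- Integration by parts in the direction `i` against a function `V` that is absolutely continuous
on lines: no boundary term arises if `V` is periodic in a horizontal direction, and a boundary term
of size `δ` if `|V| ≤ δ` at `x_d = ±H`. -/
theorem HasProdWeakDeriv.abs_integral_parts_le (hL : 0 < L) (hH : 0 < H)
    {i : Fin (n + 1)} {F G V V' : ℝ × Pt n → ℝ} (h : HasProdWeakDeriv n T L H i F G)
    (hF : Integrable F (volume.restrict (cylinder n T L H)))
    (hG : Integrable G (volume.restrict (cylinder n T L H)))
    (hV' : Integrable V' (volume.restrict (cylinder n T L H)))
    (hi : Integrable (fun p => F p * V' p + G p * V p) (volume.restrict (cylinder n T L H)))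
    {δ : ℝ} (hδ : 0 ≤ δ)
    (hV : ∀ᵐ y ∂(volume.restrict (sideSet n T L H i)),
      ∀ s ∈ Icc (-halfWidth L H i) (halfWidth L H i), V (lineEquiv i (y, s)) =
        V (lineEquiv i (y, -halfWidth L H i)) +
          ∫ r in (-halfWidth L H i)..s, V' (lineEquiv i (y, r)))
    (hver : i = Fin.last n → ∀ᵐ y ∂(volume.restrict (sideSet n T L H i)),
      |V (lineEquiv i (y, -halfWidth L H i))| ≤ δ ∧ |V (lineEquiv i (y, halfWidth L H i))| ≤ δ)
    (hhor : i ≠ Fin.last n → ∀ᵐ y ∂(volume.restrict (sideSet n T L H i)),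
      V (lineEquiv i (y, -halfWidth L H i)) = V (lineEquiv i (y, halfWidth L H i))) :
    |∫ p in cylinder n T L H, (F p * V' p + G p * V p)| ≤
      2 * δ * ((2 * halfWidth L H i)⁻¹ * (∫ p in cylinder n T L H, |F p|) +
        ∫ p in cylinder n T L H, |G p|) := by
  have hw := halfWidth_pos hL hH i
  have hcase : ∀ᵐ y ∂(volume.restrict (sideSet n T L H i)),
      (|V (lineEquiv i (y, -halfWidth L H i))| ≤ δ ∧
        |V (lineEquiv i (y, halfWidth L H i))| ≤ δ) ∨
      (V (lineEquiv i (y, -halfWidth L H i)) = V (lineEquiv i (y, halfWidth L H i)) ∧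
        ∫ r in Ioo (-halfWidth L H i) (halfWidth L H i), G (lineEquiv i (y, r)) = 0) := by
    by_cases hl : i = Fin.last n
    · filter_upwards [hver hl] with y hy using Or.inl hy
    · filter_upwards [hhor hl, h.ae_integral_eq_zero hL hl hF hG] with y h1 h2
        using Or.inr ⟨h1, h2⟩
  have iF := integrable_comp_lineEquiv i hF
  have iG := integrable_comp_lineEquiv i hG
  have iV := integrable_comp_lineEquiv i hV'
  have iA := integrable_comp_lineEquiv i hi
  rw [← (measurePreserving_lineEquiv i).integral_comp',
    ← (measurePreserving_lineEquiv i).integral_comp' (g := fun p => |F p|),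
    ← (measurePreserving_lineEquiv i).integral_comp' (g := fun p => |G p|),
    integral_prod _ iA, integral_prod _ iF.abs, integral_prod _ iG.abs,
    ← integral_const_mul, ← integral_add (iF.abs.integral_prod_left.const_mul _)
      iG.abs.integral_prod_left, ← integral_const_mul]
  refine abs_integral_le_integral_abs.trans ?_
  refine integral_mono_ae iA.integral_prod_left.abs
    (((iF.abs.integral_prod_left.const_mul _).add iG.abs.integral_prod_left).const_mul _) ?_
  filter_upwards [h.ae_line hL hH hF hG, hV, hcase, iF.prod_right_ae, iG.prod_right_ae,
    iV.prod_right_ae] with y h1 h2 h3 h4 h5 h6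
  have := abs_integral_line_parts_le (V := fun s => V (lineEquiv i (y, s)))
    (by linarith : -halfWidth L H i < halfWidth L H i) hδ h4 h5 h6 h1 h2 h3
  rwa [show halfWidth L H i - -halfWidth L H i = 2 * halfWidth L H i by ring] at this

/-! ### Piecewise linear interpolation -/

/-- The piecewise linear function with the value `a k` at every integer `k`. -/
noncomputable def plin (a : ℤ → ℝ) (y : ℝ) : ℝ := a ⌊y⌋ + Int.fract y * (a (⌊y⌋ + 1) - a ⌊y⌋)

theorem plin_intCast (a : ℤ → ℝ) (k : ℤ) : plin a k = a k := by simp [plin]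

theorem plin_add_half (a : ℤ → ℝ) (k : ℤ) : plin a (k + 1 / 2) = (a k + a (k + 1)) / 2 := by
  have h : ⌊(k : ℝ) + 1 / 2⌋ = k := by
    rw [Int.floor_eq_iff]
    constructor <;> linarith
  rw [plin, h, Int.fract, h]
  ring

theorem plin_eqOn (a : ℤ → ℝ) (k : ℤ) :
    EqOn (plin a) (fun y => a k + (y - k) * (a (k + 1) - a k)) (Icc k (k + 1)) := by
  intro y hy
  rcases hy.2.eq_or_lt with h | h
  · have : y = ((k + 1 : ℤ) : ℝ) := by push_cast; exact h
    rw [this, plin_intCast]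
    push_cast
    ring
  · have hf : ⌊y⌋ = k := Int.floor_eq_iff.2 ⟨hy.1, h⟩
    simp only [plin, Int.fract, hf]

theorem continuous_plin (a : ℤ → ℝ) : Continuous (plin a) := by
  rw [continuous_iff_continuousAt]
  intro y
  have h : ∀ k : ℤ, ContinuousOn (plin a) (Icc (k : ℝ) (k + 1)) := fun k =>
    ContinuousOn.congr (by fun_prop) (plin_eqOn a k)
  -- the unit intervals starting at `⌈y⌉ - 1` and at `⌊y⌋` together form a neighbourhood of `y`
  have hU : ContinuousOn (plin a) (Icc ((⌈y⌉ - 1 : ℤ) : ℝ) ((⌈y⌉ - 1 : ℤ) + 1) ∪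
      Icc (⌊y⌋ : ℝ) (⌊y⌋ + 1)) :=
    (h _).union_of_isClosed (h _) isClosed_Icc isClosed_Icc
  refine hU.continuousAt ?_
  have h1 := Int.ceil_lt_add_one y
  have h2 := Int.le_ceil y
  have h3 := Int.floor_le y
  have h4 := Int.lt_floor_add_one y
  refine mem_of_superset (Ioo_mem_nhds (a := (⌈y⌉ : ℝ) - 1) (b := ⌊y⌋ + 1) (by linarith) h4) ?_
  intro z hz
  rcases le_or_gt z y with hzy | hzy
  · left
    push_cast
    exact ⟨hz.1.le, by linarith⟩
  · right
    exact ⟨by linarith, hz.2.le⟩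

theorem hasDerivWithinAt_plin (a : ℤ → ℝ) (y : ℝ) :
    HasDerivWithinAt (plin a) (a (⌊y⌋ + 1) - a ⌊y⌋) (Ioi y) y := by
  have h : HasDerivAt (fun z : ℝ => a ⌊y⌋ + (z - ⌊y⌋) * (a (⌊y⌋ + 1) - a ⌊y⌋))
      (a (⌊y⌋ + 1) - a ⌊y⌋) y := by
    simpa using (((hasDerivAt_id y).sub_const (⌊y⌋ : ℝ)).mul_const
      (a (⌊y⌋ + 1) - a ⌊y⌋)).const_add (a ⌊y⌋)
  have hmem : Icc (⌊y⌋ : ℝ) (⌊y⌋ + 1) ∈ 𝓝[>] y := by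
    refine mem_of_superset (Ioc_mem_nhdsGT (Int.lt_floor_add_one y)) ?_
    exact fun z hz => ⟨(Int.floor_le y).trans hz.1.le, hz.2⟩
  refine h.hasDerivWithinAt.congr_of_eventuallyEq
    ((plin_eqOn a ⌊y⌋).eventuallyEq_of_mem hmem) ?_
  exact plin_eqOn a ⌊y⌋ ⟨Int.floor_le y, (Int.lt_floor_add_one y).le⟩

theorem intervalIntegrable_step (d : ℤ → ℝ) {h : ℝ} (hh : 0 < h) (w θ p q : ℝ) :
    IntervalIntegrable (fun s => d ⌊(s + w) / h + θ⌋) volume p q := by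
  rw [intervalIntegrable_iff]
  have hm : Measurable fun s : ℝ => d ⌊(s + w) / h + θ⌋ :=
    (Measurable.of_discrete (f := d)).comp (Int.measurable_floor.comp (by fun_prop))
  refine Measure.integrableOn_of_bounded (M := ∑ k ∈ Finset.Icc ⌊(min p q + w) / h + θ⌋
    ⌊(max p q + w) / h + θ⌋, |d k|) measure_Ioc_lt_top.ne hm.aestronglyMeasurable ?_
  filter_upwards [ae_restrict_mem measurableSet_uIoc] with s hs
  refine Finset.single_le_sum (f := fun k => |d k|) (fun k _ => abs_nonneg _)
    (Finset.mem_Icc.2 ⟨Int.floor_le_floor ?_, Int.floor_le_floor ?_⟩)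
  · have : min p q ≤ s := hs.1.le
    gcongr
  · have : s ≤ max p q := hs.2
    gcongr

/-- A piecewise linear function is a primitive of its piecewise constant slope. -/
theorem plin_eq_integral (a : ℤ → ℝ) {h : ℝ} (hh : 0 < h) (w θ : ℝ) {p s : ℝ} (hps : p ≤ s) :
    plin a ((s + w) / h + θ) = plin a ((p + w) / h + θ) +
      ∫ r in p..s, (a (⌊(r + w) / h + θ⌋ + 1) - a ⌊(r + w) / h + θ⌋) / h := by
  have hc : Continuous fun r : ℝ => plin a ((r + w) / h + θ) :=
    (continuous_plin a).comp (by fun_prop)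
  have hd : ∀ r ∈ Ioo p s, HasDerivWithinAt (fun r : ℝ => plin a ((r + w) / h + θ))
      ((a (⌊(r + w) / h + θ⌋ + 1) - a ⌊(r + w) / h + θ⌋) / h) (Ioi r) r := by
    intro r _
    have h1 : HasDerivAt (fun r : ℝ => (r + w) / h + θ) (1 / h) r :=
      (((hasDerivAt_id r).add_const w).div_const h).add_const θ
    have h2 := (hasDerivWithinAt_plin a ((r + w) / h + θ)).comp r h1.hasDerivWithinAt
      (s := Ioi r) (fun z hz => by
        have : r < z := hz
        change (r + w) / h + θ < (z + w) / h + θ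
        gcongr)
    rw [div_eq_mul_one_div]
    exact h2
  have := intervalIntegral.integral_eq_sub_of_hasDeriv_right_of_le hps hc.continuousOn hd
    (intervalIntegrable_step (fun k => (a (k + 1) - a k) / h) hh w θ p s)
  rw [this]
  ring

/-! ### Grid functions on lines -/

section Grid

variable {n : ℕ} {T L H : ℝ} (m : Mesh L H) (τ : TimeGrid T)

/-- The number of cells in direction `i`. -/
def Mesh.size (m : Mesh L H) (i : Fin (n + 1)) : ℕ := if i = Fin.last n then m.M else m.N

theorem Mesh.size_mul (i : Fin (n + 1)) : m.size i * m.h = 2 * halfWidth L H i := by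
  unfold Mesh.size halfWidth
  split_ifs
  · exact m.vertical
  · exact m.horizontal

theorem insertNth_add_single (i : Fin (n + 1)) (κ c : ℤ) (k : Fin n → ℤ) :
    (Fin.insertNth (α := fun _ => ℤ) i κ k : Idx n) + Pi.single i c =
      Fin.insertNth (α := fun _ => ℤ) i (κ + c) k := by
  funext l
  induction l using Fin.succAboveCases i with
  | x => simp
  | p j => simp

theorem insertNth_sub_single (i : Fin (n + 1)) (κ c : ℤ) (k : Fin n → ℤ) :
    (Fin.insertNth (α := fun _ => ℤ) i κ k : Idx n) - Pi.single i c =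
      Fin.insertNth (α := fun _ => ℤ) i (κ - c) k := by
  rw [sub_eq_add_neg, ← Pi.single_neg, insertNth_add_single, sub_eq_add_neg]

/-- The transverse part of the index of the cells met by a line parallel to the `i`-th axis. -/
noncomputable def sideIndex (i : Fin (n + 1)) (y : Fin n → ℝ) : Fin n → ℤ := fun j =>
  ⌊(y j + halfWidth L H (i.succAbove j)) / m.h⌋

theorem cellIndex_insertNth (i : Fin (n + 1)) (s : ℝ) (y : Fin n → ℝ) :
    cellIndex m (Fin.insertNth (α := fun _ => ℝ) i s y : Pt n) =
      Fin.insertNth (α := fun _ => ℤ) i ⌊(s + halfWidth L H i) / m.h⌋ (sideIndex m i y) := by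
  funext l
  induction l using Fin.succAboveCases i with
  | x => simp [cellIndex]
  | p j => simp [cellIndex, sideIndex]

theorem dualIndex_insertNth (i : Fin (n + 1)) (s : ℝ) (y : Fin n → ℝ) :
    dualIndex m i (Fin.insertNth (α := fun _ => ℝ) i s y : Pt n) =
      Fin.insertNth (α := fun _ => ℤ) i ⌊(s + halfWidth L H i) / m.h + 1 / 2⌋
        (sideIndex m i y) := by
  funext l
  induction l using Fin.succAboveCases i with
  | x => simp [dualIndex]
  | p j => simp [dualIndex, sideIndex]

/-- The interpolant of the face averages of `v` that is linear in direction `i` on every cell; its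
derivative in this direction is the `i`-th component of `∇_h v`. -/
noncomputable def faceInterp (i : Fin (n + 1)) (v : ℕ → Idx n → ℝ) (p : ℝ × Pt n) : ℝ :=
  interp m τ (fun k => avg i (v k)) p +
    (m.h * Int.fract ((p.2 i + halfWidth L H i) / m.h)) * interp m τ (fun k => gradH m i (v k)) p

/-- The interpolant of the cell values of `v` that is linear in direction `i` on every dual cell; its
derivative in this direction is the `i`-th component of `∇_E v`. It takes the face averages as
values on all faces orthogonal to `eᵢ`. -/
noncomputable def cellInterp (i : Fin (n + 1)) (v : ℕ → Idx n → ℝ) (p : ℝ × Pt n) : ℝ :=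
  v ⌊p.1 / τ.dt⌋₊ (dualIndex m i p.2 - Pi.single i 1) +
    (m.h * Int.fract ((p.2 i + halfWidth L H i) / m.h + 1 / 2)) * gradE m τ i v p

theorem faceInterp_line (i : Fin (n + 1)) (v : ℕ → Idx n → ℝ) (y : ℝ × (Fin n → ℝ)) (s : ℝ) :
    faceInterp m τ i v (lineEquiv i (y, s)) =
      plin (fun κ => avg i (v ⌊y.1 / τ.dt⌋₊)
        (Fin.insertNth (α := fun _ => ℤ) i κ (sideIndex m i y.2)))
        ((s + halfWidth L H i) / m.h) := by
  have hh := m.h_pos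
  simp only [faceInterp, interp, lineEquiv_apply, cellIndex_insertNth, gradH,
    insertNth_add_single, Fin.insertNth_apply_same, plin]
  field_simp

theorem interp_gradH_line (i : Fin (n + 1)) (v : ℕ → Idx n → ℝ) (y : ℝ × (Fin n → ℝ)) (s : ℝ) :
    interp m τ (fun k => gradH m i (v k)) (lineEquiv i (y, s)) =
      (avg i (v ⌊y.1 / τ.dt⌋₊) (Fin.insertNth (α := fun _ => ℤ) i
          (⌊(s + halfWidth L H i) / m.h⌋ + 1) (sideIndex m i y.2)) -
        avg i (v ⌊y.1 / τ.dt⌋₊) (Fin.insertNth (α := fun _ => ℤ) i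
          ⌊(s + halfWidth L H i) / m.h⌋ (sideIndex m i y.2))) / m.h := by
  simp only [interp, lineEquiv_apply, cellIndex_insertNth, gradH, insertNth_add_single]

theorem cellInterp_line (i : Fin (n + 1)) (v : ℕ → Idx n → ℝ) (y : ℝ × (Fin n → ℝ)) (s : ℝ) :
    cellInterp m τ i v (lineEquiv i (y, s)) =
      plin (fun κ => v ⌊y.1 / τ.dt⌋₊
        (Fin.insertNth (α := fun _ => ℤ) i (κ - 1) (sideIndex m i y.2)))
        ((s + halfWidth L H i) / m.h + 1 / 2) := by
  have hh := m.h_pos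
  simp only [cellInterp, gradE, lineEquiv_apply, dualIndex_insertNth, jump,
    insertNth_sub_single, Fin.insertNth_apply_same, plin, add_sub_cancel_right]
  field_simp

theorem gradE_line (i : Fin (n + 1)) (v : ℕ → Idx n → ℝ) (y : ℝ × (Fin n → ℝ)) (s : ℝ) :
    gradE m τ i v (lineEquiv i (y, s)) =
      (v ⌊y.1 / τ.dt⌋₊ (Fin.insertNth (α := fun _ => ℤ) i
          (⌊(s + halfWidth L H i) / m.h + 1 / 2⌋ + 1 - 1) (sideIndex m i y.2)) -
        v ⌊y.1 / τ.dt⌋₊ (Fin.insertNth (α := fun _ => ℤ) i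
          (⌊(s + halfWidth L H i) / m.h + 1 / 2⌋ - 1) (sideIndex m i y.2))) / m.h := by
  simp only [gradE, lineEquiv_apply, dualIndex_insertNth, jump, insertNth_sub_single,
    add_sub_cancel_right]

theorem faceInterp_eq_integral (i : Fin (n + 1)) (v : ℕ → Idx n → ℝ) (y : ℝ × (Fin n → ℝ)) {s : ℝ}
    (hs : -halfWidth L H i ≤ s) :
    faceInterp m τ i v (lineEquiv i (y, s)) =
      faceInterp m τ i v (lineEquiv i (y, -halfWidth L H i)) +
        ∫ r in (-halfWidth L H i)..s,
          interp m τ (fun k => gradH m i (v k)) (lineEquiv i (y, r)) := by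
  simp only [faceInterp_line, interp_gradH_line]
  have := plin_eq_integral (fun κ => avg i (v ⌊y.1 / τ.dt⌋₊)
    (Fin.insertNth (α := fun _ => ℤ) i κ (sideIndex m i y.2))) m.h_pos (halfWidth L H i) 0 hs
  simpa only [add_zero] using this

theorem cellInterp_eq_integral (i : Fin (n + 1)) (v : ℕ → Idx n → ℝ) (y : ℝ × (Fin n → ℝ)) {s : ℝ}
    (hs : -halfWidth L H i ≤ s) :
    cellInterp m τ i v (lineEquiv i (y, s)) =
      cellInterp m τ i v (lineEquiv i (y, -halfWidth L H i)) +
        ∫ r in (-halfWidth L H i)..s, gradE m τ i v (lineEquiv i (y, r)) := by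
  simp only [cellInterp_line, gradE_line]
  exact plin_eq_integral (fun κ => v ⌊y.1 / τ.dt⌋₊
    (Fin.insertNth (α := fun _ => ℤ) i (κ - 1) (sideIndex m i y.2))) m.h_pos (halfWidth L H i)
    (1 / 2) hs

theorem two_halfWidth_div (i : Fin (n + 1)) :
    (halfWidth L H i + halfWidth L H i) / m.h = ((m.size i : ℤ) : ℝ) := by
  have hh := m.h_pos
  rw [div_eq_iff hh.ne', Int.cast_natCast, m.size_mul]
  ring

theorem faceInterp_left (i : Fin (n + 1)) (v : ℕ → Idx n → ℝ) (y : ℝ × (Fin n → ℝ)) :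
    faceInterp m τ i v (lineEquiv i (y, -halfWidth L H i)) = avg i (v ⌊y.1 / τ.dt⌋₊)
      (Fin.insertNth (α := fun _ => ℤ) i 0 (sideIndex m i y.2)) := by
  rw [faceInterp_line, neg_add_cancel, zero_div]
  exact_mod_cast plin_intCast _ 0

theorem faceInterp_right (i : Fin (n + 1)) (v : ℕ → Idx n → ℝ) (y : ℝ × (Fin n → ℝ)) :
    faceInterp m τ i v (lineEquiv i (y, halfWidth L H i)) = avg i (v ⌊y.1 / τ.dt⌋₊)
      (Fin.insertNth (α := fun _ => ℤ) i (m.size i) (sideIndex m i y.2)) := by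
  rw [faceInterp_line, two_halfWidth_div, plin_intCast]

theorem cellInterp_left (i : Fin (n + 1)) (v : ℕ → Idx n → ℝ) (y : ℝ × (Fin n → ℝ)) :
    cellInterp m τ i v (lineEquiv i (y, -halfWidth L H i)) = avg i (v ⌊y.1 / τ.dt⌋₊)
      (Fin.insertNth (α := fun _ => ℤ) i 0 (sideIndex m i y.2)) := by
  have := plin_add_half (fun κ => v ⌊y.1 / τ.dt⌋₊
    (Fin.insertNth (α := fun _ => ℤ) i (κ - 1) (sideIndex m i y.2))) 0
  rw [cellInterp_line, neg_add_cancel, zero_div]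
  rw [Int.cast_zero] at this
  rw [this, avg, insertNth_sub_single, add_comm, add_sub_cancel_right]

theorem cellInterp_right (i : Fin (n + 1)) (v : ℕ → Idx n → ℝ) (y : ℝ × (Fin n → ℝ)) :
    cellInterp m τ i v (lineEquiv i (y, halfWidth L H i)) = avg i (v ⌊y.1 / τ.dt⌋₊)
      (Fin.insertNth (α := fun _ => ℤ) i (m.size i) (sideIndex m i y.2)) := by
  rw [cellInterp_line, two_halfWidth_div, plin_add_half, avg, insertNth_sub_single, add_comm,
    add_sub_cancel_right]

theorem GridPeriodic.insertNth {v : Idx n → ℝ} (hv : GridPeriodic m v) {i : Fin (n + 1)}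
    (hi : i ≠ Fin.last n) (κ : ℤ) (k : Fin n → ℤ) :
    v (Fin.insertNth (α := fun _ => ℤ) i (κ + m.size i) k) =
      v (Fin.insertNth (α := fun _ => ℤ) i κ k) := by
  rw [← insertNth_add_single, Mesh.size, if_neg hi, hv i hi]

theorem GridPeriodic.avg_insertNth {v : Idx n → ℝ} (hv : GridPeriodic m v) {i : Fin (n + 1)}
    (hi : i ≠ Fin.last n) (k : Fin n → ℤ) :
    avg i v (Fin.insertNth (α := fun _ => ℤ) i (m.size i) k) =
      avg i v (Fin.insertNth (α := fun _ => ℤ) i 0 k) := by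
  simp only [avg, insertNth_sub_single]
  rw [show (m.size i : ℤ) - 1 = (0 - 1) + m.size i by ring, hv.insertNth m hi]
  have := hv.insertNth m hi 0 k
  rw [zero_add] at this
  rw [this]

/-- On a cell a function of `Q_h` differs from the interpolant of its face averages by at most half
of the jumps. -/
theorem sq_interp_sub_faceInterp_le (i : Fin (n + 1)) (v : ℕ → Idx n → ℝ) (p : ℝ × Pt n) :
    (interp m τ v p - faceInterp m τ i v p) ^ 2 ≤
      (interp m τ (fun k c => jump i (v k) c ^ 2 + jump i (v k) (c + Pi.single i 1) ^ 2) p) / 4 := by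
  have hh := m.h_pos
  simp only [faceInterp, interp, gradH, avg, jump, add_sub_cancel_right]
  set A := v ⌊p.1 / τ.dt⌋₊ (cellIndex m p.2)
  set B := v ⌊p.1 / τ.dt⌋₊ (cellIndex m p.2 - Pi.single i 1)
  set D := v ⌊p.1 / τ.dt⌋₊ (cellIndex m p.2 + Pi.single i 1)
  set r := Int.fract ((p.2 i + halfWidth L H i) / m.h)
  have hr0 : 0 ≤ r := Int.fract_nonneg _
  have hr1 : r ≤ 1 := (Int.fract_lt_one _).le
  have e : A - ((A + B) / 2 + m.h * r * (((D + A) / 2 - (A + B) / 2) / m.h)) =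
      (1 - r) * ((A - B) / 2) - r * ((D - A) / 2) := by
    field_simp
    ring
  rw [e]
  -- convexity of the square
  have h1 : ((1 - r) * ((A - B) / 2) - r * ((D - A) / 2)) ^ 2 ≤
      (1 - r) * ((A - B) / 2) ^ 2 + r * ((D - A) / 2) ^ 2 := by
    nlinarith [mul_nonneg (mul_nonneg hr0 (sub_nonneg.2 hr1))
      (sq_nonneg ((A - B) / 2 + (D - A) / 2))]
  have h2 : (1 - r) * ((A - B) / 2) ^ 2 ≤ ((A - B) / 2) ^ 2 :=
    mul_le_of_le_one_left (sq_nonneg _) (by linarith)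
  have h3 : r * ((D - A) / 2) ^ 2 ≤ ((D - A) / 2) ^ 2 :=
    mul_le_of_le_one_left (sq_nonneg _) hr1
  linarith

theorem abs_interp_sub_cellInterp_le (i : Fin (n + 1)) (v : ℕ → Idx n → ℝ) (p : ℝ × Pt n) :
    |interp m τ v p - cellInterp m τ i v p| ≤ m.h / 2 * |gradE m τ i v p| := by
  have hh := m.h_pos
  set z := (p.2 i + halfWidth L H i) / m.h with hz
  have h0 := Int.fract_nonneg z
  have h1 := Int.fract_lt_one z
  have hzf := Int.floor_add_fract z
  rcases lt_or_ge (Int.fract z) (1 / 2) with hlt | hge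
  · have hfl : ⌊z + 1 / 2⌋ = ⌊z⌋ := by
      rw [Int.floor_eq_iff]
      constructor <;> linarith
    have hidx : dualIndex m i p.2 = cellIndex m p.2 := by
      funext l
      by_cases hl : l = i
      · subst hl
        simp only [dualIndex, cellIndex, if_true]
        exact hfl
      · simp [dualIndex, cellIndex, hl]
    have e : interp m τ v p - cellInterp m τ i v p =
        m.h * (1 / 2 - Int.fract z) * gradE m τ i v p := by
      have hfr : Int.fract (z + 1 / 2) = Int.fract z + 1 / 2 := by
        simp only [Int.fract, hfl]
        ring
      simp only [cellInterp, ← hz, hfr, interp, gradE, hidx, jump]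
      field_simp
      ring
    rw [e, abs_mul]
    gcongr
    rw [abs_of_nonneg (by apply mul_nonneg <;> linarith)]
    nlinarith
  · have hfl : ⌊z + 1 / 2⌋ = ⌊z⌋ + 1 := by
      rw [Int.floor_eq_iff]
      push_cast
      constructor <;> linarith
    have hidx : dualIndex m i p.2 = cellIndex m p.2 + Pi.single i 1 := by
      funext l
      by_cases hl : l = i
      · subst hl
        simp only [dualIndex, cellIndex, if_true, Pi.add_apply, Pi.single_eq_same]
        exact hfl
      · simp [dualIndex, cellIndex, hl]
    have e : interp m τ v p - cellInterp m τ i v p =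
        -(m.h * (Int.fract z - 1 / 2)) * gradE m τ i v p := by
      have hfr : Int.fract (z + 1 / 2) = Int.fract z - 1 / 2 := by
        simp only [Int.fract, hfl]
        push_cast
        ring
      simp only [cellInterp, ← hz, hfr, interp, gradE, hidx, jump, add_sub_cancel_right]
      ring
    rw [e, abs_mul, abs_neg]
    gcongr
    rw [abs_of_nonneg (by apply mul_nonneg <;> linarith)]
    nlinarith

/-! ### Integrability of grid functions -/

theorem floor_time_lt {t : ℝ} (ht : t ∈ Ioo 0 T) : ⌊t / τ.dt⌋₊ < τ.steps := by
  have hd := τ.dt_pos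
  rw [Nat.floor_lt (div_nonneg ht.1.le hd.le), div_lt_iff₀ hd, τ.total]
  exact ht.2

theorem cellIndex_mem {x : Pt n} (hx : x ∈ box n L H) : cellIndex m x ∈ cells n m := by
  have hh := m.h_pos
  rw [cells, Fintype.mem_piFinset]
  intro i
  have h1 := hx i (mem_univ i)
  have h2 := m.size_mul i
  have h3 : (if i = Fin.last n then (m.M : ℤ) else (m.N : ℤ)) = (m.size i : ℤ) := by
    unfold Mesh.size
    split_ifs <;> rfl
  rw [h3, Finset.mem_Ico, cellIndex, Int.floor_lt, Int.floor_nonneg, div_lt_iff₀ hh]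
  refine ⟨div_nonneg (by linarith [h1.1]) hh.le, ?_⟩
  push_cast
  linarith [h1.2]

/-- A function of finitely many index values is bounded. -/
theorem memLp_of_index {J : ℝ × Pt n → ℕ × Idx n} (hJ : Measurable J) (S : Finset (ℕ × Idx n))
    (hS : ∀ p ∈ cylinder n T L H, J p ∈ S) (φ : ℕ × Idx n → ℝ) (q : ENNReal) :
    MemLp (fun p => φ (J p)) q (volume.restrict (cylinder n T L H)) := by
  refine MemLp.of_bound ((Measurable.of_discrete (f := φ)).comp hJ).aestronglyMeasurable
    (∑ k ∈ S, |φ k|) ?_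
  filter_upwards [ae_restrict_mem measurableSet_cylinder] with p hp
  exact Finset.single_le_sum (f := fun k => |φ k|) (fun k _ => abs_nonneg _) (hS p hp)

theorem measurable_cellIndex : Measurable (cellIndex (n := n) m) := by
  unfold cellIndex
  exact measurable_pi_iff.2 fun i => Int.measurable_floor.comp (by fun_prop)

theorem measurable_dualIndex (i : Fin (n + 1)) : Measurable (dualIndex (n := n) m i) := by
  unfold dualIndex
  exact measurable_pi_iff.2 fun j => Int.measurable_floor.comp (by fun_prop)

theorem measurable_timeIndex : Measurable fun p : ℝ × Pt n => ⌊p.1 / τ.dt⌋₊ :=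
  Nat.measurable_floor.comp (by fun_prop)

theorem memLp_interp (v : ℕ → Idx n → ℝ) (q : ENNReal) :
    MemLp (interp m τ v) q (volume.restrict (cylinder n T L H)) :=
  memLp_of_index (J := fun p => (⌊p.1 / τ.dt⌋₊, cellIndex m p.2))
    ((measurable_timeIndex τ).prodMk ((measurable_cellIndex m).comp measurable_snd))
    (Finset.range τ.steps ×ˢ cells n m)
    (fun _ hp => Finset.mem_product.2
      ⟨Finset.mem_range.2 (floor_time_lt τ hp.1), cellIndex_mem m hp.2⟩)
    (fun k => v k.1 k.2) q

theorem memLp_dual (i : Fin (n + 1)) (v : ℕ → Idx n → ℝ) (q : ENNReal) :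
    MemLp (fun p => v ⌊p.1 / τ.dt⌋₊ (dualIndex m i p.2)) q
      (volume.restrict (cylinder n T L H)) := by
  refine memLp_of_index (J := fun p => (⌊p.1 / τ.dt⌋₊, dualIndex m i p.2))
    ((measurable_timeIndex τ).prodMk ((measurable_dualIndex m i).comp measurable_snd))
    (Finset.range τ.steps ×ˢ Fintype.piFinset fun j => Finset.Icc (0 : ℤ) (m.size j))
    (fun p hp => Finset.mem_product.2 ⟨Finset.mem_range.2 (floor_time_lt τ hp.1), ?_⟩)
    (fun k => v k.1 k.2) q
  have hh := m.h_pos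
  rw [Fintype.mem_piFinset]
  intro j
  have h1 := hp.2 j (mem_univ j)
  have h2 := m.size_mul j
  have h3 : 0 ≤ (p.2 j + halfWidth L H j) / m.h := div_nonneg (by linarith [h1.1]) hh.le
  have h4 : (p.2 j + halfWidth L H j) / m.h < m.size j := by
    rw [div_lt_iff₀ hh]
    linarith [h1.2]
  have h5 : (0 : ℝ) ≤ (if j = i then 1 / 2 else 0) ∧
      (if j = i then 1 / 2 else 0 : ℝ) < 1 := by
    split_ifs <;> norm_num
  simp only [Finset.mem_Icc, dualIndex]
  rw [Int.floor_nonneg, ← Int.lt_add_one_iff, Int.floor_lt]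
  push_cast
  exact ⟨by linarith [h5.1], by linarith [h5.2]⟩

theorem memLp_gradE (i : Fin (n + 1)) (v : ℕ → Idx n → ℝ) (q : ENNReal) :
    MemLp (gradE m τ i v) q (volume.restrict (cylinder n T L H)) :=
  memLp_dual m τ i (fun k c => jump i (v k) c / m.h) q

theorem memLp_fract_mul {F : ℝ × Pt n → ℝ} {q : ENNReal}
    (hF : MemLp F q (volume.restrict (cylinder n T L H))) (i : Fin (n + 1)) (w θ : ℝ) :
    MemLp (fun p => (m.h * Int.fract ((p.2 i + w) / m.h + θ)) * F p) q
      (volume.restrict (cylinder n T L H)) := by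
  have hm : Measurable fun p : ℝ × Pt n => m.h * Int.fract ((p.2 i + w) / m.h + θ) :=
    (measurable_fract.comp (by fun_prop)).const_mul _
  refine hF.of_le (hm.aestronglyMeasurable.mul hF.1) (ae_of_all _ fun p => ?_)
  rw [norm_mul]
  refine mul_le_of_le_one_left (norm_nonneg _) ?_
  rw [Real.norm_eq_abs, abs_of_nonneg (mul_nonneg m.h_pos.le (Int.fract_nonneg _))]
  exact mul_le_one₀ m.h_lt_one.le (Int.fract_nonneg _) (Int.fract_lt_one _).le

theorem memLp_faceInterp (i : Fin (n + 1)) (v : ℕ → Idx n → ℝ) (q : ENNReal) :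
    MemLp (faceInterp m τ i v) q (volume.restrict (cylinder n T L H)) := by
  have := memLp_fract_mul m (memLp_interp m τ (fun k => gradH m i (v k)) q) i (halfWidth L H i) 0
  simp only [add_zero] at this
  exact (memLp_interp m τ _ q).add this

theorem memLp_cellInterp (i : Fin (n + 1)) (v : ℕ → Idx n → ℝ) (q : ENNReal) :
    MemLp (cellInterp m τ i v) q (volume.restrict (cylinder n T L H)) := by
  unfold cellInterp
  exact (memLp_dual m τ i (fun k c => v k (c - Pi.single i 1)) q).add
    (memLp_fract_mul m (memLp_gradE m τ i v q) i (halfWidth L H i) (1 / 2))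

end Grid

/-! ### The jumps of the velocity -/

section Jumps

variable {n : ℕ} {T L H : ℝ} (m : Mesh L H) (τ : TimeGrid T)

theorem volume_real_cellIndex_eq (k : Idx n) :
    volume.real {x : Pt n | cellIndex m x = k} = m.h ^ (n + 1) := by
  have hh := m.h_pos
  have : {x : Pt n | cellIndex m x = k} = Set.univ.pi fun i =>
      Ico (-halfWidth L H i + m.h * k i) (-halfWidth L H i + m.h * k i + m.h) := by
    ext x
    simp only [mem_ofPred_eq, mem_univ_pi, funext_iff, cellIndex, Int.floor_eq_iff, mem_Ico,
      le_div_iff₀ hh, div_lt_iff₀ hh]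
    refine forall_congr' fun i => ⟨?_, ?_⟩
    · rintro ⟨h1, h2⟩
      constructor <;> linarith
    · rintro ⟨h1, h2⟩
      constructor <;> linarith
  rw [this, measureReal_def, Real.volume_pi_Ico, ENNReal.toReal_prod]
  simp [hh.le]

theorem setIntegral_cellIndex_le (φ : Idx n → ℝ) (hφ : ∀ k, 0 ≤ φ k) :
    ∫ x in box n L H, φ (cellIndex m x) ≤ m.h ^ (n + 1) * ∑ k ∈ cells n m, φ k := by
  have hms : ∀ k : Idx n, MeasurableSet {x : Pt n | cellIndex m x = k} := fun k =>
    measurable_cellIndex m (measurableSet_singleton k)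
  have hfin : volume (box n L H) ≠ ⊤ := by
    rw [box, Real.volume_pi_Ioo]
    exact (ENNReal.prod_lt_top fun i _ => ENNReal.ofReal_lt_top).ne
  have hint : ∀ k : Idx n, IntegrableOn
      (indicator {x : Pt n | cellIndex m x = k} fun _ => φ k) (box n L H) := fun k =>
    (integrableOn_const hfin).indicator (hms k)
  have e : ∫ x in box n L H, φ (cellIndex m x) =
      ∫ x in box n L H, ∑ k ∈ cells n m,
        indicator {x : Pt n | cellIndex m x = k} (fun _ => φ k) x := by
    refine setIntegral_congr_fun measurableSet_box fun x hx => ?_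
    rw [Finset.sum_eq_single (cellIndex m x)]
    · rw [indicator_of_mem (by rfl)]
    · intro k _ hk
      exact indicator_of_notMem (fun h => hk h.symm) _
    · exact fun h => absurd (cellIndex_mem m hx) h
  rw [e, integral_finsetSum _ fun k _ => hint k, Finset.mul_sum]
  refine Finset.sum_le_sum fun k _ => ?_
  rw [setIntegral_indicator (hms k), setIntegral_const, smul_eq_mul]
  refine mul_le_mul_of_nonneg_right ?_ (hφ k)
  rw [← volume_real_cellIndex_eq m k]
  refine measureReal_mono inter_subset_right ?_
  intro htop
  have := volume_real_cellIndex_eq m k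
  rw [measureReal_def, htop] at this
  have := pow_pos m.h_pos (n + 1)
  simp_all

theorem mem_cells {k : Idx n} : k ∈ cells n m ↔ ∀ i, 0 ≤ k i ∧ k i < m.size i := by
  have h3 : ∀ i : Fin (n + 1),
      (if i = Fin.last n then (m.M : ℤ) else (m.N : ℤ)) = (m.size i : ℤ) := by
    intro i
    unfold Mesh.size
    split_ifs <;> rfl
  simp only [cells, Fintype.mem_piFinset, h3, Finset.mem_Ico]

/-- Summation over the upper faces of all cells equals summation over the lower faces, for quantities
that agree at both ends: periodic ones, or ones that vanish on exterior faces. -/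
theorem sum_cells_shift (i : Fin (n + 1)) (φ : Idx n → ℝ)
    (hφ : ∀ k : Idx n, k i = 0 → φ (k + Pi.single i (m.size i : ℤ)) = φ k) :
    ∑ k ∈ cells n m, φ (k + Pi.single i 1) = ∑ k ∈ cells n m, φ k := by
  refine Finset.sum_nbij'
    (fun k => if k i + 1 = m.size i then Function.update k i 0 else k + Pi.single i 1)
    (fun k => if k i = 0 then Function.update k i (m.size i - 1) else k - Pi.single i 1)
    ?_ ?_ ?_ ?_ ?_
  · intro k hk
    rw [mem_cells] at hk ⊢
    intro l
    have h1 := hk l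
    by_cases hl : l = i
    · subst hl
      split_ifs with h
      · simp; omega
      · simp; omega
    · split_ifs with h <;> simp [hl] <;> exact h1
  · intro k hk
    rw [mem_cells] at hk ⊢
    intro l
    have h1 := hk l
    by_cases hl : l = i
    · subst hl
      split_ifs with h
      · simp; omega
      · simp; omega
    · split_ifs with h <;> simp [hl] <;> exact h1
  · intro k hk
    rw [mem_cells] at hk
    have h1 := hk i
    funext l
    by_cases hl : l = i
    · subst hl
      by_cases h : k l + 1 = m.size l
      · simp [h]; omega
      · have : k l + 1 ≠ 0 := by omega
        simp [h, this]
    · by_cases h : k i + 1 = m.size i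
      · simp [h, hl]
      · have : k i + 1 ≠ 0 := by omega
        simp [h, this]
  · intro k hk
    rw [mem_cells] at hk
    have h1 := hk i
    funext l
    by_cases hl : l = i
    · subst hl
      by_cases h : k l = 0
      · simp [h]
      · have : k l ≠ m.size l := by omega
        simp [h, this]
    · by_cases h : k i = 0
      · simp [h, hl]
      · have : k i ≠ m.size i := by omega
        simp [h, this]
  · intro k hk
    split_ifs with h
    · rw [← hφ (Function.update k i 0) (by simp)]
      congr 1
      funext l
      by_cases hl : l = i
      · subst hl
        simpa using h
      · simp [hl]
    · rfl

/-- The square of the jump, set to zero on exterior faces. -/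
noncomputable def intJumpSq (i : Fin (n + 1)) (v : Idx n → ℝ) (k : Idx n) : ℝ :=
  if i = Fin.last n ∧ ¬(0 < k (Fin.last n) ∧ k (Fin.last n) < m.M) then 0 else jump i v k ^ 2

theorem intJumpSq_nonneg (i : Fin (n + 1)) (v : Idx n → ℝ) (k : Idx n) :
    0 ≤ intJumpSq m i v k := by
  unfold intJumpSq
  split_ifs
  · exact le_rfl
  · positivity

theorem intJumpSq_shift (i : Fin (n + 1)) {v : Idx n → ℝ} (hv : GridPeriodic m v) (k : Idx n)
    (hk : k i = 0) : intJumpSq m i v (k + Pi.single i (m.size i : ℤ)) = intJumpSq m i v k := by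
  by_cases hi : i = Fin.last n
  · subst hi
    rw [intJumpSq, intJumpSq, if_pos, if_pos]
    · simp [hk]
    · simp [hk, Mesh.size]
  · rw [intJumpSq, intJumpSq, if_neg (fun h => hi h.1), if_neg (fun h => hi h.1), jump, jump,
      Mesh.size, if_neg hi, hv i hi, add_sub_right_comm, hv i hi]

theorem sum_intJumpSq_le (i : Fin (n + 1)) (v : Idx n → ℝ) :
    ∑ k ∈ cells n m, intJumpSq m i v k ≤
      ∑ σ ∈ interiorFaces n m, jump σ.1 v σ.2 ^ 2 := by
  rw [interiorFaces, Finset.sum_filter, Finset.sum_product]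
  refine le_trans ?_ (Finset.single_le_sum
    (f := fun i : Fin (n + 1) => ∑ k ∈ cells n m,
      if i = Fin.last n → 0 < k (Fin.last n) then jump i v k ^ 2 else 0) (fun i _ => ?_)
    (Finset.mem_univ i))
  · refine Finset.sum_le_sum fun k _ => ?_
    unfold intJumpSq
    split_ifs with h1 h2 h2
    · positivity
    · exact le_rfl
    · exact le_rfl
    · exact absurd (fun hi => by
        by_contra h0
        exact h1 ⟨hi, fun h => h0 h.1⟩) h2
  · refine Finset.sum_nonneg fun k _ => ?_
    split_ifs
    · positivity
    · exact le_rfl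

/-- The jump on an exterior face is controlled by the jump on the opposite face of the adjacent cell
and by the discrete gradient on this cell, since the averages on exterior faces vanish. If the slab
is only one cell high, then `h = 2H` and it is controlled by the function itself. -/
theorem jump_sq_add_le (hH : 0 < H) (i : Fin (n + 1)) {v : Idx n → ℝ}
    (hbd : ∀ σ : Idx n, (σ (Fin.last n) = 0 ∨ σ (Fin.last n) = m.M) →
      avg (Fin.last n) v σ = 0) {k : Idx n} (hk : k ∈ cells n m) :
    jump i v k ^ 2 + jump i v (k + Pi.single i 1) ^ 2 ≤
      3 * (intJumpSq m i v k + intJumpSq m i v (k + Pi.single i 1)) +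
        16 * m.h ^ 2 * gradH m i v k ^ 2 + 2 / H ^ 2 * m.h ^ 2 * v k ^ 2 := by
  have hh := m.h_pos
  have hg : 0 ≤ 16 * m.h ^ 2 * gradH m i v k ^ 2 := by positivity
  have hv : 0 ≤ 2 / H ^ 2 * m.h ^ 2 * v k ^ 2 := by positivity
  by_cases hi : i = Fin.last n
  swap
  · have h1 : ∀ c, intJumpSq m i v c = jump i v c ^ 2 := fun c => if_neg fun h => hi h.1
    rw [h1, h1]
    nlinarith [sq_nonneg (jump i v k), sq_nonneg (jump i v (k + Pi.single i 1))]
  subst hi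
  have hkl := (mem_cells m).1 hk (Fin.last n)
  rw [Mesh.size, if_pos rfl] at hkl
  have hg2 : 16 * m.h ^ 2 * gradH m (Fin.last n) v k ^ 2 =
      16 * (avg (Fin.last n) v (k + Pi.single (Fin.last n) 1) - avg (Fin.last n) v k) ^ 2 := by
    rw [gradH]
    field_simp
  have hint : ∀ c : Idx n, 0 < c (Fin.last n) → c (Fin.last n) < m.M →
      intJumpSq m (Fin.last n) v c = jump (Fin.last n) v c ^ 2 :=
    fun c h1 h2 => if_neg fun h => h.2 ⟨h1, h2⟩
  have hn1 := intJumpSq_nonneg m (Fin.last n) v k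
  have hn2 := intJumpSq_nonneg m (Fin.last n) v (k + Pi.single (Fin.last n) 1)
  have hsucc : (k + Pi.single (Fin.last n) 1 : Idx n) (Fin.last n) = k (Fin.last n) + 1 := by simp
  rcases hkl.1.eq_or_lt with h0 | h0 <;>
    rcases (Int.add_one_le_iff.2 hkl.2).eq_or_lt with h1 | h1
  · -- one layer of cells only
    have hM : (m.M : ℝ) = 1 := by
      have : (m.M : ℤ) = 1 := by omega
      exact_mod_cast this
    have hhH : m.h = 2 * H := by
      have := m.vertical
      rw [hM] at this
      linarith
    have b1 := hbd k (Or.inl h0.symm)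
    have b2 := hbd (k + Pi.single (Fin.last n) 1) (Or.inr (by rw [hsucc, h1]))
    simp only [avg, jump, add_sub_cancel_right] at b1 b2 ⊢
    have e1 : v (k - Pi.single (Fin.last n) 1) = -v k := by linarith
    have e2 : v (k + Pi.single (Fin.last n) 1) = -v k := by linarith
    have e3 : 2 / H ^ 2 * m.h ^ 2 * v k ^ 2 = 8 * v k ^ 2 := by
      rw [hhH]
      field_simp
      ring
    rw [e3, e1, e2]
    nlinarith
  · have b1 := hbd k (Or.inl h0.symm)
    rw [hg2, b1, hint (k + Pi.single (Fin.last n) 1) (by rw [hsucc]; omega)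
      (by rw [hsucc]; omega)]
    simp only [avg, jump, add_sub_cancel_right] at b1 ⊢
    have e1 : v (k - Pi.single (Fin.last n) 1) = -v k := by linarith
    rw [e1]
    nlinarith [sq_nonneg (v (k + Pi.single (Fin.last n) 1) + v k + (v (k + Pi.single (Fin.last n) 1) - v k)),
      sq_nonneg (v (k + Pi.single (Fin.last n) 1) + v k)]
  · have b2 := hbd (k + Pi.single (Fin.last n) 1) (Or.inr (by rw [hsucc, h1]))
    rw [hg2, b2, hint k h0 hkl.2]
    simp only [avg, jump, add_sub_cancel_right] at b2 ⊢
    have e2 : v (k + Pi.single (Fin.last n) 1) = -v k := by linarith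
    rw [e2]
    nlinarith [sq_nonneg (v (k - Pi.single (Fin.last n) 1) + v k -
      (v k - v (k - Pi.single (Fin.last n) 1))), sq_nonneg (v k + v (k - Pi.single (Fin.last n) 1))]
  · rw [hint k h0 hkl.2, hint (k + Pi.single (Fin.last n) 1) (by rw [hsucc]; omega)
      (by rw [hsucc]; omega)]
    nlinarith [sq_nonneg (jump (Fin.last n) v k),
      sq_nonneg (jump (Fin.last n) v (k + Pi.single (Fin.last n) 1))]

theorem integrable_time_step (φ : ℕ → ℝ) :
    Integrable (fun t => φ ⌊t / τ.dt⌋₊) (volume.restrict (Ioo 0 T)) := by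
  refine Measure.integrableOn_of_bounded (M := ∑ k ∈ Finset.range τ.steps, |φ k|)
    measure_Ioo_lt_top.ne ((Measurable.of_discrete (f := φ)).comp
      (Nat.measurable_floor.comp (by fun_prop))).aestronglyMeasurable ?_
  filter_upwards [ae_restrict_mem measurableSet_Ioo] with t ht
  exact Finset.single_le_sum (f := fun k => |φ k|) (fun k _ => abs_nonneg _)
    (Finset.mem_range.2 (floor_time_lt τ ht))

theorem integral_interp_le (v : ℕ → Idx n → ℝ) (hv : ∀ k c, 0 ≤ v k c) :
    ∫ p in cylinder n T L H, interp m τ v p ≤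
      ∫ t in Ioo 0 T, m.h ^ (n + 1) * ∑ c ∈ cells n m, v ⌊t / τ.dt⌋₊ c := by
  have hi : Integrable (interp m τ v) (volume.restrict (cylinder n T L H)) :=
    memLp_one_iff_integrable.1 (memLp_interp m τ v 1)
  rw [setIntegral_cylinder hi]
  refine integral_mono_ae ?_ (integrable_time_step τ
    fun k => m.h ^ (n + 1) * ∑ c ∈ cells n m, v k c) (ae_of_all _ fun t => ?_)
  · have : Integrable (interp m τ v)
        ((volume.restrict (Ioo 0 T)).prod (volume.restrict (box n L H))) := by
      rw [Measure.prod_restrict]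
      exact hi
    exact this.integral_prod_left
  · exact setIntegral_cellIndex_le m (v ⌊t / τ.dt⌋₊) (hv _)

/-- The part of the jump estimate that concerns one component of the velocity. -/
theorem integral_sum_jump_sq_le {α C₀ : ℝ} {U : Trio n} (hJ : JumpBound m τ α C₀ U)
    (j : Fin (n + 1)) :
    ∫ t in Ioo 0 T, m.h ^ (n + 1) * ∑ σ ∈ interiorFaces n m,
      jump σ.1 (U.u ⌊t / τ.dt⌋₊ j) σ.2 ^ 2 ≤ m.h ^ (1 - α) * C₀ := by
  have hh := m.h_pos
  have hpow : 0 < m.h ^ (1 - α) := Real.rpow_pos_of_pos hh _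
  refine le_trans ?_ (mul_le_mul_of_nonneg_left hJ hpow.le)
  rw [← integral_const_mul]
  refine integral_mono (integrable_time_step τ fun k => m.h ^ (n + 1) *
    ∑ σ ∈ interiorFaces n m, jump σ.1 (U.u k j) σ.2 ^ 2) ((integrable_time_step τ fun k =>
    ∑ σ ∈ interiorFaces n m, m.h ^ n * ((m.h ^ α + |avg σ.1 (U.u k σ.1) σ.2|) *
      (jump σ.1 (U.rho k) σ.2 ^ 2 + ∑ j, jump σ.1 (U.u k j) σ.2 ^ 2 +
        jump σ.1 (U.theta k) σ.2 ^ 2))).const_mul _) fun t => ?_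
  beta_reduce
  rw [Finset.mul_sum, Finset.mul_sum]
  refine Finset.sum_le_sum fun σ _ => ?_
  have e : m.h ^ (n + 1) = m.h ^ (1 - α) * (m.h ^ n * m.h ^ α) := by
    rw [pow_succ, mul_left_comm, ← Real.rpow_add hh]
    simp
  rw [e, mul_assoc, mul_assoc]
  have hα := Real.rpow_pos_of_pos hh α
  have h1 : jump σ.1 (U.u ⌊t / τ.dt⌋₊ j) σ.2 ^ 2 ≤
      ∑ j, jump σ.1 (U.u ⌊t / τ.dt⌋₊ j) σ.2 ^ 2 :=
    Finset.single_le_sum (f := fun j => jump σ.1 (U.u ⌊t / τ.dt⌋₊ j) σ.2 ^ 2)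
      (fun j _ => sq_nonneg _) (Finset.mem_univ j)
  refine mul_le_mul_of_nonneg_left (mul_le_mul_of_nonneg_left ?_ (by positivity)) hpow.le
  refine mul_le_mul ?_ ?_ (sq_nonneg _) (by positivity)
  · linarith [abs_nonneg (avg σ.1 (U.u ⌊t / τ.dt⌋₊ σ.1) σ.2)]
  · linarith [sq_nonneg (jump σ.1 (U.rho ⌊t / τ.dt⌋₊) σ.2),
      sq_nonneg (jump σ.1 (U.theta ⌊t / τ.dt⌋₊) σ.2)]

/-- The distance in `L²` of the velocity to the interpolant of its face averages. -/
theorem integral_sq_interp_sub_faceInterp_le (hH : 0 < H) {α C₀ : ℝ} (hα : -1 < α)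
    {θB : BdryTemp n T L H} {b : Bounds} {U : Trio n} (hU : IsDiscreteTrio m τ θB U)
    (hb : UniformBounds m τ b U) (hG : GradientBound (L := L) (H := H) m τ C₀ U)
    (hJ : JumpBound m τ α C₀ U) (i j : Fin (n + 1)) :
    ∫ p in cylinder n T L H,
      (interp m τ (fun k => U.u k j) p - faceInterp m τ i (fun k => U.u k j) p) ^ 2 ≤
      (3 / 2 * C₀ + 4 * C₀ ^ 2 + volume.real (cylinder n T L H) * b.uHi ^ 2 / (2 * H ^ 2)) *
        m.h ^ (1 - α) := by
  have hh := m.h_pos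
  set v : ℕ → Idx n → ℝ := fun k => U.u k j with hv
  -- the three contributions to the bound on one cell
  set J : ℕ → Idx n → ℝ := fun k c =>
    intJumpSq m i (v k) c + intJumpSq m i (v k) (c + Pi.single i 1) with hJdef
  have iJ := memLp_one_iff_integrable.1 (memLp_interp (L := L) (H := H) m τ J 1)
  have ig := (memLp_interp (L := L) (H := H) m τ (fun k => gradH m i (v k)) 2).integrable_sq
  have hpt : ∀ p ∈ cylinder n T L H,
      (interp m τ v p - faceInterp m τ i v p) ^ 2 ≤
        3 / 4 * interp m τ J p + 4 * m.h ^ 2 * interp m τ (fun k => gradH m i (v k)) p ^ 2 +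
          m.h ^ 2 * b.uHi ^ 2 / (2 * H ^ 2) := by
    intro p hp
    have hk := floor_time_lt τ hp.1
    have hc := cellIndex_mem m hp.2
    have h1 := sq_interp_sub_faceInterp_le m τ i v p
    have h2 := jump_sq_add_le m hH i (v := v ⌊p.1 / τ.dt⌋₊)
      (fun σ hσ => hU.bdry_u _ hk.le σ hσ j) hc
    have h3 : v ⌊p.1 / τ.dt⌋₊ (cellIndex m p.2) ^ 2 ≤ b.uHi ^ 2 := by
      have h4 := hb.u _ hk.le _ hc
      have h5 : v ⌊p.1 / τ.dt⌋₊ (cellIndex m p.2) ^ 2 ≤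
          ∑ i, U.u ⌊p.1 / τ.dt⌋₊ i (cellIndex m p.2) ^ 2 :=
        Finset.single_le_sum (f := fun i => U.u ⌊p.1 / τ.dt⌋₊ i (cellIndex m p.2) ^ 2)
          (fun i _ => sq_nonneg _) (Finset.mem_univ j)
      exact h5.trans (Real.sqrt_le_left ((Real.sqrt_nonneg _).trans h4) |>.1 h4)
    have h4 : 2 / H ^ 2 * m.h ^ 2 * v ⌊p.1 / τ.dt⌋₊ (cellIndex m p.2) ^ 2 ≤
        2 / H ^ 2 * m.h ^ 2 * b.uHi ^ 2 := by gcongr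
    have e : m.h ^ 2 * b.uHi ^ 2 / (2 * H ^ 2) = 2 / H ^ 2 * m.h ^ 2 * b.uHi ^ 2 / 4 := by
      field_simp
      norm_num
    rw [e]
    simp only [interp, hJdef] at h1 ⊢
    linarith
  have hsq : Integrable (fun p => (interp m τ v p - faceInterp m τ i v p) ^ 2)
      (volume.restrict (cylinder n T L H)) :=
    ((memLp_interp m τ v 2).sub (memLp_faceInterp m τ i v 2)).integrable_sq
  have hA : ∫ p in cylinder n T L H, interp m τ J p ≤ 2 * (m.h ^ (1 - α) * C₀) := by
    refine (integral_interp_le m τ J fun k c =>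
      add_nonneg (intJumpSq_nonneg _ _ _ _) (intJumpSq_nonneg _ _ _ _)).trans ?_
    refine le_trans ?_ (mul_le_mul_of_nonneg_left (integral_sum_jump_sq_le m τ hJ j) zero_le_two)
    rw [← integral_const_mul]
    refine integral_mono_ae (integrable_time_step τ fun k => m.h ^ (n + 1) *
      ∑ c ∈ cells n m, J k c) ((integrable_time_step τ fun k => m.h ^ (n + 1) *
        ∑ σ ∈ interiorFaces n m, jump σ.1 (U.u k j) σ.2 ^ 2).const_mul _) ?_
    filter_upwards [ae_restrict_mem measurableSet_Ioo] with t ht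
    have hk := floor_time_lt τ ht
    simp only [hJdef]
    rw [Finset.sum_add_distrib, sum_cells_shift m i (intJumpSq m i (v ⌊t / τ.dt⌋₊))
      (intJumpSq_shift m i (hU.periodic_u _ hk.le j)), ← two_mul, mul_left_comm]
    have := sum_intJumpSq_le m i (v ⌊t / τ.dt⌋₊)
    gcongr
  have hB : ∫ p in cylinder n T L H, interp m τ (fun k => gradH m i (v k)) p ^ 2 ≤ C₀ ^ 2 := by
    have h1 : Real.sqrt (∫ p in cylinder n T L H,
        ∑ i, ∑ j, interp m τ (fun k => gradH m i (U.u k j)) p ^ 2) ≤ C₀ :=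
      le_trans (le_add_of_nonneg_left (Real.sqrt_nonneg _)) hG
    have h2 := (Real.sqrt_le_left ((Real.sqrt_nonneg _).trans h1)).1 h1
    refine le_trans (integral_mono ig ?_ fun p => ?_) h2
    · exact integrable_finsetSum _ fun i _ => integrable_finsetSum _ fun j _ =>
        (memLp_interp m τ (fun k => gradH m i (U.u k j)) 2).integrable_sq
    · refine le_trans ?_ (Finset.single_le_sum (f := fun i => ∑ j, interp m τ
        (fun k => gradH m i (U.u k j)) p ^ 2) (fun i _ => Finset.sum_nonneg fun j _ =>
          sq_nonneg _) (Finset.mem_univ i))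
      exact Finset.single_le_sum (f := fun j => interp m τ
        (fun k => gradH m i (U.u k j)) p ^ 2) (fun j _ => sq_nonneg _) (Finset.mem_univ j)
  have hmain : ∫ p in cylinder n T L H, (interp m τ v p - faceInterp m τ i v p) ^ 2 ≤
      3 / 4 * (∫ p in cylinder n T L H, interp m τ J p) +
        4 * m.h ^ 2 * (∫ p in cylinder n T L H, interp m τ (fun k => gradH m i (v k)) p ^ 2) +
          volume.real (cylinder n T L H) * (m.h ^ 2 * b.uHi ^ 2 / (2 * H ^ 2)) := by
    rw [← integral_const_mul, ← integral_const_mul, ← integral_add (iJ.const_mul _)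
      (ig.const_mul _)]
    have hc : ∫ _p in cylinder n T L H, m.h ^ 2 * b.uHi ^ 2 / (2 * H ^ 2) =
        volume.real (cylinder n T L H) * (m.h ^ 2 * b.uHi ^ 2 / (2 * H ^ 2)) := by
      rw [setIntegral_const, smul_eq_mul]
    have isum : Integrable (fun p => 3 / 4 * interp m τ J p +
        4 * m.h ^ 2 * interp m τ (fun k => gradH m i (v k)) p ^ 2)
        (volume.restrict (cylinder n T L H)) := (iJ.const_mul _).add (ig.const_mul _)
    rw [← hc, ← integral_add isum (integrable_const _)]
    exact setIntegral_mono_on hsq (isum.add (integrable_const _)) measurableSet_cylinder hpt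
  have hh2 : m.h ^ 2 ≤ m.h ^ (1 - α) := by
    rw [← Real.rpow_natCast]
    exact Real.rpow_le_rpow_of_exponent_ge hh m.h_lt_one.le (by push_cast; linarith)
  have hvol : 0 ≤ volume.real (cylinder n T L H) := measureReal_nonneg
  calc _ ≤ 3 / 4 * (2 * (m.h ^ (1 - α) * C₀)) + 4 * m.h ^ (1 - α) * C₀ ^ 2 +
        volume.real (cylinder n T L H) * (m.h ^ (1 - α) * b.uHi ^ 2 / (2 * H ^ 2)) := by
        refine hmain.trans ?_
        gcongr
    _ = _ := by ring

end Jumps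

/-! ### The velocity -/

section Errors

variable {n : ℕ} {T L H : ℝ} {m : Mesh L H} {τ : TimeGrid T}

theorem L2W12.integral_sq_grad_le (f : L2W12 n T L H) (i : Fin (n + 1)) :
    ∫ p in cylinder n T L H, f.grad i p ^ 2 ≤ f.normSq := by
  have h1 : 0 ≤ ∫ p in cylinder n T L H, f.val p ^ 2 := integral_nonneg fun _ => sq_nonneg _
  have h2 := Finset.single_le_sum (f := fun i => ∫ p in cylinder n T L H, f.grad i p ^ 2)
    (fun i _ => integral_nonneg fun _ => sq_nonneg _) (Finset.mem_univ i)
  unfold L2W12.normSq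
  linarith

theorem L2W12.integral_sq_val_le (f : L2W12 n T L H) :
    ∫ p in cylinder n T L H, f.val p ^ 2 ≤ f.normSq :=
  le_add_of_nonneg_right (Finset.sum_nonneg fun _ _ => integral_nonneg fun _ => sq_nonneg _)

theorem L2W12.normSq_nonneg (f : L2W12 n T L H) : 0 ≤ f.normSq :=
  (integral_nonneg fun _ => sq_nonneg _).trans f.integral_sq_val_le

theorem sqrt_normSq_le_vecNorm (Ψ : Fin (n + 1) → L2W12 n T L H) (i : Fin (n + 1)) :
    Real.sqrt (Ψ i).normSq ≤ vecNorm Ψ :=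
  Real.sqrt_le_sqrt (Finset.single_le_sum (f := fun i => (Ψ i).normSq)
    (fun i _ => (Ψ i).normSq_nonneg) (Finset.mem_univ i))

theorem sqrt_normSq_le_tensorNorm (S : Fin (n + 1) → Fin (n + 1) → L2W12 n T L H)
    (i j : Fin (n + 1)) : Real.sqrt (S i j).normSq ≤ tensorNorm S := by
  refine Real.sqrt_le_sqrt ?_
  refine le_trans ?_ (Finset.single_le_sum (f := fun i => ∑ j, (S i j).normSq)
    (fun i _ => Finset.sum_nonneg fun j _ => (S i j).normSq_nonneg) (Finset.mem_univ i))
  exact Finset.single_le_sum (f := fun j => (S i j).normSq)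
    (fun j _ => (S i j).normSq_nonneg) (Finset.mem_univ j)

/-- The interpolant of the face averages of the velocity is an admissible test function: it vanishes
at `x_d = ±H` and is periodic in the horizontal directions. -/
theorem integral_faceInterp_eq_zero (hL : 0 < L) (hH : 0 < H) {θB : BdryTemp n T L H} {U : Trio n}
    (hU : IsDiscreteTrio m τ θB U) (i j : Fin (n + 1)) (f : L2W12 n T L H) :
    ∫ p in cylinder n T L H, (f.val p * interp m τ (fun k => gradH m j (U.u k i)) p +
      f.grad j p * faceInterp m τ j (fun k => U.u k i) p) = 0 := by
  have iV' := memLp_interp (L := L) (H := H) m τ (fun k => gradH m j (U.u k i)) 2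
  have iV := memLp_faceInterp (L := L) (H := H) m τ j (fun k => U.u k i) 2
  have h := (f.hasProdWeakDeriv hL j).abs_integral_parts_le hL hH f.integrable_val
    (f.integrable_grad j) (iV'.integrable (by norm_num))
    ((f.memLp_val.integrable_mul iV').add ((f.memLp_grad j).integrable_mul iV))
    (le_refl (0 : ℝ)) (ae_of_all _ fun y s hs => faceInterp_eq_integral m τ j _ y hs.1) ?_ ?_
  · rw [mul_zero, zero_mul] at h
    exact abs_eq_zero.1 (le_antisymm h (abs_nonneg _))
  · rintro rfl
    filter_upwards [ae_restrict_mem (isOpen_sideSet _).measurableSet] with y hy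
    have hk := (floor_time_lt τ hy.1).le
    rw [faceInterp_left, faceInterp_right, hU.bdry_u _ hk _ (by simp),
      hU.bdry_u _ hk _ (by simp [Mesh.size])]
    simp
  · intro hj
    filter_upwards [ae_restrict_mem (isOpen_sideSet _).measurableSet] with y hy
    have hk := (floor_time_lt τ hy.1).le
    rw [faceInterp_left, faceInterp_right, (hU.periodic_u _ hk i).avg_insertNth m hj]

theorem abs_velocity_component_le (hL : 0 < L) (hH : 0 < H) {α C₀ : ℝ}
    (hα : -1 < α) {θB : BdryTemp n T L H} {b : Bounds} {U : Trio n}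
    (hU : IsDiscreteTrio m τ θB U) (hb : UniformBounds m τ b U)
    (hG : GradientBound (L := L) (H := H) m τ C₀ U) (hJ : JumpBound m τ α C₀ U)
    (i j : Fin (n + 1)) (f : L2W12 n T L H) :
    |∫ p in cylinder n T L H, (interp m τ (fun k => U.u k i) p * f.grad j p +
      interp m τ (fun k => gradH m j (U.u k i)) p * f.val p)| ≤
      Real.sqrt (3 / 2 * C₀ + 4 * C₀ ^ 2 +
        volume.real (cylinder n T L H) * b.uHi ^ 2 / (2 * H ^ 2)) *
        m.h ^ ((1 - α) / 2) * Real.sqrt f.normSq := by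
  have hh := m.h_pos
  have iv := memLp_interp (L := L) (H := H) m τ (fun k => U.u k i) 2
  have iV' := memLp_interp (L := L) (H := H) m τ (fun k => gradH m j (U.u k i)) 2
  have iV := memLp_faceInterp (L := L) (H := H) m τ j (fun k => U.u k i) 2
  have i1 : Integrable (fun p => (interp m τ (fun k => U.u k i) p -
      faceInterp m τ j (fun k => U.u k i) p) * f.grad j p)
      (volume.restrict (cylinder n T L H)) := (iv.sub iV).integrable_mul (f.memLp_grad j)
  have i2 : Integrable (fun p => f.val p * interp m τ (fun k => gradH m j (U.u k i)) p +
      f.grad j p * faceInterp m τ j (fun k => U.u k i) p)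
      (volume.restrict (cylinder n T L H)) :=
    (f.memLp_val.integrable_mul iV').add ((f.memLp_grad j).integrable_mul iV)
  have e : ∫ p in cylinder n T L H, (interp m τ (fun k => U.u k i) p * f.grad j p +
      interp m τ (fun k => gradH m j (U.u k i)) p * f.val p) =
      ∫ p in cylinder n T L H, (interp m τ (fun k => U.u k i) p -
      faceInterp m τ j (fun k => U.u k i) p) * f.grad j p := by
    rw [← add_zero (∫ p in cylinder n T L H, (interp m τ (fun k => U.u k i) p -
      faceInterp m τ j (fun k => U.u k i) p) * f.grad j p),
      ← integral_faceInterp_eq_zero hL hH hU i j f, ← integral_add i1 i2]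
    exact integral_congr_ae (ae_of_all _ fun p => by ring)
  rw [e]
  refine (abs_integral_mul_le_sqrt (iv.sub iV) (f.memLp_grad j)).trans ?_
  refine mul_le_mul ?_ (Real.sqrt_le_sqrt (f.integral_sq_grad_le j)) (Real.sqrt_nonneg _)
    (mul_nonneg (Real.sqrt_nonneg _) (Real.rpow_pos_of_pos hh _).le)
  have := Real.sqrt_le_sqrt
    (integral_sq_interp_sub_faceInterp_le m τ hH hα hU hb hG hJ j i)
  refine this.trans_eq ?_
  rw [Real.sqrt_mul' _ (Real.rpow_pos_of_pos hh _).le, Real.sqrt_eq_rpow (m.h ^ (1 - α)),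
    ← Real.rpow_mul hh.le]
  congr 2
  ring

/-- The symmetric gradient may be replaced by the full gradient, since `S` is symmetric. -/
theorem velocityError_eq_sum (U : Trio n) {S : Fin (n + 1) → Fin (n + 1) → L2W12 n T L H}
    (hS : ∀ i j, (S i j).val =ᵐ[volume.restrict (cylinder n T L H)] (S j i).val) :
    velocityError m τ U S = ∑ i, ∑ j, ∫ p in cylinder n T L H,
      (interp m τ (fun k => U.u k i) p * (S i j).grad j p +
        interp m τ (fun k => gradH m j (U.u k i)) p * (S i j).val p) := by
  have hint : ∀ i j : Fin (n + 1), Integrable (fun p =>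
      interp m τ (fun k => U.u k i) p * (S i j).grad j p +
        interp m τ (fun k => gradH m j (U.u k i)) p * (S i j).val p)
      (volume.restrict (cylinder n T L H)) := fun i j =>
    ((memLp_interp m τ _ 2).integrable_mul ((S i j).memLp_grad j)).add
      ((memLp_interp m τ _ 2).integrable_mul (S i j).memLp_val)
  simp_rw [← integral_finsetSum _ fun j _ => hint _ j]
  rw [← integral_finsetSum _ fun i _ => integrable_finsetSum _ fun j _ => hint i j]
  refine integral_congr_ae ?_
  have hS' : ∀ᵐ p ∂(volume.restrict (cylinder n T L H)), ∀ i j, (S i j).val p = (S j i).val p := by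
    rw [ae_all_iff]
    intro i
    rw [ae_all_iff]
    exact hS i
  filter_upwards [hS'] with p hp
  have e : ∀ i j, interp m τ (fun k => symGradH m (U.u k) i j) p =
      (interp m τ (fun k => gradH m i (U.u k j)) p +
        interp m τ (fun k => gradH m j (U.u k i)) p) / 2 := fun i j => rfl
  have h1 : ∑ i, ∑ j, interp m τ (fun k => gradH m i (U.u k j)) p * (S i j).val p =
      ∑ i, ∑ j, interp m τ (fun k => gradH m j (U.u k i)) p * (S i j).val p := by
    rw [Finset.sum_comm]
    refine Finset.sum_congr rfl fun i _ => Finset.sum_congr rfl fun j _ => ?_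
    rw [hp]
  have h2 : ∀ i j, interp m τ (fun k => symGradH m (U.u k) i j) p * (S i j).val p =
      (1 / 2) * (interp m τ (fun k => gradH m i (U.u k j)) p * (S i j).val p) +
        (1 / 2) * (interp m τ (fun k => gradH m j (U.u k i)) p * (S i j).val p) := by
    intro i j
    rw [e]
    ring
  simp only [h2, Finset.sum_add_distrib, ← Finset.mul_sum, h1]
  ring

/-! ### The temperature -/

theorem abs_floor_mul_sub_le {t : ℝ} (ht : t ∈ Ioo 0 T) :
    |(⌊t / τ.dt⌋₊ : ℝ) * τ.dt - t| ≤ τ.dt := by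
  have hd := τ.dt_pos
  have h1 := Nat.floor_le (div_nonneg ht.1.le hd.le)
  have h2 := Nat.lt_floor_add_one (t / τ.dt)
  rw [le_div_iff₀ hd] at h1
  rw [div_lt_iff₀ hd] at h2
  rw [abs_le]
  constructor <;> linarith

/-- The boundary values of the piecewise linear temperature are close to those of `ϑ_B`. -/
theorem abs_bdry_theta_sub_le (hT : 0 < T) (hL : 0 < L) (hH : 0 < H) {θB : BdryTemp n T L H}
    {U : Trio n} (hU : IsDiscreteTrio m τ θB U) {y : ℝ × (Fin n → ℝ)}
    (hy : y ∈ sideSet n T L H (Fin.last n)) {z : ℝ} {κ : ℤ} (hκ : κ = 0 ∨ κ = m.M)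
    (hz : z = -halfWidth L H (Fin.last n) + m.h * κ) :
    |avg (Fin.last n) (U.theta ⌊y.1 / τ.dt⌋₊)
        (Fin.insertNth (α := fun _ => ℤ) (Fin.last n) κ (sideIndex m (Fin.last n) y.2)) -
      θB.val (lineEquiv (Fin.last n) (y, z))| ≤ θB.w2Norm * (τ.dt + n * m.h) := by
  have hh := m.h_pos
  have hk := floor_time_lt τ hy.1
  rw [hU.bdry_theta _ hk.le _ (by simpa using hκ), lineEquiv_apply]
  have hz' : z ∈ Icc (-halfWidth L H (Fin.last n)) (halfWidth L H (Fin.last n)) := by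
    have h1 := m.vertical
    have h2 : halfWidth L H (Fin.last n) = H := if_pos rfl
    rw [hz, h2]
    rcases hκ with rfl | rfl
    · simp [hH.le]
    · push_cast
      constructor <;> nlinarith
  have ht' : (⌊y.1 / τ.dt⌋₊ : ℝ) * τ.dt ∈ Icc 0 T := by
    have hd := τ.dt_pos
    refine ⟨by positivity, ?_⟩
    have : (⌊y.1 / τ.dt⌋₊ : ℝ) ≤ τ.steps := by exact_mod_cast hk.le
    calc _ ≤ τ.steps * τ.dt := by gcongr
      _ = T := τ.total
  have hmem := lineEquiv_mem_closed (T := T) (z := (y, z))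
    ⟨Ioo_subset_Icc_self hy.1, fun j hj => Ioo_subset_Icc_self (hy.2 j hj)⟩ hz'
  rw [lineEquiv_apply] at hmem
  refine (θB.abs_faceAverage_sub_le hT hL hH m hmem ht' ?_ ?_ ?_).trans ?_
  · simpa using hz
  · intro j
    simp only [Fin.insertNth_apply_succAbove, sideIndex]
    have h1 := hy.2 j (mem_univ j)
    have h2 := m.size_mul ((Fin.last n).succAbove j)
    have h3 : m.size ((Fin.last n).succAbove j) = m.N := if_neg (Fin.succAbove_ne _ _)
    rw [h3] at h2
    rw [Int.floor_nonneg, Int.floor_lt, div_lt_iff₀ hh]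
    push_cast
    exact ⟨div_nonneg (by linarith [h1.1]) hh.le, by linarith [h1.2]⟩
  · intro j
    simp only [Fin.insertNth_apply_succAbove, sideIndex]
    have h1 := Int.floor_le ((y.2 j + halfWidth L H ((Fin.last n).succAbove j)) / m.h)
    have h2 := (Int.lt_floor_add_one
      ((y.2 j + halfWidth L H ((Fin.last n).succAbove j)) / m.h)).le
    rw [le_div_iff₀ hh] at h1
    rw [div_le_iff₀ hh] at h2
    constructor <;> linarith
  · have := abs_floor_mul_sub_le (τ := τ) hy.1
    have := θB.w2Norm_nonneg
    gcongr

theorem BdryTemp.memLp_val (θB : BdryTemp n T L H) :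
    MemLp θB.val 2 (volume.restrict (cylinder n T L H)) := by
  obtain ⟨C, hC⟩ := isCompact_closedCylinder.exists_bound_of_continuousOn
    θB.continuousOn_closedCylinder
  refine MemLp.of_bound θB.integrable_val.1 C ?_
  filter_upwards [ae_restrict_mem measurableSet_cylinder] with p hp
    using hC p (cylinder_subset_closedCylinder hp)

theorem abs_integral_cellInterp_sub_le (hT : 0 < T) (hL : 0 < L) (hH : 0 < H)
    {θB : BdryTemp n T L H} {U : Trio n} (hU : IsDiscreteTrio m τ θB U) (i : Fin (n + 1))
    (f : L2W12 n T L H) :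
    |∫ p in cylinder n T L H, (f.val p * (gradE m τ i U.theta p - θB.d1 (some i) p) +
      f.grad i p * (cellInterp m τ i U.theta p - θB.val p))| ≤
      2 * (θB.w2Norm * (τ.dt + n * m.h)) *
        ((2 * halfWidth L H i)⁻¹ * (∫ p in cylinder n T L H, |f.val p|) +
          ∫ p in cylinder n T L H, |f.grad i p|) := by
  have hd1 : MemLp (θB.d1 (some i)) 2 (volume.restrict (cylinder n T L H)) :=
    (θB.memLp_d1 (some i)).mono_exponent le_top
  have iV' := (memLp_gradE (L := L) (H := H) m τ i U.theta 2).sub hd1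
  have iV := (memLp_cellInterp (L := L) (H := H) m τ i U.theta 2).sub θB.memLp_val
  have hδ : 0 ≤ θB.w2Norm * (τ.dt + n * m.h) :=
    mul_nonneg θB.w2Norm_nonneg (add_nonneg τ.dt_pos.le
      (mul_nonneg (Nat.cast_nonneg n) m.h_pos.le))
  refine (f.hasProdWeakDeriv hL i).abs_integral_parts_le
    (V := fun p => cellInterp m τ i U.theta p - θB.val p)
    (V' := fun p => gradE m τ i U.theta p - θB.d1 (some i) p) hL hH f.integrable_val
    (f.integrable_grad i) (iV'.integrable (by norm_num))
    ((f.memLp_val.integrable_mul iV').add ((f.memLp_grad i).integrable_mul iV)) hδ ?_ ?_ ?_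
  · have hw := halfWidth_pos hL hH i
    have ig : Integrable (gradE m τ i U.theta) (volume.restrict (cylinder n T L H)) :=
      memLp_one_iff_integrable.1 (memLp_gradE m τ i U.theta 1)
    filter_upwards [θB.ae_line hT hL hH i,
      (integrable_comp_lineEquiv i (θB.integrable_d1 (some i))).prod_right_ae,
      (integrable_comp_lineEquiv i ig).prod_right_ae] with y h1 h2 h3 s hs
    have hsub : uIcc (-halfWidth L H i) s ⊆ uIcc (-halfWidth L H i) (halfWidth L H i) := by
      rw [uIcc_of_le hs.1, uIcc_of_le (by linarith)]
      exact Icc_subset_Icc_right hs.2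
    rw [intervalIntegral.integral_sub
      ((intervalIntegrable_of_Ioo (by linarith) h3).mono_set hsub)
      ((intervalIntegrable_of_Ioo (by linarith) h2).mono_set hsub), h1 s hs,
      cellInterp_eq_integral m τ i _ y hs.1]
    ring
  · rintro rfl
    filter_upwards [ae_restrict_mem (isOpen_sideSet _).measurableSet] with y hy
    rw [cellInterp_left, cellInterp_right]
    refine ⟨abs_bdry_theta_sub_le hT hL hH hU hy (Or.inl rfl) (by simp),
      abs_bdry_theta_sub_le hT hL hH hU hy (Or.inr (by simp [Mesh.size])) ?_⟩
    have := m.size_mul (Fin.last n)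
    push_cast
    linarith
  · intro hi
    filter_upwards [ae_restrict_mem (isOpen_sideSet _).measurableSet] with y hy
    have hk := (floor_time_lt τ hy.1).le
    rw [cellInterp_left, cellInterp_right, (hU.periodic_theta _ hk).avg_insertNth m hi]
    congr 1
    rw [lineEquiv_apply, lineEquiv_apply]
    have hw : halfWidth L H i = L := if_neg hi
    have := θB.periodic y.1 i hi (Fin.insertNth (α := fun _ => ℝ) i (-L) y.2)
    dsimp only at this ⊢
    rw [hw, ← this]
    congr 2
    funext l
    induction l using Fin.succAboveCases i with
    | x => simp; ring
    | p j => simp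

theorem integral_sq_interp_sub_cellInterp_le {C₀ : ℝ} {U : Trio n}
    (hG : GradientBound (L := L) (H := H) m τ C₀ U) (i : Fin (n + 1)) :
    Real.sqrt (∫ p in cylinder n T L H,
      (interp m τ U.theta p - cellInterp m τ i U.theta p) ^ 2) ≤ m.h / 2 * C₀ := by
  have hh := m.h_pos
  have h1 : Real.sqrt (∫ p in cylinder n T L H, ∑ i, gradE m τ i U.theta p ^ 2) ≤ C₀ :=
    le_trans (le_add_of_nonneg_right (Real.sqrt_nonneg _)) hG
  refine le_trans ?_ (mul_le_mul_of_nonneg_left h1 (by positivity))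
  rw [← Real.sqrt_sq (by positivity : 0 ≤ m.h / 2), ← Real.sqrt_mul (sq_nonneg _),
    ← integral_const_mul]
  refine Real.sqrt_le_sqrt (integral_mono
    ((memLp_interp m τ U.theta 2).sub (memLp_cellInterp m τ i U.theta 2)).integrable_sq
    ((integrable_finsetSum _ fun i _ => (memLp_gradE m τ i U.theta 2).integrable_sq).const_mul _)
    fun p => ?_)
  have h2 := abs_interp_sub_cellInterp_le m τ i U.theta p
  have h3 := pow_le_pow_left₀ (abs_nonneg _) h2 2
  rw [mul_pow, sq_abs, sq_abs] at h3
  refine h3.trans (mul_le_mul_of_nonneg_left ?_ (sq_nonneg _))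
  exact Finset.single_le_sum (f := fun i => gradE m τ i U.theta p ^ 2)
    (fun i _ => sq_nonneg _) (Finset.mem_univ i)

theorem abs_temperature_component_le (hT : 0 < T) (hL : 0 < L) (hH : 0 < H) {C₀ : ℝ}
    {θB : BdryTemp n T L H} {U : Trio n} (hU : IsDiscreteTrio m τ θB U)
    (hG : GradientBound (L := L) (H := H) m τ C₀ U) (i : Fin (n + 1)) (f : L2W12 n T L H) :
    |∫ p in cylinder n T L H, ((interp m τ U.theta p - θB.val p) * f.grad i p +
      (gradE m τ i U.theta p - θB.d1 (some i) p) * f.val p)| ≤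
      (m.h / 2 * C₀ + 2 * (θB.w2Norm * (τ.dt + n * m.h)) *
        (((2 * halfWidth L H i)⁻¹ + 1) * Real.sqrt (volume.real (cylinder n T L H)))) *
          Real.sqrt f.normSq := by
  have hw := halfWidth_pos hL hH i
  have hd1 : MemLp (θB.d1 (some i)) 2 (volume.restrict (cylinder n T L H)) :=
    (θB.memLp_d1 (some i)).mono_exponent le_top
  have iv := memLp_interp (L := L) (H := H) m τ U.theta 2
  have iΘ := memLp_cellInterp (L := L) (H := H) m τ i U.theta 2
  have iV' := (memLp_gradE (L := L) (H := H) m τ i U.theta 2).sub hd1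
  have i1 : Integrable (fun p => (interp m τ U.theta p - cellInterp m τ i U.theta p) * f.grad i p)
      (volume.restrict (cylinder n T L H)) := (iv.sub iΘ).integrable_mul (f.memLp_grad i)
  have i2 : Integrable (fun p => f.val p * (gradE m τ i U.theta p - θB.d1 (some i) p) +
      f.grad i p * (cellInterp m τ i U.theta p - θB.val p))
      (volume.restrict (cylinder n T L H)) :=
    (f.memLp_val.integrable_mul iV').add ((f.memLp_grad i).integrable_mul (iΘ.sub θB.memLp_val))
  have e : ∫ p in cylinder n T L H, ((interp m τ U.theta p - θB.val p) * f.grad i p +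
      (gradE m τ i U.theta p - θB.d1 (some i) p) * f.val p) =
      (∫ p in cylinder n T L H,
        (interp m τ U.theta p - cellInterp m τ i U.theta p) * f.grad i p) +
      ∫ p in cylinder n T L H, (f.val p * (gradE m τ i U.theta p - θB.d1 (some i) p) +
        f.grad i p * (cellInterp m τ i U.theta p - θB.val p)) := by
    rw [← integral_add i1 i2]
    exact integral_congr_ae (ae_of_all _ fun p => by ring)
  rw [e, add_mul]
  refine (abs_add_le _ _).trans (add_le_add ?_ ?_)
  · refine (abs_integral_mul_le_sqrt (iv.sub iΘ) (f.memLp_grad i)).trans ?_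
    have h1 := integral_sq_interp_sub_cellInterp_le (m := m) (τ := τ) hG i
    exact mul_le_mul h1 (Real.sqrt_le_sqrt (f.integral_sq_grad_le i)) (Real.sqrt_nonneg _)
      ((Real.sqrt_nonneg _).trans h1)
  · refine (abs_integral_cellInterp_sub_le hT hL hH hU i f).trans ?_
    have hμ : (volume.restrict (cylinder n T L H)).real univ =
        volume.real (cylinder n T L H) := by simp
    have hval : ∫ p in cylinder n T L H, |f.val p| ≤
        Real.sqrt (volume.real (cylinder n T L H)) * Real.sqrt f.normSq := by
      refine (integral_abs_le_sqrt f.memLp_val).trans ?_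
      rw [hμ]
      gcongr
      exact f.integral_sq_val_le
    have hgrad : ∫ p in cylinder n T L H, |f.grad i p| ≤
        Real.sqrt (volume.real (cylinder n T L H)) * Real.sqrt f.normSq := by
      refine (integral_abs_le_sqrt (f.memLp_grad i)).trans ?_
      rw [hμ]
      gcongr
      exact f.integral_sq_grad_le i
    have hδ : 0 ≤ θB.w2Norm * (τ.dt + n * m.h) :=
      mul_nonneg θB.w2Norm_nonneg (add_nonneg τ.dt_pos.le
        (mul_nonneg (Nat.cast_nonneg n) m.h_pos.le))
    rw [mul_assoc (2 * _)]
    refine mul_le_mul_of_nonneg_left ?_ (by positivity)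
    rw [mul_assoc, add_mul, one_mul]
    gcongr

theorem temperatureError_eq_sum (θB : BdryTemp n T L H) (U : Trio n)
    (Ψ : Fin (n + 1) → L2W12 n T L H) :
    temperatureError m τ θB U Ψ = ∑ i, ∫ p in cylinder n T L H,
      ((interp m τ U.theta p - θB.val p) * (Ψ i).grad i p +
        (gradE m τ i U.theta p - θB.d1 (some i) p) * (Ψ i).val p) := by
  rw [← integral_finsetSum]
  · refine integral_congr_ae (ae_of_all _ fun p => ?_)
    dsimp only
    rw [Finset.mul_sum, ← Finset.sum_add_distrib]
  · intro i _
    have hd1 : MemLp (θB.d1 (some i)) 2 (volume.restrict (cylinder n T L H)) :=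
      (θB.memLp_d1 (some i)).mono_exponent le_top
    exact (((memLp_interp m τ U.theta 2).sub θB.memLp_val).integrable_mul
      ((Ψ i).memLp_grad i)).add
      (((memLp_gradE m τ i U.theta 2).sub hd1).integrable_mul (Ψ i).memLp_val)

/-- The bounds on the data contained in `Λ ≤ Λ₀`. -/
theorem le_of_lam_le {Λ₀ : ℝ} (hT : 0 < T) (hL : 0 < L) (hH : 0 < H) {θB : BdryTemp n T L H}
    {b : Bounds} {U : Trio n} (hΛ : Lam θB b ≤ Λ₀) (hr : StepRatio m τ b)
    (hb : UniformBounds m τ b U) :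
    T ≤ Λ₀ ∧ θB.w2Norm ≤ Λ₀ ∧ 0 ≤ b.uHi ∧ b.uHi ≤ Λ₀ ∧ b.cHi ≤ Λ₀ := by
  have hh := m.h_pos
  have hcell : (0 : Idx n) ∈ cells n m := by
    rw [mem_cells]
    intro i
    have h1 := m.size_mul i
    have h2 := halfWidth_pos hL hH i
    have h3 : 0 < m.size i := by
      by_contra h0
      rw [Nat.eq_zero_of_not_pos h0] at h1
      simp at h1
      linarith
    exact ⟨le_rfl, Int.natCast_pos.2 h3⟩
  have h1 := hb.rho 0 (Nat.zero_le _) 0 hcell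
  have h2 := hb.theta 0 (Nat.zero_le _) 0 hcell
  have h3 := (Real.sqrt_nonneg _).trans (hb.u 0 (Nat.zero_le _) 0 hcell)
  have h4 := hb.rhoLo_pos
  have h5 := hb.thetaLo_pos
  have h6 := hr.1
  have h7 : 0 ≤ b.cHi := by
    by_contra h0
    have := mul_neg_of_neg_of_pos (not_le.1 h0) hh
    linarith [hr.2.2, τ.dt_pos]
  have h8 := θB.w2Norm_nonneg
  have h9 : 0 < 1 / b.rhoLo := by positivity
  have h10 : 0 < 1 / b.thetaLo := by positivity
  have h11 : 0 < 1 / b.cLo := by positivity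
  unfold Lam at hΛ
  refine ⟨?_, ?_, h3, ?_, ?_⟩ <;> linarith [h1.1, h1.2, h2.1, h2.2]

end Errors

end FV

theorem lemma2p7 (n : ℕ) (hn : n = 1 ∨ n = 2) (L H : ℝ) (hL : 0 < L) (hH : 0 < H)
    (Λ₀ C₀ : ℝ) :
    ∃ C : ℝ, ∀ (α : ℝ), -1 < α → α < 1 →
      ∀ (T : ℝ), 0 < T → ∀ (θB : FV.BdryTemp n T L H) (b : FV.Bounds)
        (m : FV.Mesh L H) (τ : FV.TimeGrid T) (U : FV.Trio n),
        FV.Lam θB b ≤ Λ₀ →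
        FV.StepRatio m τ b →
        FV.IsDiscreteTrio m τ θB U →
        FV.UniformBounds m τ b U →
        FV.GradientBound (L := L) (H := H) m τ C₀ U →
        FV.JumpBound m τ α C₀ U →
        (∀ S : Fin (n + 1) → Fin (n + 1) → FV.L2W12 n T L H,
          (∀ i j, (S i j).val =ᵐ[MeasureTheory.volume.restrict (FV.cylinder n T L H)]
            (S j i).val) →
          |FV.velocityError m τ U S| ≤ C * FV.tensorNorm S * m.h ^ ((1 - α) / 2)) ∧
        (∀ Ψ : Fin (n + 1) → FV.L2W12 n T L H,
          |FV.temperatureError m τ θB U Ψ| ≤ C * FV.vecNorm Ψ * m.h) := by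
  -- `Λ₀ W` bounds the volume of the space-time cylinder
  set W : ℝ := ∏ i : Fin (n + 1), (2 * FV.halfWidth L H i) with hW
  set C₁ : ℝ := (n + 1) * ((n + 1) * Real.sqrt (3 / 2 * C₀ + 4 * C₀ ^ 2 +
    Λ₀ * W * Λ₀ ^ 2 / (2 * H ^ 2))) with hC₁
  set C₂ : ℝ := ∑ i : Fin (n + 1), (1 / 2 * C₀ + 2 * (Λ₀ * (Λ₀ + n)) *
    (((2 * FV.halfWidth L H i)⁻¹ + 1) * Real.sqrt (Λ₀ * W))) with hC₂
  refine ⟨max C₁ C₂, ?_⟩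
  intro α hα _ T hT θB b m τ U hΛ hr hU hb hG hJ
  have hh := m.h_pos
  obtain ⟨hTΛ, hBΛ, hu0, huΛ, hcΛ⟩ := FV.le_of_lam_le hT hL hH hΛ hr hb
  have hWpos : 0 < W := Finset.prod_pos fun i _ => by
    have := FV.halfWidth_pos hL hH i
    positivity
  have hΛ0 : 0 ≤ Λ₀ := hT.le.trans hTΛ
  have hvol : volume.real (FV.cylinder n T L H) ≤ Λ₀ * W := by
    rw [FV.volume_real_cylinder hT hL hH]
    gcongr
  constructor
  · intro S hS
    have hpow : 0 ≤ m.h ^ ((1 - α) / 2) := (Real.rpow_pos_of_pos hh _).le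
    have hN : 0 ≤ FV.tensorNorm S := Real.sqrt_nonneg _
    have hK : Real.sqrt (3 / 2 * C₀ + 4 * C₀ ^ 2 +
        volume.real (FV.cylinder n T L H) * b.uHi ^ 2 / (2 * H ^ 2)) ≤
        Real.sqrt (3 / 2 * C₀ + 4 * C₀ ^ 2 + Λ₀ * W * Λ₀ ^ 2 / (2 * H ^ 2)) := by
      refine Real.sqrt_le_sqrt ?_
      gcongr
    have hterm : ∀ i j : Fin (n + 1), |∫ p in FV.cylinder n T L H,
        (FV.interp m τ (fun k => U.u k i) p * (S i j).grad j p +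
          FV.interp m τ (fun k => FV.gradH m j (U.u k i)) p * (S i j).val p)| ≤
        Real.sqrt (3 / 2 * C₀ + 4 * C₀ ^ 2 + Λ₀ * W * Λ₀ ^ 2 / (2 * H ^ 2)) *
          m.h ^ ((1 - α) / 2) * FV.tensorNorm S := by
      intro i j
      refine (FV.abs_velocity_component_le hL hH hα hU hb hG hJ i j (S i j)).trans ?_
      have := FV.sqrt_normSq_le_tensorNorm S i j
      gcongr
    rw [FV.velocityError_eq_sum U hS]
    calc _ ≤ ∑ _i : Fin (n + 1), ∑ _j : Fin (n + 1),
          Real.sqrt (3 / 2 * C₀ + 4 * C₀ ^ 2 + Λ₀ * W * Λ₀ ^ 2 / (2 * H ^ 2)) *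
          m.h ^ ((1 - α) / 2) * FV.tensorNorm S :=
          (Finset.abs_sum_le_sum_abs _ _).trans (Finset.sum_le_sum fun i _ =>
            (Finset.abs_sum_le_sum_abs _ _).trans (Finset.sum_le_sum fun j _ => hterm i j))
      _ = C₁ * FV.tensorNorm S * m.h ^ ((1 - α) / 2) := by
          simp only [Finset.sum_const, Finset.card_univ, Fintype.card_fin, nsmul_eq_mul, hC₁]
          push_cast
          ring
      _ ≤ _ := by
          gcongr
          exact le_max_left _ _
  · intro Ψ
    have hN : 0 ≤ FV.vecNorm Ψ := Real.sqrt_nonneg _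
    have hC₀ : 0 ≤ C₀ :=
      (add_nonneg (Real.sqrt_nonneg _) (Real.sqrt_nonneg _)).trans hG
    have hdt : τ.dt + n * m.h ≤ (Λ₀ + n) * m.h := by
      have := hr.2.2.trans (mul_le_mul_of_nonneg_right hcΛ hh.le)
      linarith
    have hdt0 : 0 ≤ τ.dt + n * m.h :=
      add_nonneg τ.dt_pos.le (mul_nonneg (Nat.cast_nonneg n) hh.le)
    rw [FV.temperatureError_eq_sum]
    calc _ ≤ ∑ i : Fin (n + 1), (1 / 2 * C₀ + 2 * (Λ₀ * (Λ₀ + n)) *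
          (((2 * FV.halfWidth L H i)⁻¹ + 1) * Real.sqrt (Λ₀ * W))) *
            (FV.vecNorm Ψ * m.h) := by
          refine (Finset.abs_sum_le_sum_abs _ _).trans (Finset.sum_le_sum fun i _ => ?_)
          refine (FV.abs_temperature_component_le hT hL hH hU hG i (Ψ i)).trans ?_
          have hw := FV.halfWidth_pos hL hH i
          have h1 : θB.w2Norm * (τ.dt + n * m.h) ≤ Λ₀ * ((Λ₀ + n) * m.h) := by
            gcongr
          have h2 := FV.sqrt_normSq_le_vecNorm Ψ i
          calc _ ≤ (m.h / 2 * C₀ + 2 * (Λ₀ * ((Λ₀ + n) * m.h)) *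
                (((2 * FV.halfWidth L H i)⁻¹ + 1) * Real.sqrt (Λ₀ * W))) * FV.vecNorm Ψ := by
                gcongr
            _ = _ := by ring
      _ = C₂ * FV.vecNorm Ψ * m.h := by
          rw [← Finset.sum_mul, hC₂]
          ring
      _ ≤ _ := by
          gcongr
          exact le_max_right _ _
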